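/- Let $\lambda\ge 0$. Write $(a)_n=a(a+1)\cdots(a+n-1)$, $\mathbb D=\{z\in\mathbb C:|z|<1\}$, $$\epsilon_n=\sqrt{\frac{n!}{(2\lambda+1)_n}},\qquad \phi_n(z)=\epsilon_n\sum_{j=0}^n\frac{(\lambda)_j(\lambda+1)_{n-j}}{j!\,(n-j)!}\,\bar z^{\,j}z^{n-j}\qquad(n\ge0),$$ $$dm_\lambda(\varphi)=\frac{c_\lambda}{2\lambda+2}|\sin\varphi|^{2\lambda}\,d\varphi\ \text{ on } (-\pi,\pi],\qquad c_\lambda=\frac{\Gamma(\lambda+2)}{\Gamma(\lambda+\frac12)\Gamma(\frac12)}.$$ For $\alpha>-1$ and $\beta>-2\lambda-2$ define, for $|zw|<1$, $$K_{\lambda,\alpha}(z,w)=\sum_{n=0}^\infty\frac{\Gamma(\lambda+1)\Gamma(n+\lambda+\alpha+2)}{\Gamma(\lambda+\alpha+2)\Gamma(n+\lambda+1)}\phi_n(z)\phi_n(w),\qquad \tilde K_{\lambda,\beta}(z,w)=\sum_{n=0}^\infty\frac{\Gamma(n+\beta+2\lambda+2)}{\Gamma(n+2\lambda+2)}\phi_n(z)\overline{\phi_n(w)};$$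 both series converge absolutely. Put $a=|1-z\bar w|$ and $b=|1-zw|$. Below, $X\lesssim Y$ means $X\le C\,Y$ with a constant $C>0$ that depends only on the parameters among $\lambda,\alpha,\beta,p$ that occur in the estimate, and not on $z,w,s$. (A) For every $\alpha>-1$, $$|K_{\lambda,\alpha}(z,w)|\lesssim b^{-1}(a+b)^{-2\lambda}\left(a^{-\alpha-1}+b^{-\alpha-1}\right),\qquad z,w\in\mathbb D.$$ (B) Let $0<p\le1$ and $\alpha>(2\lambda+1)(p^{-1}-1)-1$. For all $z\in\mathbb D$, $s\in[0,1)$ the function $\varphi\mapsto|K_{\lambda,\alpha}(z,se^{i\varphi})|^p$ is $m_\lambda$-integrable and $$\int_{-\pi}^{\pi}|K_{\lambda,\alpha}(z,se^{i\varphi})|^p\,dm_\lambda(\varphi)\lesssim\frac{|1-s^2z^2|^{2\lambda(1-p)}}{(1-s|z|)^{(2+\alpha)p-1}}.$$ (C) For $z,w\in\mathbb D$: (i) if $\beta>0$, then $|\tilde K_{\lambda,\beta}(z,w)|\lesssim (a+b)^{-2\lambda}a^{-1}\left(a^{-\beta}+b^{-\beta}\right)$; (ii) $|\tilde K_{\lambda,0}(z,w)|\lesssim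 (a+b)^{-2\lambda}a^{-1}\ln\left(\frac ab+2\right)$; (iii) if $-1<\beta<0$, then $|\tilde K_{\lambda,\beta}(z,w)|\lesssim (a+b)^{-2\lambda}a^{-\beta-1}$; (iv) if $\lambda>0$, then $|\tilde K_{\lambda,-1}(z,w)|\lesssim (a+b)^{-2\lambda}\ln\left(\frac ba+2\right)$; (v) if $-2\lambda-1<\beta<-1$, then $|\tilde K_{\lambda,\beta}(z,w)|\lesssim (a+b)^{-\beta-2\lambda-1}$; (vi) if $\lambda>0$, then $|\tilde K_{\lambda,-2\lambda-1}(z,w)|\lesssim \ln\left(\frac1{a+b}+2\right)$; (vii) if $-2\lambda-2<\beta<-2\lambda-1$, then the series of $\tilde K_{\lambda,\beta}(z,w)$ converges absolutely for all $z,w\in\mathbb C$ with $|zw|\le1$, and $\tilde K_{\lambda,\beta}$ is continuous on $\{(z,w)\in\mathbb C^2:|zw|\le1\}$. -/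

import Mathlib

noncomputable section

namespace DunklDisk

open scoped ComplexConjugate

/-- The Pochhammer symbol `(a)_n = a (a + 1) ⋯ (a + n - 1)` of a real number. -/
def poch (a : ℝ) (n : ℕ) : ℝ := (ascPochhammer ℝ n).eval a

/-- The normalizing constant `ε_n = √(n! / (2 lam + 1)_n)`. -/
def eps (lam : ℝ) (n : ℕ) : ℝ := Real.sqrt ((n.factorial : ℝ) / poch (2 * lam + 1) n)

/-- The basic lam-analytic polynomial
`φ_n(z) = ε_n ∑_{j=0}^n (lam)_j (lam+1)_{n-j} / (j! (n-j)!) * z̄^j * z^(n-j)`. -/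
def phi (lam : ℝ) (n : ℕ) (z : ℂ) : ℂ :=
  (eps lam n : ℂ) * ∑ j ∈ Finset.range (n + 1),
    ((poch lam j * poch (lam + 1) (n - j) /
      ((j.factorial : ℝ) * ((n - j).factorial : ℝ)) : ℝ) : ℂ) * (conj z) ^ j * z ^ (n - j)

/-- The `n`-th term of the series of the (lam, α)-Bergman kernel. -/
def bergmanTerm (lam α : ℝ) (z w : ℂ) (n : ℕ) : ℂ :=
  ((Real.Gamma (lam + 1) * Real.Gamma ((n : ℝ) + lam + α + 2) /
      (Real.Gamma (lam + α + 2) * Real.Gamma ((n : ℝ) + lam + 1)) : ℝ) : ℂ)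
    * phi lam n z * phi lam n w

/-- The (lam, α)-Bergman kernel `K_{lam,α}(z, w)`, for `|z w| < 1`. -/
def bergmanKernel (lam α : ℝ) (z w : ℂ) : ℂ := ∑' n : ℕ, bergmanTerm lam α z w n

/-- The `n`-th term of the series of the variant kernel `K̃_{lam,β}`. -/
def variantTerm (lam β : ℝ) (z w : ℂ) (n : ℕ) : ℂ :=
  ((Real.Gamma ((n : ℝ) + β + 2 * lam + 2) / Real.Gamma ((n : ℝ) + 2 * lam + 2) : ℝ) : ℂ)
    * phi lam n z * conj (phi lam n w)

/-- The variant kernel `K̃_{lam,β}(z, w)`. -/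
def variantKernel (lam β : ℝ) (z w : ℂ) : ℂ := ∑' n : ℕ, variantTerm lam β z w n

/-- The constant `c_lam = Γ(lam + 2) / (Γ(lam + 1/2) Γ(1/2))`, which gives the measure
`c_lam |y|^(2 lam) dx dy` on the unit disk total mass one. -/
def diskConst (lam : ℝ) : ℝ :=
  Real.Gamma (lam + 2) / (Real.Gamma (lam + 1 / 2) * Real.Gamma (1 / 2))

/-- The measure `dm_lam(φ) = c_lam / (2 lam + 2) * |sin φ|^(2 lam) dφ` on the circle,
parametrized by the angle `φ ∈ (-π, π]`. -/
def circleMeasure (lam : ℝ) : MeasureTheory.Measure ℝ :=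
  (MeasureTheory.volume.restrict (Set.Ioc (-Real.pi) Real.pi)).withDensity
    fun φ => ENNReal.ofReal (diskConst lam / (2 * lam + 2) * |Real.sin φ| ^ (2 * lam))

end DunklDisk

end

/-!
The kernels are series `∑ c_n φ_n(z) conj φ_n(w)` (with `w̄` in place of `w` for the Bergman kernel)
whose weights `c_n = Γ(n + γ + β) / Γ(n + γ)` (`gammaRatio`) behave like `n ^ β`. Write
`a = |1 - z w̄|` and `b = |1 - z w|`.

The estimates rest on a product formula (`phi_mul_conj_phi`): `φ_n(z) conj φ_n(w)` is the average,
over the Beta distribution of `s` with parameters `lam + 1` and `lam`, of the coefficient of `t ^ n`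
in `(1 - t z w̄)⁻¹ |1 - t ζ_s| ^ (-2 lam)`. Here `ζ_s` (`mixPoint`) is a point of the disk for which
`|1 - t ζ_s| ^ 2` is the convex combination of `|1 - t z w̄| ^ 2` and `|1 - t z w| ^ 2` with weights
`1 - s` and `s`. To see this, `φ_n(z)` is written as a Beta average of `(q z + (1 - q) z̄) ^ n`,
which gives the generating function of `φ_n(z) conj φ_n(w)` as a Beta integral in `q`; a Möbius
substitution (`mobius_beta_integral_of_ray`) and analytic continuation (`mobius_beta_integral`) turn
this integral into the one in `s`.

It remains to estimate, for fixed `s`, the sum of `c_n` times the coefficients of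
`(1 - t ξ)⁻¹ |1 - t ζ| ^ (-2 lam)`. The weight `c_n` is a polynomial `(n + γ)_m` times a Beta
integral of `t ^ n` (`gammaRatio_eq_integral`). The polynomial acts through the Euler operator
`t d/dt`, which raises one of the exponents by one for each factor
(`exists_norm_tsum_poch_mul_coeff_le`), and the power `t ^ n` replaces `ξ`, `ζ` by `t ξ`, `t ζ`. So
the sum is bounded by an elementary integral over the radius (`radialIntegral`,
`exists_norm_tsum_gammaRatio_le`). Averaging its bounds over `s` leads to the negative moments of
`|1 - ζ_s|` (`mixMoment`); their behaviour changes at the exponent `2 lam`. The regimes of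
these two integrals give the cases in `β`.

The mean estimate follows from the pointwise bound of the Bergman kernel: since `|sin φ| ≤ a + b`,
the density `|sin φ| ^ (2 lam)` absorbs the factor `(a + b) ^ (-2 lam p)` and leaves
`|sin φ| ^ (2 lam (1 - p))`; and `|sin φ| ≤ |1 - s ^ 2 z ^ 2| + min a b`, so that only the standard
means of `|1 - ζ e^{iφ}| ^ (-q)` with `q > 1` remain. For `β < -2 lam - 1` the series of the variant
kernel is dominated by the summable differences of the coefficients of `(1 - t) ^ (-x)`,
`x = β + 2 lam + 2 < 1`.
-/

noncomputable section

namespace DunklDisk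

open scoped ComplexConjugate Topology
open MeasureTheory Set

/-! ### Pochhammer symbols and binomial series -/

lemma poch_zero (a : ℝ) : poch a 0 = 1 := by simp [poch]

lemma poch_succ (a : ℝ) (n : ℕ) : poch a (n + 1) = poch a n * (a + n) := by
  simp [poch, ascPochhammer_succ_eval]

lemma poch_succ_left (a : ℝ) (n : ℕ) : poch a (n + 1) = a * poch (a + 1) n := by
  simp [poch, ascPochhammer_succ_left, Polynomial.eval_comp]

lemma poch_pos {a : ℝ} (ha : 0 < a) (n : ℕ) : 0 < poch a n := ascPochhammer_pos n a ha

lemma poch_nonneg {a : ℝ} (ha : 0 ≤ a) (n : ℕ) : 0 ≤ poch a n := by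
  induction n with
  | zero => simp [poch_zero]
  | succ n ih => rw [poch_succ]; positivity

lemma poch_zero_succ (n : ℕ) : poch 0 (n + 1) = 0 := by simp [poch_succ_left]

lemma Gamma_add_nat {a : ℝ} (ha : 0 < a) (n : ℕ) :
    Real.Gamma (a + n) = poch a n * Real.Gamma a := by
  induction n with
  | zero => simp [poch_zero]
  | succ n ih =>
    have h : a + n ≠ 0 := by positivity
    rw [Nat.cast_succ, ← add_assoc, Real.Gamma_add_one h, ih, poch_succ]; ring

/-- The coefficient `(μ)_n / n!` of `t ^ n` in `(1 - t) ^ (-μ)`. -/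
def binomCoeff (μ : ℝ) (n : ℕ) : ℝ := poch μ n / n.factorial

lemma binomCoeff_nonneg {μ : ℝ} (h : 0 ≤ μ) (n : ℕ) : 0 ≤ binomCoeff μ n :=
  div_nonneg (poch_nonneg h n) (by positivity)

lemma binomCoeff_succ (μ : ℝ) (n : ℕ) :
    binomCoeff μ (n + 1) * (n + 1) = binomCoeff μ n * (μ + n) := by
  have : (n.factorial : ℝ) ≠ 0 := by positivity
  simp only [binomCoeff, poch_succ, Nat.factorial_succ]
  push_cast
  field_simp

lemma binomCoeff_add_one (μ : ℝ) (n : ℕ) :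
    (μ + n) * binomCoeff μ n = μ * binomCoeff (μ + 1) n := by
  have h : poch μ n * (μ + n) = μ * poch (μ + 1) n := by rw [← poch_succ, poch_succ_left]
  simp only [binomCoeff, mul_div_assoc']
  rw [← h, mul_comm]

/-- The binomial power series `(1 - t x) ^ (-μ) = ∑ (μ)_n / n! * x ^ n * t ^ n` in `t`. -/
def binomSeries (μ : ℝ) (x : ℂ) : PowerSeries ℂ :=
  PowerSeries.mk fun n => (binomCoeff μ n : ℂ) * x ^ n

lemma coeff_binomSeries (μ : ℝ) (x : ℂ) (n : ℕ) :
    PowerSeries.coeff n (binomSeries μ x) = (binomCoeff μ n : ℂ) * x ^ n := by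
  simp [binomSeries]

lemma choose_eq_binomCoeff (μ : ℝ) (n : ℕ) :
    Ring.choose ((μ : ℂ) + n - 1) n = (binomCoeff μ n : ℂ) := by
  have h1 : Ring.multichoose (μ : ℂ) n = Ring.choose ((μ : ℂ) + n - 1) n := by
    rw [Ring.choose]; congr 1; ring
  rw [← h1]
  have h2 := Ring.factorial_nsmul_multichoose_eq_ascPochhammer (μ : ℂ) n
  have h3 : (ascPochhammer ℕ n).smeval (μ : ℂ) = (poch μ n : ℂ) := by
    rw [Polynomial.ascPochhammer_smeval_eq_eval, poch]
    rw [← Complex.ofRealHom_eq_coe, ← Complex.ofRealHom_eq_coe, ← Polynomial.eval_map_apply,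
      ascPochhammer_map]
  rw [h3, nsmul_eq_mul] at h2
  have h4 : (n.factorial : ℂ) ≠ 0 := by exact_mod_cast n.factorial_ne_zero
  rw [binomCoeff, Complex.ofReal_div, ← h2, Complex.ofReal_natCast]
  field_simp

lemma hasSum_binomSeries (μ : ℝ) {x : ℂ} (hx : ‖x‖ < 1) :
    HasSum (fun n => PowerSeries.coeff n (binomSeries μ x)) ((1 - x) ^ (-(μ : ℂ))) := by
  have h := (Complex.one_div_one_sub_cpow_hasFPowerSeriesOnBall_zero (μ : ℂ)).hasSum
    (y := x) (by rw [← ENNReal.ofReal_one, Metric.eball_ofReal]; simpa using hx)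
  simpa [coeff_binomSeries, choose_eq_binomCoeff, Complex.cpow_neg, mul_comm,
    FormalMultilinearSeries.ofScalars_apply_eq] using h

lemma hasSum_coeff_mul {f g : PowerSeries ℂ} {A B : ℂ}
    (hf : HasSum (fun n => PowerSeries.coeff n f) A)
    (hg : HasSum (fun n => PowerSeries.coeff n g) B) :
    HasSum (fun n => PowerSeries.coeff n (f * g)) (A * B) := by
  have hf' := hf.summable.norm
  have hg' := hg.summable.norm
  have hs := summable_norm_sum_mul_antidiagonal_of_summable_norm hf' hg'
  have ht := tsum_mul_tsum_eq_tsum_sum_antidiagonal_of_summable_norm hf' hg'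
  rw [hf.tsum_eq, hg.tsum_eq] at ht
  simp only [PowerSeries.coeff_mul]
  rw [ht]
  exact hs.of_norm.hasSum

/-! ### Weighted sums of coefficients of products of three binomial series -/

/-- The product `(1 - t ξ) ^ (-μ₁) (1 - t ζ) ^ (-μ₂) (1 - t η) ^ (-μ₃)` as a power series in `t`. -/
def tripleSeries (μ₁ μ₂ μ₃ : ℝ) (ξ ζ η : ℂ) : PowerSeries ℂ :=
  binomSeries μ₁ ξ * binomSeries μ₂ ζ * binomSeries μ₃ η

lemma hasSum_tripleSeries (μ₁ μ₂ μ₃ : ℝ) {ξ ζ η : ℂ} (hξ : ‖ξ‖ < 1) (hζ : ‖ζ‖ < 1)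
    (hη : ‖η‖ < 1) :
    HasSum (fun n => PowerSeries.coeff n (tripleSeries μ₁ μ₂ μ₃ ξ ζ η))
      ((1 - ξ) ^ (-(μ₁ : ℂ)) * (1 - ζ) ^ (-(μ₂ : ℂ)) * (1 - η) ^ (-(μ₃ : ℂ))) :=
  hasSum_coeff_mul (hasSum_coeff_mul (hasSum_binomSeries _ hξ) (hasSum_binomSeries _ hζ))
    (hasSum_binomSeries _ hη)

/-- The Euler operator `t d/dt` on power series. -/
def euler (f : PowerSeries ℂ) : PowerSeries ℂ :=
  PowerSeries.X * PowerSeries.derivative ℂ f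

lemma coeff_euler (f : PowerSeries ℂ) (n : ℕ) :
    PowerSeries.coeff n (euler f) = n * PowerSeries.coeff n f := by
  cases n with
  | zero => simp [euler]
  | succ n =>
    rw [euler, PowerSeries.coeff_succ_X_mul, PowerSeries.coeff_derivative]; push_cast; ring

lemma euler_mul (f g : PowerSeries ℂ) : euler (f * g) = euler f * g + f * euler g := by
  simp only [euler, Derivation.leibniz, smul_eq_mul]; ring

lemma euler_binomSeries (μ : ℝ) (x : ℂ) :
    euler (binomSeries μ x) =
      PowerSeries.C (μ : ℂ) * (binomSeries (μ + 1) x - binomSeries μ x) := by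
  ext n
  rw [coeff_euler, PowerSeries.coeff_C_mul, map_sub, coeff_binomSeries, coeff_binomSeries]
  have h := congrArg (fun r : ℝ => (r : ℂ)) (binomCoeff_add_one μ n)
  push_cast at h
  linear_combination x ^ n * h

/-- Multiplying the `n`-th coefficient by `n + γ` raises one of the exponents by one. -/
lemma add_mul_coeff_tripleSeries (γ μ₁ μ₂ μ₃ : ℝ) (ξ ζ η : ℂ) (n : ℕ) :
    ((n + γ : ℝ) : ℂ) * PowerSeries.coeff n (tripleSeries μ₁ μ₂ μ₃ ξ ζ η) =
      ((γ - μ₁ - μ₂ - μ₃ : ℝ) : ℂ) * PowerSeries.coeff n (tripleSeries μ₁ μ₂ μ₃ ξ ζ η) +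
      μ₁ * PowerSeries.coeff n (tripleSeries (μ₁ + 1) μ₂ μ₃ ξ ζ η) +
      μ₂ * PowerSeries.coeff n (tripleSeries μ₁ (μ₂ + 1) μ₃ ξ ζ η) +
      μ₃ * PowerSeries.coeff n (tripleSeries μ₁ μ₂ (μ₃ + 1) ξ ζ η) := by
  have h : euler (tripleSeries μ₁ μ₂ μ₃ ξ ζ η) =
      PowerSeries.C (μ₁ : ℂ) * tripleSeries (μ₁ + 1) μ₂ μ₃ ξ ζ η +
      PowerSeries.C (μ₂ : ℂ) * tripleSeries μ₁ (μ₂ + 1) μ₃ ξ ζ η +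
      PowerSeries.C (μ₃ : ℂ) * tripleSeries μ₁ μ₂ (μ₃ + 1) ξ ζ η -
      PowerSeries.C (μ₁ + μ₂ + μ₃ : ℂ) * tripleSeries μ₁ μ₂ μ₃ ξ ζ η := by
    simp only [tripleSeries, euler_mul, euler_binomSeries, map_add]; ring
  have h' := congrArg (PowerSeries.coeff n) h
  rw [coeff_euler] at h'
  simp only [map_add, map_sub, PowerSeries.coeff_C_mul] at h'
  push_cast
  simp only [← map_add, PowerSeries.coeff_C_mul] at h'
  linear_combination h'

lemma one_sub_ne_zero_of_norm_lt {x : ℂ} (hx : ‖x‖ < 1) : 1 - x ≠ 0 := by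
  intro h
  rw [sub_eq_zero] at h
  rw [← h] at hx; simp at hx

lemma norm_one_sub_pos {x : ℂ} (hx : ‖x‖ < 1) : 0 < ‖1 - x‖ :=
  norm_pos_iff.mpr (one_sub_ne_zero_of_norm_lt hx)

lemma norm_one_sub_le_two {x : ℂ} (hx : ‖x‖ ≤ 1) : ‖1 - x‖ ≤ 2 := by
  have := norm_sub_le (1 : ℂ) x
  simp at this; linarith

/-- Every factor `n + γ + i` put into the sum of the coefficients of `tripleSeries` costs at most a
factor `1 / min ‖1 - ξ‖ ‖1 - ζ‖`: by `add_mul_coeff_tripleSeries` it is traded for an exponent that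
is larger by one. -/
theorem exists_norm_tsum_poch_mul_coeff_le (m : ℕ) : ∀ γ μ₁ μ₂ μ₃ : ℝ, ∃ C : ℝ, 0 < C ∧
    ∀ ξ ζ η : ℂ, ‖ξ‖ < 1 → ‖ζ‖ < 1 → ‖η‖ < 1 → ‖1 - η‖ = ‖1 - ζ‖ →
      (Summable fun n : ℕ =>
        (poch (n + γ) m : ℂ) * PowerSeries.coeff n (tripleSeries μ₁ μ₂ μ₃ ξ ζ η)) ∧
      ‖∑' n : ℕ, (poch (n + γ) m : ℂ) * PowerSeries.coeff n (tripleSeries μ₁ μ₂ μ₃ ξ ζ η)‖ ≤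
        C * (‖1 - ξ‖ ^ (-μ₁) * ‖1 - ζ‖ ^ (-(μ₂ + μ₃)) * min ‖1 - ξ‖ ‖1 - ζ‖ ^ (-(m : ℝ))) := by
  induction m with
  | zero =>
    intro γ μ₁ μ₂ μ₃
    refine ⟨1, one_pos, fun ξ ζ η hξ hζ hη he => ?_⟩
    have h := hasSum_tripleSeries μ₁ μ₂ μ₃ hξ hζ hη
    simp only [poch_zero, Complex.ofReal_one, one_mul]
    refine ⟨h.summable, ?_⟩
    rw [h.tsum_eq]
    simp only [norm_mul, ← Complex.ofReal_neg, Complex.norm_cpow_real, he]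
    rw [mul_assoc, ← Real.rpow_add (norm_one_sub_pos hζ)]
    simp
    rw [add_comm]
  | succ m ih =>
    intro γ μ₁ μ₂ μ₃
    obtain ⟨C₀, hC₀, h₀⟩ := ih (γ + 1) μ₁ μ₂ μ₃
    obtain ⟨C₁, hC₁, h₁⟩ := ih (γ + 1) (μ₁ + 1) μ₂ μ₃
    obtain ⟨C₂, hC₂, h₂⟩ := ih (γ + 1) μ₁ (μ₂ + 1) μ₃
    obtain ⟨C₃, hC₃, h₃⟩ := ih (γ + 1) μ₁ μ₂ (μ₃ + 1)
    refine ⟨|γ - μ₁ - μ₂ - μ₃| * (2 * C₀) + |μ₁| * C₁ + |μ₂| * C₂ + |μ₃| * C₃ + 1, by positivity,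
      fun ξ ζ η hξ hζ hη he => ?_⟩
    obtain ⟨s₀, b₀⟩ := h₀ ξ ζ η hξ hζ hη he
    obtain ⟨s₁, b₁⟩ := h₁ ξ ζ η hξ hζ hη he
    obtain ⟨s₂, b₂⟩ := h₂ ξ ζ η hξ hζ hη he
    obtain ⟨s₃, b₃⟩ := h₃ ξ ζ η hξ hζ hη he
    have key := (((s₀.hasSum.mul_left ((γ - μ₁ - μ₂ - μ₃ : ℝ) : ℂ)).add
      (s₁.hasSum.mul_left (μ₁ : ℂ))).add (s₂.hasSum.mul_left (μ₂ : ℂ))).add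
      (s₃.hasSum.mul_left (μ₃ : ℂ))
    have hterm : (fun n : ℕ => (poch (n + γ) (m + 1) : ℂ) *
        PowerSeries.coeff n (tripleSeries μ₁ μ₂ μ₃ ξ ζ η)) = fun n : ℕ =>
        ((γ - μ₁ - μ₂ - μ₃ : ℝ) : ℂ) * ((poch (n + (γ + 1)) m : ℂ) *
          PowerSeries.coeff n (tripleSeries μ₁ μ₂ μ₃ ξ ζ η)) +
        μ₁ * ((poch (n + (γ + 1)) m : ℂ) *
          PowerSeries.coeff n (tripleSeries (μ₁ + 1) μ₂ μ₃ ξ ζ η)) +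
        μ₂ * ((poch (n + (γ + 1)) m : ℂ) *
          PowerSeries.coeff n (tripleSeries μ₁ (μ₂ + 1) μ₃ ξ ζ η)) +
        μ₃ * ((poch (n + (γ + 1)) m : ℂ) *
          PowerSeries.coeff n (tripleSeries μ₁ μ₂ (μ₃ + 1) ξ ζ η)) := by
      funext n
      have hc := add_mul_coeff_tripleSeries γ μ₁ μ₂ μ₃ ξ ζ η n
      rw [poch_succ_left, Complex.ofReal_mul, add_assoc]
      linear_combination (poch (n + (γ + 1)) m : ℂ) * hc
    rw [hterm]
    refine ⟨key.summable, ?_⟩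
    rw [key.tsum_eq]
    set a := ‖1 - ξ‖ with ha
    set r := ‖1 - ζ‖ with hr
    have ha0 : 0 < a := norm_one_sub_pos hξ
    have hr0 : 0 < r := norm_one_sub_pos hζ
    have ha2 : a ≤ 2 := norm_one_sub_le_two hξ.le
    set d := min a r with hd
    have hd0 : 0 < d := lt_min ha0 hr0
    have hda : d ≤ a := min_le_left _ _
    have hdr : d ≤ r := min_le_right _ _
    have hdpow : d ^ (-((m + 1 : ℕ) : ℝ)) = d ^ (-(m : ℝ)) * d⁻¹ := by
      rw [← Real.rpow_neg_one, ← Real.rpow_add hd0]; push_cast; ring_nf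
    set W := a ^ (-μ₁) * r ^ (-(μ₂ + μ₃)) * d ^ (-(m : ℝ)) with hW
    have hW0 : 0 < W := by positivity
    have e1 : a ^ (-(μ₁ + 1)) = a ^ (-μ₁) * a⁻¹ := by
      rw [← Real.rpow_neg_one, ← Real.rpow_add ha0]; ring_nf
    have e2 : r ^ (-(μ₂ + 1 + μ₃)) = r ^ (-(μ₂ + μ₃)) * r⁻¹ := by
      rw [← Real.rpow_neg_one, ← Real.rpow_add hr0]; ring_nf
    have e3 : r ^ (-(μ₂ + (μ₃ + 1))) = r ^ (-(μ₂ + μ₃)) * r⁻¹ := by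
      rw [← Real.rpow_neg_one, ← Real.rpow_add hr0]; ring_nf
    rw [e1] at b₁
    rw [e2] at b₂
    rw [e3] at b₃
    have ia : a⁻¹ ≤ d⁻¹ := inv_anti₀ hd0 hda
    have ir : r⁻¹ ≤ d⁻¹ := inv_anti₀ hd0 hdr
    have i2 : (1 : ℝ) ≤ 2 * d⁻¹ := by
      rw [← div_eq_mul_inv, le_div_iff₀ hd0]; linarith
    have hB : ∀ (c X Y : ℝ) (T : ℂ), ‖T‖ ≤ X → X ≤ Y → ‖(c : ℂ) * T‖ ≤ |c| * Y := by
      intro c X Y T h h'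
      rw [norm_mul, Complex.norm_real, Real.norm_eq_abs]
      exact mul_le_mul_of_nonneg_left (h.trans h') (abs_nonneg _)
    have B₀ := hB (γ - μ₁ - μ₂ - μ₃) _ (2 * C₀ * (W * d⁻¹)) _ b₀ <| by
      calc C₀ * W = C₀ * W * 1 := by ring
        _ ≤ C₀ * W * (2 * d⁻¹) := by gcongr
        _ = _ := by ring
    have B₁ := hB μ₁ _ (C₁ * (W * d⁻¹)) _ b₁ <| by
      calc _ = C₁ * (W * a⁻¹) := by rw [hW]; ring
        _ ≤ _ := by gcongr
    have B₂ := hB μ₂ _ (C₂ * (W * d⁻¹)) _ b₂ <| by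
      calc _ = C₂ * (W * r⁻¹) := by rw [hW]; ring
        _ ≤ _ := by gcongr
    have B₃ := hB μ₃ _ (C₃ * (W * d⁻¹)) _ b₃ <| by
      calc _ = C₃ * (W * r⁻¹) := by rw [hW]; ring
        _ ≤ _ := by gcongr
    have hT : a ^ (-μ₁) * r ^ (-(μ₂ + μ₃)) * d ^ (-((m + 1 : ℕ) : ℝ)) = W * d⁻¹ := by
      rw [hdpow, hW]; ring
    rw [hT]
    have hWd : 0 < W * d⁻¹ := by positivity
    refine (norm_add_le _ _).trans ((add_le_add (norm_add_le _ _) le_rfl).trans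
      ((add_le_add (add_le_add (norm_add_le _ _) le_rfl) le_rfl).trans ?_))
    linarith [B₀, B₁, B₂, B₃, hWd]

/-! ### Quotients of Gamma functions and the Beta integral -/

lemma integrableOn_beta {p q : ℝ} (hp : 0 < p) (hq : 0 < q) :
    IntegrableOn (fun t : ℝ => t ^ (p - 1) * (1 - t) ^ (q - 1)) (Ioo 0 1) := by
  have h := (Complex.betaIntegral_convergent (u := p) (v := q) (by simpa) (by simpa)).norm
  rw [intervalIntegrable_iff_integrableOn_Ioo_of_le zero_le_one] at h
  refine h.congr_fun (fun t ht => ?_) measurableSet_Ioo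
  have h1 : 0 < 1 - t := by linarith [ht.2]
  have e1 : ((p : ℂ) - 1) = ((p - 1 : ℝ) : ℂ) := by push_cast; rfl
  have e2 : ((q : ℂ) - 1) = ((q - 1 : ℝ) : ℂ) := by push_cast; rfl
  have e3 : (1 : ℂ) - t = ((1 - t : ℝ) : ℂ) := by push_cast; rfl
  simp only [norm_mul, e1, e2, e3, Complex.norm_cpow_real, Complex.norm_real, Real.norm_eq_abs,
    abs_of_pos ht.1, abs_of_pos h1]

lemma integral_beta {p q : ℝ} (hp : 0 < p) (hq : 0 < q) :
    ∫ t in Ioo (0 : ℝ) 1, t ^ (p - 1) * (1 - t) ^ (q - 1) =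
      Real.Gamma p * Real.Gamma q / Real.Gamma (p + q) := by
  have h := ProbabilityTheory.beta_eq_betaIntegralReal p q hp hq
  rw [ProbabilityTheory.beta] at h
  rw [h, Complex.betaIntegral, intervalIntegral.integral_of_le zero_le_one,
    integral_Ioc_eq_integral_Ioo]
  have h2 : ∫ t in Ioo (0 : ℝ) 1, (t : ℂ) ^ ((p : ℂ) - 1) * (1 - (t : ℂ)) ^ ((q : ℂ) - 1) =
      ∫ t in Ioo (0 : ℝ) 1, ((t ^ (p - 1) * (1 - t) ^ (q - 1) : ℝ) : ℂ) := by
    refine setIntegral_congr_fun measurableSet_Ioo fun t ht => ?_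
    have h1 : 0 < 1 - t := by linarith [ht.2]
    push_cast
    rw [Complex.ofReal_cpow ht.1.le, Complex.ofReal_cpow h1.le]
    push_cast
    rfl
  rw [h2, integral_complex_ofReal, Complex.ofReal_re]

/-- The quotient `Γ(n + γ + β) / Γ(n + γ)`, which grows like `n ^ β`. -/
def gammaRatio (γ β : ℝ) (n : ℕ) : ℝ := Real.Gamma (n + γ + β) / Real.Gamma (n + γ)

lemma gammaRatio_pos {γ β : ℝ} (hγ : 0 < γ) (hβ : 0 < γ + β) (n : ℕ) : 0 < gammaRatio γ β n :=
  div_pos (Real.Gamma_pos_of_pos (by rw [add_assoc]; positivity))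
    (Real.Gamma_pos_of_pos (by positivity))

lemma gammaRatio_zero {γ : ℝ} (hγ : 0 < γ) (n : ℕ) : gammaRatio γ 0 n = 1 := by
  have : Real.Gamma (n + γ) ≠ 0 := (Real.Gamma_pos_of_pos (by positivity)).ne'
  simp [gammaRatio, this]

/-- For a natural number `m > β`, the quotient of Gamma functions is a polynomial of degree `m` in `n`
times a Beta integral, in which `n` enters only through the power `t ^ n`. -/
lemma gammaRatio_eq_integral {γ β : ℝ} (hγ : 0 < γ) (hβ : 0 < γ + β) {m : ℕ} (hm : β < m)
    (n : ℕ) : Real.Gamma (m - β) * gammaRatio γ β n =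
      poch (n + γ) m * ∫ t in Ioo (0 : ℝ) 1, t ^ (n + γ + β - 1) * (1 - t) ^ (m - β - 1) := by
  have h0 : 0 < (n : ℝ) + γ := by positivity
  have h1 : 0 < (n : ℝ) + γ + β := by rw [add_assoc]; positivity
  rw [integral_beta h1 (by linarith : 0 < m - β),
    show (n : ℝ) + γ + β + (m - β) = (n + γ) + m by ring, Gamma_add_nat h0, gammaRatio]
  have := (poch_pos h0 m).ne'
  have := (Real.Gamma_pos_of_pos h0).ne'
  field_simp

/-- `Γ(n + γ + β) / Γ(n + γ)` is bounded by a multiple of a polynomial in `n` of degree `m > β`. -/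
lemma exists_gammaRatio_le {γ β : ℝ} (hγ : 0 < γ) (hβ : 0 < γ + β) {m : ℕ} (hm : β < m) :
    ∃ C : ℝ, 0 < C ∧ ∀ n : ℕ, gammaRatio γ β n ≤ C * poch (n + γ) m := by
  have hG : 0 < Real.Gamma (m - β) := Real.Gamma_pos_of_pos (by linarith)
  set I := ∫ t in Ioo (0 : ℝ) 1, t ^ (γ + β - 1) * (1 - t) ^ (m - β - 1) with hI
  have hI0 : 0 ≤ I := setIntegral_nonneg measurableSet_Ioo fun t ht =>
    mul_nonneg (Real.rpow_nonneg ht.1.le _) (Real.rpow_nonneg (by linarith [ht.2]) _)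
  refine ⟨(I + 1) / Real.Gamma (m - β), by positivity, fun n => ?_⟩
  have h0 : 0 < (n : ℝ) + γ := by positivity
  have h1 : 0 < (n : ℝ) + γ + β := by rw [add_assoc]; positivity
  have hle : ∫ t in Ioo (0 : ℝ) 1, t ^ (n + γ + β - 1) * (1 - t) ^ (m - β - 1) ≤ I := by
    refine setIntegral_mono_on (integrableOn_beta h1 (by linarith))
      (integrableOn_beta hβ (by linarith)) measurableSet_Ioo fun t ht => ?_
    refine mul_le_mul_of_nonneg_right ?_ (Real.rpow_nonneg (by linarith [ht.2]) _)
    exact Real.rpow_le_rpow_of_exponent_ge ht.1 ht.2.le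
      (by have : (0 : ℝ) ≤ n := n.cast_nonneg
          linarith)
  have h := gammaRatio_eq_integral hγ hβ hm n
  rw [div_mul_eq_mul_div, le_div_iff₀ hG, mul_comm, h, mul_comm]
  exact mul_le_mul_of_nonneg_right (by linarith) (poch_pos h0 m).le

/-! ### Radial behaviour of the coefficient sums -/

lemma rescale_binomSeries (t : ℂ) (μ : ℝ) (x : ℂ) :
    PowerSeries.rescale t (binomSeries μ x) = binomSeries μ (t * x) := by
  ext n
  rw [PowerSeries.coeff_rescale, coeff_binomSeries, coeff_binomSeries, mul_pow]; ring

lemma coeff_tripleSeries_mul (t : ℂ) (μ₁ μ₂ μ₃ : ℝ) (ξ ζ η : ℂ) (n : ℕ) :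
    PowerSeries.coeff n (tripleSeries μ₁ μ₂ μ₃ (t * ξ) (t * ζ) (t * η)) =
      t ^ n * PowerSeries.coeff n (tripleSeries μ₁ μ₂ μ₃ ξ ζ η) := by
  rw [← PowerSeries.coeff_rescale]
  simp only [tripleSeries, map_mul, rescale_binomSeries]

/-- On the radius from `0` to a point `ξ` of the disk, the distance to `1` is comparable to
`‖1 - ξ‖ + (1 - t)`. -/
lemma add_le_three_mul_norm_one_sub {ξ : ℂ} (hξ : ‖ξ‖ ≤ 1) {t : ℝ} (h0 : 0 ≤ t) (h1 : t ≤ 1) :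
    ‖1 - ξ‖ + (1 - t) ≤ 3 * ‖1 - t * ξ‖ := by
  have e1 : ‖(t : ℂ) * ξ‖ ≤ t := by
    rw [norm_mul, Complex.norm_real, Real.norm_eq_abs, abs_of_nonneg h0]
    exact mul_le_of_le_one_right h0 hξ
  have e2 : 1 - t ≤ ‖1 - t * ξ‖ := by
    have := norm_sub_norm_le (1 : ℂ) (t * ξ)
    rw [norm_one] at this; linarith
  have e3 : ‖1 - ξ‖ ≤ ‖1 - t * ξ‖ + (1 - t) := by
    have h : 1 - ξ = (1 - t * ξ) - ((1 - t : ℝ) : ℂ) * ξ := by push_cast; ring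
    have h' : ‖((1 - t : ℝ) : ℂ) * ξ‖ ≤ 1 - t := by
      rw [norm_mul, Complex.norm_real, Real.norm_eq_abs, abs_of_nonneg (by linarith)]
      exact mul_le_of_le_one_right (by linarith) hξ
    rw [h]
    exact (norm_sub_le _ _).trans (by linarith)
  linarith

lemma rpow_neg_le_of_le_three_mul {x y e : ℝ} (hy : 0 < y) (h : y ≤ 3 * x) (he : 0 ≤ e) :
    x ^ (-e) ≤ 3 ^ e * y ^ (-e) := by
  have hx : 0 < x := by linarith
  have h1 : (3 * x) ^ (-e) ≤ y ^ (-e) := Real.rpow_le_rpow_of_nonpos hy h (by linarith)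
  rw [Real.mul_rpow (by norm_num) hx.le, Real.rpow_neg (by norm_num : (0:ℝ) ≤ 3)] at h1
  have h3 : (0 : ℝ) < 3 ^ e := by positivity
  rw [inv_mul_le_iff₀ h3] at h1
  exact h1

/-- The one-dimensional integral that controls the sums `∑ Γ(n + γ + β) / Γ(n + γ) * h n`, where
`h n` are the coefficients of `(1 - t ξ)⁻¹ |1 - t ζ| ^ (-2 lam)` and `a = ‖1 - ξ‖`,
`r = ‖1 - ζ‖`. -/
def radialIntegral (lam β : ℝ) (m : ℕ) (a r : ℝ) : ℝ :=
  ∫ u in Ioo (0 : ℝ) 1, u ^ (m - β - 1) *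
    ((a + u) ^ (-1 : ℝ) * (r + u) ^ (-(2 * lam)) * (min a r + u) ^ (-(m : ℝ)))

lemma integrableOn_rpow_Ioo {p : ℝ} (hp : -1 < p) :
    IntegrableOn (fun u : ℝ => u ^ p) (Ioo 0 1) := by
  have := (intervalIntegral.intervalIntegrable_rpow' (a := 0) (b := 1) hp)
  rwa [intervalIntegrable_iff_integrableOn_Ioo_of_le zero_le_one] at this

lemma integrableOn_rpow_mul_of_continuousOn {p : ℝ} (hp : -1 < p) {g : ℝ → ℝ}
    (hg : ContinuousOn g (Icc 0 1)) :
    IntegrableOn (fun u : ℝ => u ^ p * g u) (Ioo 0 1) := by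
  have h := (integrableOn_rpow_Ioo hp)
  rw [← integrableOn_Icc_iff_integrableOn_Ioo] at h ⊢
  exact h.mul_continuousOn hg isCompact_Icc

lemma integrableOn_radial (lam : ℝ) {β : ℝ} {m : ℕ} (hm : β < m) {a r : ℝ} (ha : 0 < a)
    (hr : 0 < r) : IntegrableOn (fun u : ℝ => u ^ (m - β - 1) *
      ((a + u) ^ (-1 : ℝ) * (r + u) ^ (-(2 * lam)) * (min a r + u) ^ (-(m : ℝ)))) (Ioo 0 1) := by
  refine integrableOn_rpow_mul_of_continuousOn (by linarith) ?_
  have hd : 0 < min a r := lt_min ha hr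
  refine ((ContinuousOn.rpow_const (by fun_prop) ?_).mul
    (ContinuousOn.rpow_const (by fun_prop) ?_)).mul (ContinuousOn.rpow_const (by fun_prop) ?_)
  all_goals
    intro x hx
    left
    have := hx.1
    positivity

lemma setIntegral_Ioo_one_sub (f : ℝ → ℝ) :
    ∫ t in Ioo (0 : ℝ) 1, f (1 - t) = ∫ u in Ioo (0 : ℝ) 1, f u := by
  rw [← integral_Ioc_eq_integral_Ioo, ← integral_Ioc_eq_integral_Ioo,
    ← intervalIntegral.integral_of_le zero_le_one, ← intervalIntegral.integral_of_le zero_le_one,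
    intervalIntegral.integral_comp_sub_left (fun x => f x) 1]
  simp

lemma integrableOn_Ioo_one_sub {f : ℝ → ℝ} (hf : IntegrableOn f (Ioo 0 1)) :
    IntegrableOn (fun t => f (1 - t)) (Ioo 0 1) := by
  rw [← intervalIntegrable_iff_integrableOn_Ioo_of_le zero_le_one] at hf ⊢
  have := hf.comp_sub_left 1
  simpa using this.symm

/-- The weight `Γ(n + γ + β) / Γ(n + γ)` is written as a polynomial of degree `m` in `n` times a
Beta integral in `t`; the power `t ^ n` under the integral moves `ξ`, `ζ` to `t ξ`, `t ζ`. -/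
theorem exists_norm_tsum_gammaRatio_le {lam : ℝ} (hlam : 0 ≤ lam) {γ β : ℝ} (hγ : 0 < γ)
    (hβ : 1 ≤ γ + β) {m : ℕ} (hm : β < m) : ∃ C : ℝ, 0 < C ∧
    ∀ ξ ζ : ℂ, ‖ξ‖ < 1 → ‖ζ‖ < 1 →
      ‖∑' n : ℕ, (gammaRatio γ β n : ℂ) *
        PowerSeries.coeff n (tripleSeries 1 lam lam ξ ζ (conj ζ))‖ ≤
        C * radialIntegral lam β m ‖1 - ξ‖ ‖1 - ζ‖ := by
  obtain ⟨C, hC, hS⟩ := exists_norm_tsum_poch_mul_coeff_le m γ 1 lam lam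
  obtain ⟨C', hC', hR⟩ := exists_gammaRatio_le hγ (by linarith : 0 < γ + β) hm
  have hmβ : 0 < m - β := by linarith
  have hG : 0 < Real.Gamma (m - β) := Real.Gamma_pos_of_pos hmβ
  set K : ℝ := C * (3 ^ (1 : ℝ) * 3 ^ (2 * lam) * 3 ^ (m : ℝ)) with hK
  have hK0 : 0 < K := by positivity
  refine ⟨K / Real.Gamma (m - β), by positivity, fun ξ ζ hξ hζ => ?_⟩
  have hη : ∀ x : ℂ, ‖conj x‖ = ‖x‖ := fun x => RCLike.norm_conj x
  have hη1 : ∀ x : ℂ, ‖1 - conj x‖ = ‖1 - x‖ := fun x => by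
    rw [← hη (1 - x)]; simp
  have hsum := (hS ξ ζ (conj ζ) hξ hζ (by rwa [hη]) (hη1 ζ)).1.norm
  set c : ℕ → ℂ := fun n => PowerSeries.coeff n (tripleSeries 1 lam lam ξ ζ (conj ζ)) with hc
  have h1 : ∀ n : ℕ, 0 < (n : ℝ) + γ + β := fun n => by
    rw [add_assoc]
    have : (0 : ℝ) ≤ n := n.cast_nonneg
    linarith
  let B : ℕ → ℝ → ℝ := fun n t => t ^ ((n : ℝ) + γ + β - 1) * (1 - t) ^ ((m : ℝ) - β - 1)
  have hBint : ∀ n, IntegrableOn (B n) (Ioo 0 1) := fun n => integrableOn_beta (h1 n) hmβ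
  have hB0 : ∀ n, ∀ t ∈ Ioo (0 : ℝ) 1, 0 ≤ B n t := fun n t ht =>
    mul_nonneg (Real.rpow_nonneg ht.1.le _) (Real.rpow_nonneg (by linarith [ht.2]) _)
  let F : ℕ → ℝ → ℂ := fun n t => ((poch (n + γ) m : ℂ) * c n) * (B n t : ℂ)
  have hFint : ∀ n, Integrable (F n) (volume.restrict (Ioo 0 1)) := fun n =>
    ((hBint n).ofReal (𝕜 := ℂ)).const_mul _
  have hFn : ∀ n, ∫ t in Ioo (0 : ℝ) 1, ‖F n t‖ =
      ‖((Real.Gamma (m - β) * gammaRatio γ β n : ℝ) : ℂ) * c n‖ := by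
    intro n
    have hp : 0 < poch (n + γ) m := poch_pos (by positivity) m
    rw [gammaRatio_eq_integral hγ (by linarith) hm n]
    calc ∫ t in Ioo (0 : ℝ) 1, ‖F n t‖
        = ∫ t in Ioo (0 : ℝ) 1, (poch (n + γ) m * ‖c n‖) * B n t := by
          refine setIntegral_congr_fun measurableSet_Ioo fun t ht => ?_
          simp only [F, norm_mul, Complex.norm_real, Real.norm_eq_abs, abs_of_pos hp,
            abs_of_nonneg (hB0 n t ht)]
      _ = _ := by
          rw [integral_const_mul, norm_mul, Complex.norm_real, Real.norm_eq_abs, abs_of_nonneg]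
          · ring
          · exact mul_nonneg hp.le (setIntegral_nonneg measurableSet_Ioo (hB0 n))
  have hFsum : Summable fun n => ∫ t in Ioo (0 : ℝ) 1, ‖F n t‖ := by
    refine Summable.of_nonneg_of_le (fun n => integral_nonneg fun t => norm_nonneg _) (fun n => ?_)
      (hsum.mul_left (Real.Gamma (m - β) * C'))
    have hp : 0 < poch (n + γ) m := poch_pos (by positivity) m
    have hg := gammaRatio_pos hγ (by linarith : 0 < γ + β) n
    rw [hFn, norm_mul, norm_mul, Complex.norm_real, Complex.norm_real, Real.norm_eq_abs,
      Real.norm_eq_abs, abs_of_pos hp, abs_of_pos (by positivity)]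
    have := hR n
    calc _ ≤ Real.Gamma (m - β) * (C' * poch (n + γ) m) * ‖c n‖ := by gcongr
      _ = _ := by ring
  have hmain := hasSum_integral_of_summable_integral_norm hFint hFsum
  have hFi : ∀ n, ∫ t in Ioo (0 : ℝ) 1, F n t =
      (Real.Gamma (m - β) : ℂ) * ((gammaRatio γ β n : ℂ) * c n) := by
    intro n
    have h := congrArg (fun x : ℝ => (x : ℂ)) (gammaRatio_eq_integral hγ (by linarith) hm n)
    push_cast at h
    rw [integral_const_mul, integral_complex_ofReal, ← mul_assoc, h]
    ring
  simp only [hFi] at hmain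
  have hts := hmain.tsum_eq
  rw [tsum_mul_left] at hts
  have hbound : ‖∫ t in Ioo (0 : ℝ) 1, ∑' n, F n t‖ ≤
      K * radialIntegral lam β m ‖1 - ξ‖ ‖1 - ζ‖ := by
    rw [radialIntegral, ← setIntegral_Ioo_one_sub, ← integral_const_mul]
    have ha := norm_one_sub_pos hξ
    have hr := norm_one_sub_pos hζ
    refine norm_integral_le_of_norm_le
      ((integrableOn_Ioo_one_sub (integrableOn_radial lam hm ha hr)).const_mul K) ?_
    refine ae_restrict_of_forall_mem measurableSet_Ioo fun t ht => ?_
    have ht1 : 0 < 1 - t := by linarith [ht.2]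
    have hnt : ∀ x : ℂ, ‖x‖ < 1 → ‖(t : ℂ) * x‖ < 1 := fun x hx => by
      rw [norm_mul, Complex.norm_real, Real.norm_eq_abs, abs_of_pos ht.1]
      nlinarith [ht.1, ht.2, norm_nonneg x]
    have hconj : (t : ℂ) * conj ζ = conj ((t : ℂ) * ζ) := by simp
    have hS' := (hS (t * ξ) (t * ζ) (t * conj ζ) (hnt _ hξ) (hnt _ hζ)
      (hnt _ (by rwa [hη])) (by rw [hconj, hη1])).2
    have hFt : ∑' n, F n t = ((t ^ (γ + β - 1) * (1 - t) ^ ((m : ℝ) - β - 1) : ℝ) : ℂ) *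
        ∑' n : ℕ, (poch (n + γ) m : ℂ) * PowerSeries.coeff n
          (tripleSeries 1 lam lam (t * ξ) (t * ζ) (t * conj ζ)) := by
      rw [← tsum_mul_left]
      congr 1
      funext n
      have hpow : t ^ ((n : ℝ) + γ + β - 1) = t ^ n * t ^ (γ + β - 1) := by
        rw [← Real.rpow_natCast, ← Real.rpow_add ht.1]; ring_nf
      simp only [F, B, coeff_tripleSeries_mul, hpow, hc]
      push_cast
      ring
    rw [hFt, norm_mul, Complex.norm_real, Real.norm_eq_abs, abs_of_nonneg
      (mul_nonneg (Real.rpow_nonneg ht.1.le _) (Real.rpow_nonneg ht1.le _))]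
    have ht' : t ^ (γ + β - 1) ≤ 1 := Real.rpow_le_one ht.1.le ht.2.le (by linarith)
    have ea := add_le_three_mul_norm_one_sub hξ.le ht.1.le ht.2.le
    have er := add_le_three_mul_norm_one_sub hζ.le ht.1.le ht.2.le
    have ed : min ‖1 - ξ‖ ‖1 - ζ‖ + (1 - t) ≤ 3 * min ‖1 - t * ξ‖ ‖1 - t * ζ‖ := by
      rcases min_cases ‖1 - t * ξ‖ ‖1 - t * ζ‖ with h | h
      · rw [h.1]; linarith [min_le_left ‖1 - ξ‖ ‖1 - ζ‖]
      · rw [h.1]; linarith [min_le_right ‖1 - ξ‖ ‖1 - ζ‖]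
    have i1 := rpow_neg_le_of_le_three_mul (by positivity) ea zero_le_one
    have i2 := rpow_neg_le_of_le_three_mul (by positivity) er (by linarith : 0 ≤ 2 * lam)
    have i3 := rpow_neg_le_of_le_three_mul
      (by have := lt_min ha hr
          positivity) ed (Nat.cast_nonneg m : (0 : ℝ) ≤ m)
    rw [← two_mul] at hS'
    set T := ∑' n : ℕ, (poch (n + γ) m : ℂ) * PowerSeries.coeff n
          (tripleSeries 1 lam lam (t * ξ) (t * ζ) (t * conj ζ))
    have hd : 0 < min ‖1 - ξ‖ ‖1 - ζ‖ := lt_min ha hr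
    calc t ^ (γ + β - 1) * (1 - t) ^ ((m : ℝ) - β - 1) * ‖T‖
        ≤ 1 * (1 - t) ^ ((m : ℝ) - β - 1) * (C * ((3 ^ (1 : ℝ) * (‖1 - ξ‖ + (1 - t)) ^ (-(1 : ℝ))) *
          (3 ^ (2 * lam) * (‖1 - ζ‖ + (1 - t)) ^ (-(2 * lam))) *
          (3 ^ (m : ℝ) * (min ‖1 - ξ‖ ‖1 - ζ‖ + (1 - t)) ^ (-(m : ℝ))))) := by
          refine mul_le_mul (mul_le_mul_of_nonneg_right ht' (Real.rpow_nonneg ht1.le _))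
            (hS'.trans ?_) (norm_nonneg _) (by positivity)
          gcongr
      _ = _ := by rw [hK]; ring
  rw [← hts, norm_mul, Complex.norm_real, Real.norm_eq_abs, abs_of_pos hG] at hbound
  rw [div_mul_eq_mul_div, le_div_iff₀ hG, mul_comm]
  exact hbound

/-! ### The Beta distribution with parameters `lam + 1`, `lam` -/

/-- The Beta distribution with parameters `lam + 1` and `lam`; as `lam` tends to `0` its mass
concentrates at `1`, and for `lam = 0` it is taken to be the Dirac mass there. -/
def mixMeasure (lam : ℝ) : Measure ℝ :=
  if lam = 0 then Measure.dirac 1 else ProbabilityTheory.betaMeasure (lam + 1) lam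

lemma mixMeasure_zero : mixMeasure 0 = Measure.dirac 1 := if_pos rfl

lemma mixMeasure_of_pos {lam : ℝ} (h : 0 < lam) :
    mixMeasure lam = ProbabilityTheory.betaMeasure (lam + 1) lam := if_neg h.ne'

lemma isProbabilityMeasure_mixMeasure {lam : ℝ} (h : 0 ≤ lam) :
    IsProbabilityMeasure (mixMeasure lam) := by
  rcases h.eq_or_lt with rfl | h
  · rw [mixMeasure_zero]; infer_instance
  · rw [mixMeasure_of_pos h]
    exact ProbabilityTheory.isProbabilityMeasureBeta (by linarith) h

lemma measurable_betaPDF (p q : ℝ) : Measurable (ProbabilityTheory.betaPDF p q) :=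
  (ProbabilityTheory.measurable_betaPDFReal p q).ennreal_ofReal

lemma ae_mem_mixMeasure {lam : ℝ} (h : 0 ≤ lam) : ∀ᵐ s ∂mixMeasure lam, s ∈ Ioc (0 : ℝ) 1 := by
  rcases h.eq_or_lt with rfl | h
  · rw [mixMeasure_zero, ae_dirac_eq]; exact right_mem_Ioc.mpr one_pos
  · rw [mixMeasure_of_pos h, ProbabilityTheory.betaMeasure,
      ae_withDensity_iff (measurable_betaPDF _ _)]
    refine Filter.Eventually.of_forall fun s hs => ?_
    by_contra hn
    apply hs
    rw [ProbabilityTheory.betaPDF_eq, if_neg (fun h' => hn ⟨h'.1, h'.2.le⟩), ENNReal.ofReal_zero]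

lemma integral_betaMeasure {E : Type*} [NormedAddCommGroup E] [NormedSpace ℝ E] {p q : ℝ}
    (hp : 0 < p) (hq : 0 < q) (f : ℝ → E) :
    ∫ x, f x ∂ProbabilityTheory.betaMeasure p q =
      (ProbabilityTheory.beta p q)⁻¹ •
        ∫ x in Ioo (0 : ℝ) 1, (x ^ (p - 1) * (1 - x) ^ (q - 1)) • f x := by
  rw [ProbabilityTheory.betaMeasure, integral_withDensity_eq_integral_toReal_smul
    (measurable_betaPDF p q) (Filter.Eventually.of_forall fun x => ENNReal.ofReal_lt_top),
    ← integral_smul, ← integral_indicator measurableSet_Ioo]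
  congr 1
  funext x
  by_cases hx : x ∈ Ioo (0 : ℝ) 1
  · have hx' : 0 < x ∧ x < 1 := hx
    rw [indicator_of_mem hx, ProbabilityTheory.betaPDF, ENNReal.toReal_ofReal
      (ProbabilityTheory.betaPDFReal_pos hx.1 hx.2 hp hq).le, ProbabilityTheory.betaPDFReal,
      if_pos hx', smul_smul, one_div, mul_assoc]
  · have hx' : ¬ (0 < x ∧ x < 1) := hx
    rw [indicator_of_notMem hx, ProbabilityTheory.betaPDF_eq, if_neg hx']
    simp

lemma integral_mixMeasure {E : Type*} [NormedAddCommGroup E] [NormedSpace ℝ E] {lam : ℝ}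
    (h : 0 < lam) (f : ℝ → E) :
    ∫ x, f x ∂mixMeasure lam = (ProbabilityTheory.beta (lam + 1) lam)⁻¹ •
        ∫ x in Ioo (0 : ℝ) 1, (x ^ lam * (1 - x) ^ (lam - 1)) • f x := by
  rw [mixMeasure_of_pos h, integral_betaMeasure (by linarith) h, add_sub_cancel_right]

lemma integrable_mixMeasure {E : Type*} [NormedAddCommGroup E] {lam : ℝ} (h : 0 ≤ lam)
    {f : ℝ → E} (hf : ContinuousOn f (Icc 0 1)) : Integrable f (mixMeasure lam) := by
  have := isProbabilityMeasure_mixMeasure h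
  have hr : (mixMeasure lam).restrict (Icc 0 1) = mixMeasure lam :=
    Measure.restrict_eq_self_of_ae_mem
      ((ae_mem_mixMeasure h).mono fun s hs => Ioc_subset_Icc_self hs)
  have := hf.integrableOn_compact (μ := mixMeasure lam) isCompact_Icc
  rwa [IntegrableOn, hr] at this

lemma norm_integral_mixMeasure_le {E : Type*} [NormedAddCommGroup E] [NormedSpace ℝ E] {lam : ℝ}
    (h : 0 ≤ lam) {f : ℝ → E} {B : ℝ} (hf : ∀ s ∈ Ioc (0 : ℝ) 1, ‖f s‖ ≤ B) :
    ‖∫ s, f s ∂mixMeasure lam‖ ≤ B := by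
  have := isProbabilityMeasure_mixMeasure h
  have := norm_integral_le_of_norm_le_const ((ae_mem_mixMeasure h).mono fun s hs => hf s hs)
  simpa using this

/-- The mixed moments of the Beta distribution. For `lam = 0` both sides vanish unless `j = 0`. -/
lemma integral_mixMeasure_pow_mul_pow {lam : ℝ} (h : 0 ≤ lam) (i j : ℕ) :
    ∫ s, s ^ i * (1 - s) ^ j ∂mixMeasure lam =
      poch (lam + 1) i * poch lam j / poch (2 * lam + 1) (i + j) := by
  rcases h.eq_or_lt with rfl | h
  · rw [mixMeasure_zero, integral_dirac]
    have hp : poch 1 i ≠ 0 := (poch_pos one_pos i).ne'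
    cases j with
    | zero => simp [poch_zero, hp]
    | succ j => simp [poch_zero_succ]
  · have hi : 0 < lam + 1 + i := by positivity
    have hj : 0 < lam + j := by positivity
    rw [integral_mixMeasure h]
    have he : ∫ x in Ioo (0 : ℝ) 1, (x ^ lam * (1 - x) ^ (lam - 1)) • (x ^ i * (1 - x) ^ j) =
        ∫ x in Ioo (0 : ℝ) 1, x ^ (lam + 1 + i - 1) * (1 - x) ^ (lam + j - 1) := by
      refine setIntegral_congr_fun measurableSet_Ioo fun x hx => ?_
      have h1 : 0 < 1 - x := by linarith [hx.2]
      have e1 : x ^ (lam + 1 + i - 1) = x ^ lam * x ^ i := by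
        rw [← Real.rpow_natCast, ← Real.rpow_add hx.1]; ring_nf
      have e2 : (1 - x) ^ (lam + j - 1) = (1 - x) ^ (lam - 1) * (1 - x) ^ j := by
        rw [← Real.rpow_natCast, ← Real.rpow_add h1]; ring_nf
      simp only [smul_eq_mul, e1, e2]; ring
    rw [he, integral_beta hi hj, ProbabilityTheory.beta, Gamma_add_nat (by linarith : 0 < lam + 1),
      Gamma_add_nat h, show lam + 1 + i + (lam + j) = (2 * lam + 1) + ((i + j : ℕ) : ℝ) by
        push_cast; ring, Gamma_add_nat (by linarith : 0 < 2 * lam + 1),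
      show lam + 1 + lam = 2 * lam + 1 by ring]
    have h1 := (Real.Gamma_pos_of_pos (by linarith : 0 < lam + 1)).ne'
    have h2 := (Real.Gamma_pos_of_pos h).ne'
    have h3 := (Real.Gamma_pos_of_pos (by linarith : 0 < 2 * lam + 1)).ne'
    have h4 := (poch_pos (by linarith : 0 < 2 * lam + 1) (i + j)).ne'
    simp only [smul_eq_mul]
    field_simp

/-! ### The basic polynomials -/

/-- The polynomial `∑_j (lam)_j (lam+1)_{n-j} / (j! (n-j)!) * y ^ j * x ^ (n-j)`, the coefficient of
`t ^ n` in `(1 - t y) ^ (-lam) * (1 - t x) ^ (-lam - 1)`. -/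
def biPoly (lam : ℝ) (n : ℕ) (x y : ℂ) : ℂ :=
  PowerSeries.coeff n (binomSeries lam y * binomSeries (lam + 1) x)

lemma biPoly_eq_sum (lam : ℝ) (n : ℕ) (x y : ℂ) :
    biPoly lam n x y = ∑ j ∈ Finset.range (n + 1),
      ((poch lam j * poch (lam + 1) (n - j) /
        ((j.factorial : ℝ) * ((n - j).factorial : ℝ)) : ℝ) : ℂ) * y ^ j * x ^ (n - j) := by
  rw [biPoly, PowerSeries.coeff_mul, Finset.Nat.sum_antidiagonal_eq_sum_range_succ_mk]
  refine Finset.sum_congr rfl fun j _ => ?_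
  simp only [coeff_binomSeries, binomCoeff]
  push_cast
  ring

lemma phi_eq (lam : ℝ) (n : ℕ) (z : ℂ) :
    phi lam n z = (eps lam n : ℂ) * biPoly lam n z (conj z) := by
  rw [phi, biPoly_eq_sum]

lemma conj_phi_eq (lam : ℝ) (n : ℕ) (w : ℂ) :
    conj (phi lam n w) = (eps lam n : ℂ) * biPoly lam n (conj w) w := by
  simp only [phi_eq, biPoly_eq_sum, map_mul, map_sum, map_pow, Complex.conj_ofReal,
    Complex.conj_conj]

lemma eps_sq_mul_binomCoeff {lam : ℝ} (h : 0 ≤ lam) (n : ℕ) :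
    eps lam n ^ 2 * binomCoeff (2 * lam + 1) n = 1 := by
  have h1 := poch_pos (by linarith : 0 < 2 * lam + 1) n
  have h2 : (n.factorial : ℝ) ≠ 0 := by positivity
  rw [eps, Real.sq_sqrt (by positivity), binomCoeff]
  field_simp

lemma biPoly_mul (lam : ℝ) (n : ℕ) (t x y : ℂ) :
    biPoly lam n (t * x) (t * y) = t ^ n * biPoly lam n x y := by
  rw [biPoly, biPoly, ← PowerSeries.coeff_rescale]
  simp only [map_mul, rescale_binomSeries]

lemma continuous_biPoly (lam : ℝ) (n : ℕ) {X : Type*} [TopologicalSpace X] {f g : X → ℂ}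
    (hf : Continuous f) (hg : Continuous g) : Continuous fun x => biPoly lam n (f x) (g x) := by
  simp only [biPoly_eq_sum]
  fun_prop

/-- A formula of Laplace type: `biPoly lam n x y` is up to a factor the Beta average of the powers
`(q x + (1 - q) y) ^ n`. -/
lemma biPoly_eq_integral {lam : ℝ} (h : 0 ≤ lam) (n : ℕ) (x y : ℂ) :
    biPoly lam n x y = (binomCoeff (2 * lam + 1) n : ℂ) *
      ∫ q : ℝ, ((q : ℂ) * x + (1 - q) * y) ^ n ∂mixMeasure lam := by
  have hexp : ∀ q : ℝ, ((q : ℂ) * x + (1 - q) * y) ^ n = ∑ j ∈ Finset.range (n + 1),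
      ((q ^ (n - j) * (1 - q) ^ j : ℝ) : ℂ) * (n.choose j * y ^ j * x ^ (n - j)) := by
    intro q
    rw [add_comm, add_pow]
    refine Finset.sum_congr rfl fun j _ => ?_
    push_cast
    rw [mul_pow, mul_pow]; ring
  simp only [hexp]
  rw [integral_finsetSum, Finset.mul_sum, biPoly_eq_sum]
  · refine Finset.sum_congr rfl fun j hj => ?_
    have hj' : j ≤ n := by simpa [Nat.lt_succ_iff] using hj
    rw [integral_mul_const, integral_complex_ofReal, integral_mixMeasure_pow_mul_pow h,
      Nat.sub_add_cancel hj']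
    have hc : (n.choose j : ℂ) =
        (((n.factorial : ℝ) / (j.factorial * (n - j).factorial) : ℝ) : ℂ) := by
      rw [← Nat.cast_choose ℝ hj']; simp
    have h1 := (poch_pos (by linarith : 0 < 2 * lam + 1) n).ne'
    have h2 : (n.factorial : ℝ) ≠ 0 := by positivity
    rw [hc]
    have : poch lam j * poch (lam + 1) (n - j) / ((j.factorial : ℝ) * (n - j).factorial) =
        binomCoeff (2 * lam + 1) n * (poch (lam + 1) (n - j) * poch lam j / poch (2 * lam + 1) n) *
          ((n.factorial : ℝ) / (j.factorial * (n - j).factorial)) := by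
      rw [binomCoeff]
      generalize poch (2 * lam + 1) n = p at h1
      field_simp
    rw [this]
    push_cast
    ring
  · intro j _
    exact integrable_mixMeasure h (by fun_prop)

lemma norm_convexCombo_le {x y : ℂ} {r : ℝ} (hx : ‖x‖ ≤ r) (hy : ‖y‖ ≤ r) {q : ℝ}
    (hq : q ∈ Icc (0 : ℝ) 1) : ‖(q : ℂ) * x + (1 - q) * y‖ ≤ r := by
  have h1 : ‖(q : ℂ)‖ = q := by rw [Complex.norm_real, Real.norm_eq_abs, abs_of_nonneg hq.1]
  have h2 : ‖(1 - q : ℂ)‖ = 1 - q := by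
    rw [← Complex.ofReal_one, ← Complex.ofReal_sub, Complex.norm_real, Real.norm_eq_abs,
      abs_of_nonneg (by linarith [hq.2])]
  refine (norm_add_le _ _).trans ?_
  rw [norm_mul, norm_mul, h1, h2]
  nlinarith [hq.1, hq.2, mul_le_mul_of_nonneg_left hx hq.1,
    mul_le_mul_of_nonneg_left hy (by linarith [hq.2] : 0 ≤ 1 - q)]

lemma norm_biPoly_le {lam : ℝ} (h : 0 ≤ lam) (n : ℕ) {x y : ℂ} {r : ℝ} (hx : ‖x‖ ≤ r)
    (hy : ‖y‖ ≤ r) : ‖biPoly lam n x y‖ ≤ binomCoeff (2 * lam + 1) n * r ^ n := by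
  have hb := binomCoeff_nonneg (by linarith : 0 ≤ 2 * lam + 1) n
  rw [biPoly_eq_integral h, norm_mul, Complex.norm_real, Real.norm_eq_abs, abs_of_nonneg hb]
  refine mul_le_mul_of_nonneg_left (norm_integral_mixMeasure_le h fun s hs => ?_) hb
  rw [norm_pow]
  exact pow_le_pow_left₀ (norm_nonneg _) (norm_convexCombo_le hx hy (Ioc_subset_Icc_self hs)) n

/-- `|φ_n(z) φ_n(w)| ≤ (2 lam + 1)_n / n! * |z w| ^ n`. -/
lemma norm_phi_mul_norm_phi_le {lam : ℝ} (h : 0 ≤ lam) (n : ℕ) (z w : ℂ) :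
    ‖phi lam n z‖ * ‖phi lam n w‖ ≤ binomCoeff (2 * lam + 1) n * ‖z * w‖ ^ n := by
  have hb := binomCoeff_nonneg (by linarith : 0 ≤ 2 * lam + 1) n
  have he : 0 ≤ eps lam n := Real.sqrt_nonneg _
  have hz : ∀ z : ℂ, ‖phi lam n z‖ ≤ eps lam n * (binomCoeff (2 * lam + 1) n * ‖z‖ ^ n) := by
    intro z
    rw [phi_eq, norm_mul, Complex.norm_real, Real.norm_eq_abs, abs_of_nonneg he]
    exact mul_le_mul_of_nonneg_left
      (norm_biPoly_le h n le_rfl (by rw [RCLike.norm_conj])) he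
  calc _ ≤ (eps lam n * (binomCoeff (2 * lam + 1) n * ‖z‖ ^ n)) *
        (eps lam n * (binomCoeff (2 * lam + 1) n * ‖w‖ ^ n)) :=
        mul_le_mul (hz z) (hz w) (norm_nonneg _) (by positivity)
    _ = (eps lam n ^ 2 * binomCoeff (2 * lam + 1) n) *
        (binomCoeff (2 * lam + 1) n * ‖z * w‖ ^ n) := by rw [norm_mul, mul_pow]; ring
    _ = _ := by rw [eps_sq_mul_binomCoeff h, one_mul]

/-! ### A Möbius transformation of the Beta integral -/

lemma mul_cpow_of_re_pos {x y : ℂ} (hx : 0 < x.re) (hy : 0 < y.re) (c : ℂ) :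
    (x * y) ^ c = x ^ c * y ^ c := by
  have hx0 : x ≠ 0 := fun h => by simp [h] at hx
  have hy0 : y ≠ 0 := fun h => by simp [h] at hy
  have h1 := abs_lt.mp (Complex.abs_arg_lt_pi_div_two_iff.mpr (Or.inl hx))
  have h2 := abs_lt.mp (Complex.abs_arg_lt_pi_div_two_iff.mpr (Or.inl hy))
  rw [Complex.cpow_def_of_ne_zero hx0, Complex.cpow_def_of_ne_zero hy0,
    Complex.cpow_def_of_ne_zero (mul_ne_zero hx0 hy0),
    Complex.log_mul hx0 hy0 ⟨by linarith, by linarith⟩, ← Complex.exp_add, add_mul]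

lemma mul_mem_slitPlane_of_re_pos {x y : ℂ} (hx : 0 < x.re) (hy : 0 < y.re) :
    x * y ∈ Complex.slitPlane := by
  have hx0 : x ≠ 0 := fun h => by simp [h] at hx
  have hy0 : y ≠ 0 := fun h => by simp [h] at hy
  have h1 := abs_lt.mp (Complex.abs_arg_lt_pi_div_two_iff.mpr (Or.inl hx))
  have h2 := abs_lt.mp (Complex.abs_arg_lt_pi_div_two_iff.mpr (Or.inl hy))
  rw [Complex.mem_slitPlane_iff_arg, Complex.arg_mul hx0 hy0 ⟨by linarith, by linarith⟩]
  exact ⟨by linarith, mul_ne_zero hx0 hy0⟩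

/-- Segments from a point off the negative real axis to a positive real number stay off the
negative real axis. -/
lemma combo_mem_slitPlane {x : ℂ} (hx : x ∈ Complex.slitPlane) {y : ℝ} (hy : 0 < y) {s : ℝ}
    (hs : s ∈ Icc (0 : ℝ) 1) : (1 - s : ℂ) * x + s * y ∈ Complex.slitPlane := by
  have hre : ((1 - s : ℂ) * x + s * y).re = (1 - s) * x.re + s * y := by simp
  have him : ((1 - s : ℂ) * x + s * y).im = (1 - s) * x.im := by simp
  rw [Complex.mem_slitPlane_iff, hre, him]
  rcases hs.2.eq_or_lt with rfl | h1
  · left; simpa using hy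
  · have h2 : 0 < 1 - s := by linarith
    rw [Complex.mem_slitPlane_iff] at hx
    rcases hx with h | h
    · left; have := mul_pos h2 h; have := mul_nonneg hs.1 hy.le; linarith
    · right; exact mul_ne_zero h2.ne' h

lemma combo_re_pos {x y : ℂ} (hx : 0 < x.re) (hy : 0 < y.re) {q : ℝ} (hq : q ∈ Icc (0 : ℝ) 1) :
    0 < ((q : ℂ) * x + (1 - q) * y).re := by
  have : ((q : ℂ) * x + (1 - q) * y).re = q * x.re + (1 - q) * y.re := by simp
  rw [this]
  rcases hq.1.eq_or_lt with h | h
  · rw [← h]; simpa using hy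
  · have := mul_pos h hx
    have := mul_nonneg (by linarith [hq.2] : 0 ≤ 1 - q) hy.le
    linarith

/-- A parametric integral over `[0, 1]` of a function that is holomorphic in the parameter. -/
lemma differentiableOn_integral_mixMeasure {lam : ℝ} (h : 0 ≤ lam) {U : Set ℂ} (hU : IsOpen U)
    {k k' : ℂ → ℝ → ℂ} (hk : ∀ q ∈ Icc (0 : ℝ) 1, ∀ P ∈ U, HasDerivAt (k · q) (k' P q) P)
    (hc : ∀ P ∈ U, ContinuousOn (k P) (Icc 0 1))
    (hc' : ContinuousOn (fun x : ℂ × ℝ => k' x.1 x.2) (U ×ˢ Icc 0 1)) :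
    DifferentiableOn ℂ (fun P => ∫ q, k P q ∂mixMeasure lam) U := by
  have := isProbabilityMeasure_mixMeasure h
  intro P hP
  obtain ⟨δ, hδ, hb⟩ := Metric.nhds_basis_closedBall.mem_iff.mp (hU.mem_nhds hP)
  obtain ⟨M, hM⟩ := ((isCompact_closedBall P δ).prod (isCompact_Icc (a := (0 : ℝ)) (b := 1)))
    |>.exists_bound_of_continuousOn (hc'.mono (prod_mono_left hb))
  have hae : ∀ᵐ q ∂mixMeasure lam, q ∈ Icc (0 : ℝ) 1 :=
    (ae_mem_mixMeasure h).mono fun q hq => Ioc_subset_Icc_self hq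
  have hc'P : ContinuousOn (k' P) (Icc 0 1) :=
    hc'.comp (f := fun q : ℝ => (P, q)) (by fun_prop) fun q hq => ⟨hP, hq⟩
  refine (hasDerivAt_integral_of_dominated_loc_of_deriv_le (F := k) (F' := k')
    (bound := fun _ => M) (Metric.closedBall_mem_nhds P hδ) ?_ (integrable_mixMeasure h (hc P hP))
    (integrable_mixMeasure h hc'P).aestronglyMeasurable ?_ (integrable_const M) ?_).2
      |>.differentiableAt.differentiableWithinAt
  · filter_upwards [hU.mem_nhds hP] with x hx
    exact (integrable_mixMeasure h (hc x hx)).aestronglyMeasurable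
  · filter_upwards [hae] with q hq x hx using hM (x, q) ⟨hx, hq⟩
  · filter_upwards [hae] with q hq x hx using hk q hq x (hb hx)

/-- For `P` on the ray through `R` the two Beta integrals are related by the substitution
`s = ρ q / (ρ q + 1 - q)`. On this ray every power under the integrals splits off a power of `R`,
which is possible since all points involved lie in the right half-plane. -/
lemma mobius_beta_integral_of_ray {lam : ℝ} (hlam : 0 < lam) {R T : ℂ} (hR : 0 < R.re)
    (hT : 0 < T.re) {ρ : ℝ} (hρ : 0 < ρ) :
    ∫ q : ℝ, ((q : ℂ) * (ρ * R) + (1 - q) * R) ^ (-((lam : ℂ) + 1)) *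
        ((q : ℂ) * conj R + (1 - q) * T) ^ (-(lam : ℂ)) ∂mixMeasure lam =
      (ρ * R)⁻¹ * ∫ s : ℝ, ((1 - s : ℂ) * (ρ * R * T) + s * (Complex.normSq R : ℂ)) ^ (-(lam : ℂ))
        ∂mixMeasure lam := by
  rw [integral_mixMeasure hlam, integral_mixMeasure hlam, mul_smul_comm]
  congr 1
  let D : ℝ → ℝ := fun q => q * ρ + (1 - q)
  let f : ℝ → ℝ := fun q => ρ * q / D q
  have hD : ∀ q ∈ Ioo (0 : ℝ) 1, 0 < D q := fun q hq => by
    have := mul_pos hq.1 hρ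
    simp only [D]; linarith [hq.2]
  have h1f : ∀ q ∈ Ioo (0 : ℝ) 1, 1 - f q = (1 - q) / D q := fun q hq => by
    have := (hD q hq).ne'
    simp only [f]
    field_simp
    simp only [D]; ring
  have hf' : ∀ q ∈ Ioo (0 : ℝ) 1, HasDerivWithinAt f (ρ / D q ^ 2) (Ioo 0 1) q := fun q hq => by
    have hne := (hD q hq).ne'
    have hd : HasDerivAt D (ρ - 1) q := by
      have := ((hasDerivAt_id q).mul_const ρ).add ((hasDerivAt_const q 1).sub (hasDerivAt_id q))
      rw [one_mul, zero_sub, ← sub_eq_add_neg] at this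
      exact this
    have hn : HasDerivAt (fun q : ℝ => ρ * q) ρ q := by
      simpa using (hasDerivAt_id q).const_mul ρ
    have := (hn.div hd hne).hasDerivWithinAt (s := Ioo 0 1)
    have e : ρ * D q - ρ * q * (ρ - 1) = ρ := by simp only [D]; ring
    rw [e] at this
    exact this
  have hinj : InjOn f (Ioo 0 1) := by
    intro x hx y hy hxy
    have hx' := (hD x hx).ne'
    have hy' := (hD y hy).ne'
    change ρ * x / D x = ρ * y / D y at hxy
    rw [div_eq_div_iff hx' hy'] at hxy
    simp only [D] at hxy
    have : ρ * (x - y) = 0 := by linear_combination hxy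
    rcases mul_eq_zero.mp this with h | h
    · exact absurd h hρ.ne'
    · linarith
  have himg : f '' Ioo 0 1 = Ioo 0 1 := by
    ext s
    constructor
    · rintro ⟨q, hq, rfl⟩
      refine ⟨div_pos (mul_pos hρ hq.1) (hD q hq), ?_⟩
      have := h1f q hq
      have h2 : 0 < (1 - q) / D q := div_pos (by linarith [hq.2]) (hD q hq)
      linarith
    · intro hs
      have hE : 0 < s + ρ * (1 - s) := by
        have := mul_pos hρ (by linarith [hs.2] : 0 < 1 - s)
        linarith [hs.1]
      have hE' := hE.ne'
      refine ⟨s / (s + ρ * (1 - s)), ⟨div_pos hs.1 hE, ?_⟩, ?_⟩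
      · rw [div_lt_one hE]
        have := mul_pos hρ (by linarith [hs.2] : 0 < 1 - s)
        linarith
      · have hDs : D (s / (s + ρ * (1 - s))) = ρ / (s + ρ * (1 - s)) := by
          simp only [D]; field_simp; ring
        simp only [f, hDs]
        field_simp
  have hcv : ∀ g : ℝ → ℂ, ∫ s in Ioo (0 : ℝ) 1, g s =
      ∫ q in Ioo (0 : ℝ) 1, |ρ / D q ^ 2| • g (f q) := fun g => by
    rw [← integral_image_eq_integral_abs_deriv_smul measurableSet_Ioo hf' hinj, himg]
  rw [hcv fun s => (s ^ lam * (1 - s) ^ (lam - 1)) •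
    ((1 - s : ℂ) * (ρ * R * T) + s * (Complex.normSq R : ℂ)) ^ (-(lam : ℂ)), ← integral_const_mul]
  refine setIntegral_congr_fun measurableSet_Ioo fun q hq => ?_
  have hq1 : 0 < 1 - q := by linarith [hq.2]
  have hDq := hD q hq
  have hV : 0 < ((q : ℂ) * conj R + (1 - q) * T).re :=
    combo_re_pos (by simpa using hR) hT (Ioo_subset_Icc_self hq)
  have hR0 : R ≠ 0 := fun h => by simp [h] at hR
  set V := (q : ℂ) * conj R + (1 - q) * T with hVdef
  have e1 : (q : ℂ) * (ρ * R) + (1 - q) * R = (D q : ℂ) * R := by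
    simp only [D]; push_cast; ring
  have hDc : (D q : ℂ) ≠ 0 := by exact_mod_cast hDq.ne'
  have e2 : (1 - (f q : ℂ)) * (ρ * R * T) + (f q) * (Complex.normSq R : ℂ) =
      (((ρ / D q : ℝ) : ℂ) * R) * V := by
    have : (1 - (f q : ℂ)) = ((1 - q : ℝ) : ℂ) / D q := by
      rw [← Complex.ofReal_one, ← Complex.ofReal_sub, h1f q hq, Complex.ofReal_div]
    rw [this, ← Complex.mul_conj]
    simp only [f, hVdef]
    push_cast
    field_simp
    ring
  have hre : ∀ x : ℝ, 0 < x → 0 < ((x : ℂ) * R).re := fun x hx => by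
    simpa using mul_pos hx hR
  have hρD : 0 < ρ / D q := div_pos hρ hDq
  have e3 : ∀ x : ℝ, 0 < x → ∀ e : ℝ, ((x : ℂ) * R) ^ (-(e : ℂ)) =
      ((x ^ (-e) : ℝ) : ℂ) * R ^ (-(e : ℂ)) := fun x hx e => by
    rw [mul_cpow_of_re_pos (by simpa using hx) hR, Complex.ofReal_cpow hx.le]
    push_cast; rfl
  have e4 : -((lam : ℂ) + 1) = -((lam + 1 : ℝ) : ℂ) := by push_cast; rfl
  have e5 : R ^ (-((lam + 1 : ℝ) : ℂ)) = R ^ (-(lam : ℂ)) * R⁻¹ := by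
    rw [← Complex.cpow_neg_one, ← Complex.cpow_add _ _ hR0]
    push_cast; ring_nf
  rw [e1, e2, e4, e3 _ hDq, mul_cpow_of_re_pos (hre _ hρD) hV, e3 _ hρD, e5, h1f q hq]
  have hreal : |ρ / D q ^ 2| * (f q ^ lam * ((1 - q) / D q) ^ (lam - 1) * (ρ / D q) ^ (-lam)) =
      ρ * (q ^ lam * (1 - q) ^ (lam - 1) * D q ^ (-(lam + 1))) := by
    rw [abs_of_pos (by positivity)]
    simp only [f]
    rw [mul_div_right_comm, Real.mul_rpow hρD.le hq.1.le, Real.div_rpow hq1.le hDq.le,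
      Real.rpow_neg hρD.le, Real.rpow_sub_one hDq.ne', Real.rpow_neg hDq.le,
      Real.rpow_add_one hDq.ne']
    have h1 : (ρ / D q) ^ lam ≠ 0 := (Real.rpow_pos_of_pos hρD _).ne'
    have h2 : D q ^ lam ≠ 0 := (Real.rpow_pos_of_pos hDq _).ne'
    field_simp
  have hcx := congrArg (fun x : ℝ => (x : ℂ)) hreal
  push_cast at hcx
  have hρc : (ρ : ℂ) ≠ 0 := by exact_mod_cast hρ.ne'
  simp only [Complex.real_smul]
  push_cast
  rw [mul_inv]
  have hρi : (ρ : ℂ)⁻¹ * ρ = 1 := inv_mul_cancel₀ hρc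
  linear_combination (-(ρ : ℂ)⁻¹ * R⁻¹ * R ^ (-(lam : ℂ)) * V ^ (-(lam : ℂ))) * hcx -
    ((q ^ lam : ℝ) : ℂ) * (((1 - q) ^ (lam - 1) : ℝ) : ℂ) * ((D q ^ (-(lam + 1)) : ℝ) : ℂ) *
      R⁻¹ * R ^ (-(lam : ℂ)) * V ^ (-(lam : ℂ)) * hρi

/-- The identity of `mobius_beta_integral_of_ray` for all `P` in the right half-plane, by analytic
continuation in `P`. In the application `P = 1 - z w̄`, `R = 1 - z̄ w̄` and `T = conj P`, and the
right side is an integral over convex combinations of `|P| ^ 2` and `|R| ^ 2`. -/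
theorem mobius_beta_integral {lam : ℝ} (hlam : 0 < lam) {P R T : ℂ} (hP : 0 < P.re)
    (hR : 0 < R.re) (hT : 0 < T.re) :
    ∫ q : ℝ, ((q : ℂ) * P + (1 - q) * R) ^ (-((lam : ℂ) + 1)) *
        ((q : ℂ) * conj R + (1 - q) * T) ^ (-(lam : ℂ)) ∂mixMeasure lam =
      P⁻¹ * ∫ s : ℝ, ((1 - s : ℂ) * (P * T) + s * (Complex.normSq R : ℂ)) ^ (-(lam : ℂ))
        ∂mixMeasure lam := by
  set U : Set ℂ := {P | 0 < P.re} with hUdef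
  have hU : IsOpen U := isOpen_lt continuous_const Complex.continuous_re
  have hRc : 0 < (conj R).re := by simpa using hR
  have hR0 : R ≠ 0 := fun h => by simp [h] at hR
  have hns : 0 < Complex.normSq R := Complex.normSq_pos.mpr hR0
  have hslit : ∀ x : ℂ, 0 < x.re → x ∈ Complex.slitPlane := fun x hx => Or.inl hx
  have hb1 : ∀ q ∈ Icc (0 : ℝ) 1, ∀ P ∈ U, (q : ℂ) * P + (1 - q) * R ∈ Complex.slitPlane :=
    fun q hq P hP => hslit _ (combo_re_pos hP hR hq)
  have hb2 : ∀ q ∈ Icc (0 : ℝ) 1, (q : ℂ) * conj R + (1 - q) * T ∈ Complex.slitPlane :=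
    fun q hq => hslit _ (combo_re_pos hRc hT hq)
  have hb3 : ∀ s ∈ Icc (0 : ℝ) 1, ∀ P ∈ U,
      (1 - s : ℂ) * (P * T) + s * (Complex.normSq R : ℂ) ∈ Complex.slitPlane :=
    fun s hs P hP => combo_mem_slitPlane (mul_mem_slitPlane_of_re_pos hP hT) hns hs
  have hd1 : DifferentiableOn ℂ (fun P : ℂ => ∫ q : ℝ,
      ((q : ℂ) * P + (1 - q) * R) ^ (-((lam : ℂ) + 1)) *
        ((q : ℂ) * conj R + (1 - q) * T) ^ (-(lam : ℂ)) ∂mixMeasure lam) U := by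
    refine differentiableOn_integral_mixMeasure hlam.le hU
      (k' := fun P q => (-((lam : ℂ) + 1)) * ((q : ℂ) * P + (1 - q) * R) ^ (-((lam : ℂ) + 1) - 1) *
        q * ((q : ℂ) * conj R + (1 - q) * T) ^ (-(lam : ℂ))) ?_ ?_ ?_
    · intro q hq P hP
      have hin : HasDerivAt (fun P : ℂ => (q : ℂ) * P + (1 - q) * R) q P := by
        simpa using ((hasDerivAt_id P).const_mul (q : ℂ)).add_const ((1 - q) * R)
      exact (hin.cpow_const (hb1 q hq P hP)).mul_const _
    · intro P hP
      exact (ContinuousOn.cpow (by fun_prop) (by fun_prop) fun q hq => hb1 q hq P hP).mul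
        (ContinuousOn.cpow (by fun_prop) (by fun_prop) hb2)
    · refine ((continuousOn_const.mul (ContinuousOn.cpow (by fun_prop) (by fun_prop)
        fun x hx => hb1 x.2 hx.2 x.1 hx.1)).mul (by fun_prop)).mul
        (ContinuousOn.cpow (by fun_prop) (by fun_prop) fun x hx => hb2 x.2 hx.2)
  have hd2 : DifferentiableOn ℂ (fun P : ℂ => P⁻¹ * ∫ s : ℝ,
      ((1 - s : ℂ) * (P * T) + s * (Complex.normSq R : ℂ)) ^ (-(lam : ℂ)) ∂mixMeasure lam) U := by
    refine DifferentiableOn.mul ?_ (differentiableOn_integral_mixMeasure hlam.le hU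
      (k' := fun P s => (-(lam : ℂ)) * ((1 - s : ℂ) * (P * T) + s * (Complex.normSq R : ℂ)) ^
        (-(lam : ℂ) - 1) * ((1 - s) * T)) ?_ ?_ ?_)
    · refine differentiableOn_id.inv fun P hP h => ?_
      have : P = 0 := h
      rw [this] at hP
      simp [hUdef] at hP
    · intro s hs P hP
      have hin : HasDerivAt (fun P : ℂ => (1 - s : ℂ) * (P * T) + s * (Complex.normSq R : ℂ))
          ((1 - s) * T) P := by
        simpa using (((hasDerivAt_id P).mul_const T).const_mul (1 - s : ℂ)).add_const
          (s * (Complex.normSq R : ℂ))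
      exact hin.cpow_const (hb3 s hs P hP)
    · intro P hP
      exact ContinuousOn.cpow (by fun_prop) (by fun_prop) fun q hq => hb3 q hq P hP
    · exact (continuousOn_const.mul (ContinuousOn.cpow (by fun_prop) (by fun_prop)
        fun x hx => hb3 x.2 hx.2 x.1 hx.1)).mul (by fun_prop)
  have hconn : IsPreconnected U := (convex_halfSpace_re_gt 0).isPreconnected
  refine (hd1.analyticOnNhd hU).eqOn_of_preconnected_of_frequently_eq (hd2.analyticOnNhd hU)
    hconn hR ?_ hP
  have ht : Filter.Tendsto (fun ρ : ℝ => (ρ : ℂ) * R) (𝓝[≠] 1) (𝓝[≠] R) := by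
    refine tendsto_nhdsWithin_of_tendsto_nhds_of_eventually_within _ ?_ ?_
    · have : Filter.Tendsto (fun ρ : ℝ => (ρ : ℂ) * R) (𝓝 1) (𝓝 (((1 : ℝ) : ℂ) * R)) :=
        Continuous.tendsto (by fun_prop) 1
      rw [Complex.ofReal_one, one_mul] at this
      exact this.mono_left nhdsWithin_le_nhds
    · filter_upwards [self_mem_nhdsWithin] with ρ hρ h
      have h' : (ρ : ℂ) * R = R := h
      rw [mul_eq_right₀ hR0] at h'
      exact hρ (by exact_mod_cast h')
  refine ht.frequently (Filter.Eventually.frequently ?_)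
  have : ∀ᶠ ρ : ℝ in 𝓝[≠] 1, 0 < ρ := nhdsWithin_le_nhds (lt_mem_nhds one_pos)
  filter_upwards [this] with ρ hρ
  exact mobius_beta_integral_of_ray hlam hR hT hρ

/-! ### The product formula -/

/-- A point of modulus `‖z * w‖` with real part `(1 - s) Re (z w̄) + s Re (z w)`; it interpolates
between `z w̄` (or its conjugate) at `s = 0` and `z w` (or its conjugate) at `s = 1`. -/
def mixPoint (z w : ℂ) (s : ℝ) : ℂ :=
  ⟨(1 - s) * (z * conj w).re + s * (z * w).re,
    √(‖z * w‖ ^ 2 - ((1 - s) * (z * conj w).re + s * (z * w).re) ^ 2)⟩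

lemma norm_mul_conj (z w : ℂ) : ‖z * conj w‖ = ‖z * w‖ := by
  rw [norm_mul, norm_mul, RCLike.norm_conj]

lemma norm_mixPoint (z w : ℂ) {s : ℝ} (hs : s ∈ Icc (0 : ℝ) 1) :
    ‖mixPoint z w s‖ = ‖z * w‖ := by
  have h1 := abs_le.mp (Complex.abs_re_le_norm (z * conj w))
  have h2 := abs_le.mp (Complex.abs_re_le_norm (z * w))
  rw [norm_mul_conj] at h1
  have h3 : 0 ≤ 1 - s := by linarith [hs.2]
  have hx : ((1 - s) * (z * conj w).re + s * (z * w).re) ^ 2 ≤ ‖z * w‖ ^ 2 := by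
    refine sq_le_sq' ?_ ?_
    · nlinarith [mul_le_mul_of_nonneg_left h1.1 h3, mul_le_mul_of_nonneg_left h2.1 hs.1]
    · nlinarith [mul_le_mul_of_nonneg_left h1.2 h3, mul_le_mul_of_nonneg_left h2.2 hs.1]
  rw [← sq_eq_sq₀ (norm_nonneg _) (norm_nonneg _), Complex.sq_norm, Complex.normSq_apply, mixPoint]
  simp only
  rw [Real.mul_self_sqrt (by linarith)]
  ring

lemma continuous_mixPoint (z w : ℂ) : Continuous (mixPoint z w) := by
  have h : mixPoint z w = fun s =>
      (((1 - s) * (z * conj w).re + s * (z * w).re : ℝ) : ℂ) +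
      ((√(‖z * w‖ ^ 2 - ((1 - s) * (z * conj w).re + s * (z * w).re) ^ 2) : ℝ) : ℂ) *
        Complex.I := by
    funext s
    exact Complex.mk_eq_add_mul_I _ _
  rw [h]
  exact (Complex.continuous_ofReal.comp (by fun_prop)).add
    ((Complex.continuous_ofReal.comp (by fun_prop)).mul continuous_const)

lemma sq_norm_one_sub_ofReal_mul (t : ℝ) (x : ℂ) :
    ‖1 - t * x‖ ^ 2 = 1 - 2 * t * x.re + t ^ 2 * ‖x‖ ^ 2 := by
  rw [Complex.sq_norm, Complex.sq_norm, Complex.normSq_apply, Complex.normSq_apply]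
  simp
  ring

/-- The squared distance of `t * mixPoint z w s` to `1` is a convex combination. -/
lemma sq_norm_one_sub_mixPoint (z w : ℂ) {s : ℝ} (hs : s ∈ Icc (0 : ℝ) 1) (t : ℝ) :
    ‖1 - t * mixPoint z w s‖ ^ 2 =
      (1 - s) * ‖1 - t * (z * conj w)‖ ^ 2 + s * ‖1 - t * (z * w)‖ ^ 2 := by
  simp only [sq_norm_one_sub_ofReal_mul, norm_mixPoint z w hs, norm_mul_conj]
  simp only [mixPoint]
  ring

lemma norm_coeff_mul_le {f g : PowerSeries ℂ} {F G : PowerSeries ℝ}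
    (hf : ∀ n, ‖PowerSeries.coeff n f‖ ≤ PowerSeries.coeff n F)
    (hg : ∀ n, ‖PowerSeries.coeff n g‖ ≤ PowerSeries.coeff n G) (n : ℕ) :
    ‖PowerSeries.coeff n (f * g)‖ ≤ PowerSeries.coeff n (F * G) := by
  rw [PowerSeries.coeff_mul, PowerSeries.coeff_mul]
  refine (norm_sum_le _ _).trans (Finset.sum_le_sum fun p _ => ?_)
  rw [norm_mul]
  exact mul_le_mul (hf _) (hg _) (norm_nonneg _) ((norm_nonneg _).trans (hf _))

lemma norm_coeff_tripleSeries_le {lam : ℝ} (h : 0 ≤ lam) {ξ ζ η : ℂ} {r : ℝ} (hξ : ‖ξ‖ ≤ r)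
    (hζ : ‖ζ‖ ≤ r) (hη : ‖η‖ ≤ r) (n : ℕ) :
    ‖PowerSeries.coeff n (tripleSeries 1 lam lam ξ ζ η)‖ ≤
      ‖PowerSeries.coeff n (tripleSeries 1 lam lam r r r)‖ := by
  let B : ℝ → PowerSeries ℝ := fun μ => PowerSeries.mk fun n => binomCoeff μ n * r ^ n
  have hB : ∀ μ : ℝ, 0 ≤ μ → ∀ x : ℂ, ‖x‖ ≤ r → ∀ n,
      ‖PowerSeries.coeff n (binomSeries μ x)‖ ≤ PowerSeries.coeff n (B μ) := by
    intro μ hμ x hx n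
    have := binomCoeff_nonneg hμ n
    rw [coeff_binomSeries, PowerSeries.coeff_mk, norm_mul, norm_pow, Complex.norm_real,
      Real.norm_eq_abs, abs_of_nonneg this]
    gcongr
  have hm : ∀ μ : ℝ, PowerSeries.map Complex.ofRealHom (B μ) = binomSeries μ r := by
    intro μ
    ext n
    simp [B, coeff_binomSeries]
  have h1 : tripleSeries 1 lam lam r r r =
      PowerSeries.map Complex.ofRealHom (B 1 * B lam * B lam) := by
    simp only [tripleSeries, map_mul, hm]
  have h2 := norm_coeff_mul_le (norm_coeff_mul_le (hB 1 zero_le_one ξ hξ) (hB lam h ζ hζ))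
    (hB lam h η hη) n
  rw [h1, PowerSeries.coeff_map, Complex.ofRealHom_eq_coe, Complex.norm_real]
  exact h2.trans (le_abs_self _)

lemma continuous_coeff_tripleSeries (μ₁ μ₂ μ₃ : ℝ) (n : ℕ) {X : Type*} [TopologicalSpace X]
    {f g k : X → ℂ} (hf : Continuous f) (hg : Continuous g) (hk : Continuous k) :
    Continuous fun x => PowerSeries.coeff n (tripleSeries μ₁ μ₂ μ₃ (f x) (g x) (k x)) := by
  simp only [tripleSeries, PowerSeries.coeff_mul, coeff_binomSeries]
  fun_prop

/-- The coefficient of `t ^ n` in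
`(1 - t z w̄)⁻¹ ((1 - s) |1 - t z w̄| ^ 2 + s |1 - t z w| ^ 2) ^ (-lam)`. -/
def mixCoeff (lam : ℝ) (z w : ℂ) (n : ℕ) (s : ℝ) : ℂ :=
  PowerSeries.coeff n
    (tripleSeries 1 lam lam (z * conj w) (mixPoint z w s) (conj (mixPoint z w s)))

lemma continuous_mixCoeff (lam : ℝ) (z w : ℂ) (n : ℕ) : Continuous (mixCoeff lam z w n) :=
  continuous_coeff_tripleSeries _ _ _ _ continuous_const (continuous_mixPoint z w)
    (Complex.continuous_conj.comp (continuous_mixPoint z w))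

lemma norm_mixCoeff_le {lam : ℝ} (h : 0 ≤ lam) (z w : ℂ) (n : ℕ) {s : ℝ}
    (hs : s ∈ Icc (0 : ℝ) 1) : ‖mixCoeff lam z w n s‖ ≤
      ‖PowerSeries.coeff n (tripleSeries 1 lam lam (‖z * w‖ : ℝ) (‖z * w‖ : ℝ) (‖z * w‖ : ℝ))‖ :=
  norm_coeff_tripleSeries_le h (norm_mul_conj z w).le (norm_mixPoint z w hs).le
    (by rw [RCLike.norm_conj, norm_mixPoint z w hs]) n

lemma norm_ofReal_norm (x : ℂ) : ‖((‖x‖ : ℝ) : ℂ)‖ = ‖x‖ := by simp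

lemma cpow_mul_cpow_conj {x : ℂ} (hx : 0 < x.re) (c : ℝ) :
    x ^ (c : ℂ) * conj x ^ (c : ℂ) = ((‖x‖ ^ 2 : ℝ) : ℂ) ^ (c : ℂ) := by
  rw [← mul_cpow_of_re_pos hx (by simpa using hx), Complex.mul_conj, Complex.normSq_eq_norm_sq]

lemma one_sub_re_pos {x : ℂ} (hx : ‖x‖ < 1) : 0 < (1 - x).re := by
  have := (abs_le.mp (Complex.abs_re_le_norm x)).2
  simp; linarith

lemma norm_mul_lt_one {z w : ℂ} (hz : ‖z‖ < 1) (hw : ‖w‖ < 1) : ‖z * w‖ < 1 := by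
  rw [norm_mul]
  exact mul_lt_one_of_nonneg_of_lt_one_left (norm_nonneg _) hz hw.le

/-- The generating function of the integrals of the coefficients `mixCoeff`. -/
lemma hasSum_integral_mixCoeff {lam : ℝ} (h : 0 ≤ lam) {z w : ℂ} (hzw : ‖z * w‖ < 1) {t : ℝ}
    (ht : t ∈ Icc (0 : ℝ) 1) :
    HasSum (fun n => (t : ℂ) ^ n * ∫ s, mixCoeff lam z w n s ∂mixMeasure lam)
      ((1 - t * (z * conj w))⁻¹ * ∫ s : ℝ, (((1 - s) * ‖1 - t * (z * conj w)‖ ^ 2 +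
        s * ‖1 - t * (z * w)‖ ^ 2 : ℝ) : ℂ) ^ (-(lam : ℂ)) ∂mixMeasure lam) := by
  have hP := isProbabilityMeasure_mixMeasure h
  set H : ℕ → ℝ := fun n => ‖PowerSeries.coeff n
    (tripleSeries 1 lam lam (‖z * w‖ : ℝ) (‖z * w‖ : ℝ) (‖z * w‖ : ℝ))‖ with hH
  have hr : ‖((‖z * w‖ : ℝ) : ℂ)‖ < 1 := by rwa [norm_ofReal_norm]
  have hHs : Summable H := (hasSum_tripleSeries 1 lam lam hr hr hr).summable.norm
  have hae : ∀ᵐ s ∂mixMeasure lam, s ∈ Icc (0 : ℝ) 1 :=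
    (ae_mem_mixMeasure h).mono fun q hq => Ioc_subset_Icc_self hq
  have htn : ‖(t : ℂ)‖ ≤ 1 := by
    rw [Complex.norm_real, Real.norm_eq_abs, abs_of_nonneg ht.1]; exact ht.2
  have hint : ∀ n, Integrable (fun s => (t : ℂ) ^ n * mixCoeff lam z w n s) (mixMeasure lam) :=
    fun n => integrable_mixMeasure h ((continuous_mixCoeff lam z w n).const_smul ((t : ℂ) ^ n)
      |>.continuousOn)
  have hle : ∀ n, ∀ s ∈ Icc (0 : ℝ) 1, ‖(t : ℂ) ^ n * mixCoeff lam z w n s‖ ≤ H n := by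
    intro n s hs
    rw [norm_mul, norm_pow]
    exact (mul_le_of_le_one_left (norm_nonneg _) (pow_le_one₀ (norm_nonneg _) htn)).trans
      (norm_mixCoeff_le h z w n hs)
  have hsum : Summable fun n => ∫ s, ‖(t : ℂ) ^ n * mixCoeff lam z w n s‖ ∂mixMeasure lam := by
    refine Summable.of_nonneg_of_le (fun n => integral_nonneg fun s => norm_nonneg _)
      (fun n => ?_) hHs
    refine (Real.le_norm_self _).trans (norm_integral_mixMeasure_le h (fun s hs => ?_))
    rw [norm_norm]
    exact hle n s (Ioc_subset_Icc_self hs)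
  have key := hasSum_integral_of_summable_integral_norm hint hsum
  simp only [integral_const_mul] at key
  suffices heq : ∫ s, ∑' n, (t : ℂ) ^ n * mixCoeff lam z w n s ∂mixMeasure lam =
      (1 - t * (z * conj w))⁻¹ * ∫ s : ℝ, (((1 - s) * ‖1 - t * (z * conj w)‖ ^ 2 +
        s * ‖1 - t * (z * w)‖ ^ 2 : ℝ) : ℂ) ^ (-(lam : ℂ)) ∂mixMeasure lam by
    rwa [heq] at key
  rw [← integral_const_mul]
  refine integral_congr_ae ?_
  filter_upwards [hae] with s hs
  have hlt : ∀ x : ℂ, ‖x‖ < 1 → ‖(t : ℂ) * x‖ < 1 := fun x hx => by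
    rw [norm_mul]
    exact (mul_le_of_le_one_left (norm_nonneg _) htn).trans_lt hx
  have hξ : ‖(t : ℂ) * (z * conj w)‖ < 1 := hlt _ (by rwa [norm_mul_conj])
  have hζ : ‖(t : ℂ) * mixPoint z w s‖ < 1 := hlt _ (by rwa [norm_mixPoint z w hs])
  have hη : ‖(t : ℂ) * conj (mixPoint z w s)‖ < 1 :=
    hlt _ (by rwa [RCLike.norm_conj, norm_mixPoint z w hs])
  have hs3 := hasSum_tripleSeries 1 lam lam hξ hζ hη
  simp only [coeff_tripleSeries_mul] at hs3
  simp only [mixCoeff]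
  rw [hs3.tsum_eq, mul_assoc]
  have hc : (1 : ℂ) - t * conj (mixPoint z w s) = conj (1 - t * mixPoint z w s) := by simp
  have hpw := cpow_mul_cpow_conj (one_sub_re_pos hζ) (-lam)
  rw [sq_norm_one_sub_mixPoint z w hs, Complex.ofReal_neg] at hpw
  rw [hc, hpw, Complex.ofReal_one, Complex.cpow_neg_one]

/-- The generating function of the products `φ_n(z) conj φ_n(w)` as a Beta integral. -/
lemma hasSum_phi_mul_conj_phi {lam : ℝ} (h : 0 ≤ lam) {z w : ℂ} (hz : ‖z‖ < 1) (hw : ‖w‖ < 1) :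
    HasSum (fun n => phi lam n z * conj (phi lam n w))
      (∫ q : ℝ, ((q : ℂ) * (1 - z * conj w) + (1 - q) * (1 - conj z * conj w)) ^
          (-((lam : ℂ) + 1)) *
        ((q : ℂ) * conj (1 - conj z * conj w) + (1 - q) * conj (1 - z * conj w)) ^
          (-(lam : ℂ)) ∂mixMeasure lam) := by
  have hP := isProbabilityMeasure_mixMeasure h
  let X : ℝ → ℂ := fun q => (q : ℂ) * z + (1 - q) * conj z
  have hXc : Continuous X := by fun_prop
  have hX : ∀ q ∈ Icc (0 : ℝ) 1, ‖X q‖ ≤ ‖z‖ := fun q hq =>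
    norm_convexCombo_le le_rfl (by rw [RCLike.norm_conj]) hq
  have hterm : ∀ n, phi lam n z * conj (phi lam n w) =
      ∫ q, biPoly lam n (X q * conj w) (X q * w) ∂mixMeasure lam := by
    intro n
    have he := congrArg (fun x : ℝ => (x : ℂ)) (eps_sq_mul_binomCoeff h n)
    push_cast at he
    simp only [biPoly_mul]
    -- the normalization of `φ_n` cancels the factor in `biPoly_eq_integral`
    rw [integral_mul_const, conj_phi_eq, phi_eq, biPoly_eq_integral h n z]
    linear_combination (biPoly lam n (conj w) w * ∫ q, X q ^ n ∂mixMeasure lam) * he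
  have hXw : ∀ q ∈ Icc (0 : ℝ) 1, ‖X q * w‖ ≤ ‖z * w‖ := fun q hq => by
    rw [norm_mul, norm_mul]
    exact mul_le_mul_of_nonneg_right (hX q hq) (norm_nonneg _)
  have hXcw : ∀ q ∈ Icc (0 : ℝ) 1, ‖X q * conj w‖ ≤ ‖z * w‖ := fun q hq => by
    rw [norm_mul_conj]; exact hXw q hq
  have hzw := norm_mul_lt_one hz hw
  have hint : ∀ n, Integrable (fun q => biPoly lam n (X q * conj w) (X q * w)) (mixMeasure lam) :=
    fun n => integrable_mixMeasure h
      (continuous_biPoly lam n (by fun_prop) (by fun_prop)).continuousOn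
  have hb : Summable fun n => binomCoeff (2 * lam + 1) n * ‖z * w‖ ^ n := by
    have := (hasSum_binomSeries (2 * lam + 1) (x := ((‖z * w‖ : ℝ) : ℂ))
      (by rwa [norm_ofReal_norm])).summable.norm
    refine this.congr fun n => ?_
    rw [coeff_binomSeries, norm_mul, norm_pow, norm_ofReal_norm, Complex.norm_real,
      Real.norm_eq_abs, abs_of_nonneg (binomCoeff_nonneg (by linarith) n)]
  have hsum : Summable fun n =>
      ∫ q, ‖biPoly lam n (X q * conj w) (X q * w)‖ ∂mixMeasure lam := by
    refine Summable.of_nonneg_of_le (fun n => integral_nonneg fun s => norm_nonneg _)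
      (fun n => ?_) hb
    refine (Real.le_norm_self _).trans (norm_integral_mixMeasure_le h (fun s hs => ?_))
    rw [norm_norm]
    exact norm_biPoly_le h n (hXcw s (Ioc_subset_Icc_self hs)) (hXw s (Ioc_subset_Icc_self hs))
  have key := hasSum_integral_of_summable_integral_norm hint hsum
  simp only [← hterm] at key
  have heq : ∫ q, ∑' n, biPoly lam n (X q * conj w) (X q * w) ∂mixMeasure lam =
      ∫ q : ℝ, ((q : ℂ) * (1 - z * conj w) + (1 - q) * (1 - conj z * conj w)) ^
          (-((lam : ℂ) + 1)) *
        ((q : ℂ) * conj (1 - conj z * conj w) + (1 - q) * conj (1 - z * conj w)) ^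
          (-(lam : ℂ)) ∂mixMeasure lam := by
    refine integral_congr_ae ?_
    filter_upwards [ae_mem_mixMeasure h] with q hq
    have hq' := Ioc_subset_Icc_self hq
    have hs := hasSum_coeff_mul (hasSum_binomSeries lam ((hXw q hq').trans_lt hzw))
      (hasSum_binomSeries (lam + 1) ((hXcw q hq').trans_lt hzw))
    have e1 : (q : ℂ) * (1 - z * conj w) + (1 - q) * (1 - conj z * conj w) =
        1 - X q * conj w := by simp only [X]; ring
    have e2 : (q : ℂ) * conj (1 - conj z * conj w) + (1 - q) * conj (1 - z * conj w) =
        1 - X q * w := by simp [X]; ring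
    simp only [biPoly]
    rw [hs.tsum_eq, e1, e2, mul_comm]
    push_cast
    rfl
  rwa [heq] at key

lemma binomCoeff_zero_succ (n : ℕ) : binomCoeff 0 (n + 1) = 0 := by
  simp [binomCoeff, poch_zero_succ]

lemma binomSeries_zero (x : ℂ) : binomSeries 0 x = 1 := by
  ext n
  cases n with
  | zero => simp [coeff_binomSeries, binomCoeff, poch_zero]
  | succ n => simp [coeff_binomSeries, binomCoeff_zero_succ, PowerSeries.coeff_one]

lemma phi_ofReal_mul (lam : ℝ) (n : ℕ) (t : ℝ) (z : ℂ) :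
    phi lam n (t * z) = (t : ℂ) ^ n * phi lam n z := by
  rw [phi_eq, phi_eq, map_mul, Complex.conj_ofReal, biPoly_mul]; ring

/-- The identity theorem for absolutely convergent power series, on the interval `(0, 1)`. -/
lemma eq_zero_of_forall_hasSum_zero {d : ℕ → ℂ}
    (h : ∀ t ∈ Ioo (0 : ℝ) 1, HasSum (fun n => (t : ℂ) ^ n * d n) 0)
    (hs : Summable fun n => ‖d n‖) : d = 0 := by
  let p : FormalMultilinearSeries ℂ ℂ ℂ := FormalMultilinearSeries.ofScalars ℂ d
  have hp : HasFPowerSeriesAt (fun t : ℂ => ∑' n, t ^ n * d n) p 0 := by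
    rw [hasFPowerSeriesAt_iff]
    filter_upwards [Metric.ball_mem_nhds (0 : ℂ) one_pos] with t ht
    have ht' : ‖t‖ ≤ 1 := by simpa using (mem_ball_zero_iff.mp ht).le
    have : Summable fun n => t ^ n * d n := by
      refine Summable.of_norm_bounded hs fun n => ?_
      rw [norm_mul, norm_pow]
      exact mul_le_of_le_one_left (norm_nonneg _) (pow_le_one₀ (norm_nonneg _) ht')
    simpa [p, FormalMultilinearSeries.coeff_ofScalars] using this.hasSum
  have hp0 : p = 0 := by
    by_contra hne
    have h1 := hp.locally_ne_zero hne
    have ht : Filter.Tendsto (fun t : ℝ => (t : ℂ)) (𝓝[>] 0) (𝓝[≠] 0) := by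
      refine tendsto_nhdsWithin_of_tendsto_nhds_of_eventually_within _ ?_ ?_
      · exact (Complex.continuous_ofReal.tendsto' 0 0 Complex.ofReal_zero).mono_left
          nhdsWithin_le_nhds
      · filter_upwards [self_mem_nhdsWithin] with t ht h'
        have : (t : ℂ) = 0 := h'
        exact (ne_of_gt ht) (by exact_mod_cast this)
    obtain ⟨t, ht1, ht2⟩ := ((ht.eventually h1).and (Ioo_mem_nhdsGT one_pos)).exists
    exact ht1 (h t ht2).tsum_eq
  funext n
  have h1 : p.coeff n = 0 := by rw [hp0]; rfl
  simpa [p, FormalMultilinearSeries.coeff_ofScalars] using h1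

/-- The product formula: `φ_n(z) conj φ_n(w)` is an average of the coefficients `mixCoeff`. -/
theorem phi_mul_conj_phi {lam : ℝ} (h : 0 ≤ lam) {z w : ℂ} (hz : ‖z‖ < 1) (hw : ‖w‖ < 1)
    (n : ℕ) :
    phi lam n z * conj (phi lam n w) = ∫ s, mixCoeff lam z w n s ∂mixMeasure lam := by
  rcases h.eq_or_lt with rfl | hpos
  -- for `lam = 0` the measure is the Dirac mass at `1`, and both sides are `(z w̄) ^ n`
  · have hb : binomCoeff 1 n = 1 := by
      simp [binomCoeff, poch, n.factorial_ne_zero]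
    have he := eps_sq_mul_binomCoeff le_rfl n
    rw [mul_zero, zero_add, hb, mul_one] at he
    have he' := congrArg (fun x : ℝ => (x : ℂ)) he
    push_cast at he'
    rw [mixMeasure_zero, integral_dirac, mixCoeff, tripleSeries, binomSeries_zero,
      binomSeries_zero, mul_one, mul_one, coeff_binomSeries, conj_phi_eq, phi_eq, biPoly, biPoly,
      binomSeries_zero, binomSeries_zero, one_mul, one_mul, coeff_binomSeries, coeff_binomSeries,
      zero_add, hb, mul_pow]
    push_cast
    linear_combination z ^ n * conj w ^ n * he'
  -- for `lam > 0` the generating functions in `t` agree by the Möbius transformation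
  · have hzw := norm_mul_lt_one hz hw
    set d : ℕ → ℂ := fun n => phi lam n z * conj (phi lam n w) -
      ∫ s, mixCoeff lam z w n s ∂mixMeasure lam with hd
    have hmain : ∀ t ∈ Icc (0 : ℝ) 1, HasSum (fun n => (t : ℂ) ^ n * d n) 0 := by
      intro t ht
      have htz : ‖(t : ℂ) * z‖ < 1 := by
        rw [norm_mul, Complex.norm_real, Real.norm_eq_abs, abs_of_nonneg ht.1]
        exact (mul_le_of_le_one_left (norm_nonneg _) ht.2).trans_lt hz
      have h1 := hasSum_phi_mul_conj_phi h htz hw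
      have h2 := hasSum_integral_mixCoeff h hzw ht
      have hP : 0 < (1 - (t : ℂ) * z * conj w).re :=
        one_sub_re_pos (by rw [norm_mul_conj]; exact norm_mul_lt_one htz hw)
      have hR : 0 < (1 - conj ((t : ℂ) * z) * conj w).re :=
        one_sub_re_pos (by rw [← map_mul, RCLike.norm_conj]; exact norm_mul_lt_one htz hw)
      have hT : 0 < (conj (1 - (t : ℂ) * z * conj w)).re := by rw [Complex.conj_re]; exact hP
      rw [mobius_beta_integral hpos hP hR hT] at h1
      have hN : Complex.normSq (1 - conj ((t : ℂ) * z) * conj w) = ‖1 - t * (z * w)‖ ^ 2 := by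
        rw [Complex.normSq_eq_norm_sq, ← RCLike.norm_conj]
        simp [mul_assoc]
      have hsub := h1.sub h2
      have heq : (1 - (t : ℂ) * z * conj w)⁻¹ * ∫ s : ℝ, ((1 - s : ℂ) *
            ((1 - t * z * conj w) * conj (1 - t * z * conj w)) +
            s * (Complex.normSq (1 - conj ((t : ℂ) * z) * conj w) : ℂ)) ^ (-(lam : ℂ))
              ∂mixMeasure lam =
          (1 - t * (z * conj w))⁻¹ * ∫ s : ℝ, (((1 - s) * ‖1 - t * (z * conj w)‖ ^ 2 +
            s * ‖1 - t * (z * w)‖ ^ 2 : ℝ) : ℂ) ^ (-(lam : ℂ)) ∂mixMeasure lam := by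
        rw [hN, Complex.mul_conj, Complex.normSq_eq_norm_sq, mul_assoc]
        push_cast
        rfl
      rw [heq, sub_self] at hsub
      have hfun : (fun n => (t : ℂ) ^ n * d n) = fun n => phi lam n (t * z) * conj (phi lam n w) -
          (t : ℂ) ^ n * ∫ s, mixCoeff lam z w n s ∂mixMeasure lam := by
        funext n
        rw [phi_ofReal_mul, hd]; ring
      rw [hfun]
      exact hsub
    have hs : Summable fun n => ‖d n‖ := by
      have := (hmain 1 ⟨zero_le_one, le_rfl⟩).summable.norm
      simpa using this
    have := congrFun (eq_zero_of_forall_hasSum_zero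
      (fun t ht => hmain t (Ioo_subset_Icc_self ht)) hs) n
    exact sub_eq_zero.mp this

/-! ### One-dimensional integral estimates -/

lemma integrableOn_rpow_mul_add_rpow {p e : ℝ} (hp : 0 < p) (he : 0 < e) (q : ℝ) :
    IntegrableOn (fun v : ℝ => v ^ (p - 1) * (v + e) ^ (-q)) (Ioo 0 1) := by
  refine integrableOn_rpow_mul_of_continuousOn (by linarith)
    (ContinuousOn.rpow_const (by fun_prop) fun v hv => Or.inl ?_)
  have := hv.1
  positivity

lemma setIntegral_Ioo_rpow_sub_one {p : ℝ} (hp : 0 < p) :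
    ∫ v in Ioo (0 : ℝ) 1, v ^ (p - 1) = p⁻¹ := by
  rw [← integral_Ioc_eq_integral_Ioo, ← intervalIntegral.integral_of_le zero_le_one,
    integral_rpow (Or.inl (by linarith))]
  simp [Real.zero_rpow hp.ne']

/-- The integral over `(0, 1)` is split at `e`. -/
lemma setIntegral_Ioo_le_add {f g k : ℝ → ℝ} {e : ℝ} (he0 : 0 < e) (he1 : e < 1)
    (hf : IntegrableOn f (Ioo 0 1)) (hg : IntervalIntegrable g volume 0 e)
    (hk : IntervalIntegrable k volume e 1) (hfg : ∀ v ∈ Ioo 0 e, f v ≤ g v)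
    (hfk : ∀ v ∈ Ioo e 1, f v ≤ k v) :
    ∫ v in Ioo (0 : ℝ) 1, f v ≤ (∫ v in (0 : ℝ)..e, g v) + ∫ v in e..1, k v := by
  rw [← intervalIntegrable_iff_integrableOn_Ioo_of_le zero_le_one] at hf
  rw [← integral_Ioc_eq_integral_Ioo, ← intervalIntegral.integral_of_le zero_le_one]
  have h1 : IntervalIntegrable f volume 0 e :=
    hf.mono_set (by rw [uIcc_of_le he0.le, uIcc_of_le zero_le_one]; exact Icc_subset_Icc_right he1.le)
  have h2 : IntervalIntegrable f volume e 1 :=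
    hf.mono_set (by rw [uIcc_of_le he1.le, uIcc_of_le zero_le_one]; exact Icc_subset_Icc_left he0.le)
  rw [← intervalIntegral.integral_add_adjacent_intervals h1 h2]
  exact add_le_add (intervalIntegral.integral_mono_on_of_le_Ioo he0.le h1 hg hfg)
    (intervalIntegral.integral_mono_on_of_le_Ioo he1.le h2 hk hfk)

lemma rpow_mul_add_rpow_le_left {p q e v : ℝ} (hq : 0 ≤ q) (he : 0 < e) (hv : 0 < v) :
    v ^ (p - 1) * (v + e) ^ (-q) ≤ v ^ (p - 1) * e ^ (-q) :=
  mul_le_mul_of_nonneg_left (Real.rpow_le_rpow_of_nonpos he (by linarith) (by linarith))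
    (Real.rpow_nonneg hv.le _)

lemma rpow_mul_add_rpow_le_right {p q e v : ℝ} (hq : 0 ≤ q) (he : 0 < e) (hv : 0 < v) :
    v ^ (p - 1) * (v + e) ^ (-q) ≤ v ^ (p - q - 1) := by
  have h : (v + e) ^ (-q) ≤ v ^ (-q) :=
    Real.rpow_le_rpow_of_nonpos hv (by linarith) (by linarith)
  calc _ ≤ v ^ (p - 1) * v ^ (-q) := mul_le_mul_of_nonneg_left h (Real.rpow_nonneg hv.le _)
    _ = _ := by rw [← Real.rpow_add hv]; ring_nf

lemma intervalIntegral_rpow_sub_one {p e : ℝ} (hp : 0 < p) :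
    ∫ v in (0 : ℝ)..e, v ^ (p - 1) = e ^ p / p := by
  rw [integral_rpow (Or.inl (by linarith))]
  simp [Real.zero_rpow hp.ne']

lemma intervalIntegrable_rpow_sub_one {p e : ℝ} (hp : 0 < p) :
    IntervalIntegrable (fun v : ℝ => v ^ (p - 1)) volume 0 e :=
  intervalIntegral.intervalIntegrable_rpow' (by linarith)

lemma intervalIntegrable_rpow_of_pos (r : ℝ) {e : ℝ} (he : 0 < e) :
    IntervalIntegrable (fun v : ℝ => v ^ r) volume e 1 :=
  intervalIntegral.intervalIntegrable_rpow (Or.inr (by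
    rw [mem_uIcc]; push Not; constructor <;> intro h <;> linarith))

lemma setIntegral_rpow_mul_add_rpow_le_of_one_le {p q e : ℝ} (hp : 0 < p) (hq : 0 ≤ q)
    (he : 1 ≤ e) : ∫ v in Ioo (0 : ℝ) 1, v ^ (p - 1) * (v + e) ^ (-q) ≤ p⁻¹ * e ^ (-q) := by
  have he0 : 0 < e := by linarith
  rw [← setIntegral_Ioo_rpow_sub_one hp, ← integral_mul_const]
  exact setIntegral_mono_on (integrableOn_rpow_mul_add_rpow hp he0 q)
    ((integrableOn_rpow_Ioo (by linarith)).mul_const _) measurableSet_Ioo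
    fun v hv => rpow_mul_add_rpow_le_left hq he0 hv.1

/-- The integrand has size `v ^ (p - 1) * e ^ (-q)` for `v ≤ e` and `v ^ (p - q - 1)` for `v ≥ e`; as
`p < q`, both parts contribute `e ^ (p - q)`. -/
lemma setIntegral_rpow_mul_add_rpow_le_of_lt {p q : ℝ} (hp : 0 < p) (hpq : p < q) {e : ℝ}
    (he : 0 < e) : ∫ v in Ioo (0 : ℝ) 1, v ^ (p - 1) * (v + e) ^ (-q) ≤
      (p⁻¹ + (q - p)⁻¹) * e ^ (p - q) := by
  have hq : 0 ≤ q := by linarith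
  have hqp : 0 < q - p := by linarith
  have hpow : 0 < e ^ (p - q) := Real.rpow_pos_of_pos he _
  rcases le_or_gt 1 e with h1 | h1
  · refine (setIntegral_rpow_mul_add_rpow_le_of_one_le hp hq h1).trans ?_
    have : e ^ (-q) ≤ e ^ (p - q) := Real.rpow_le_rpow_of_exponent_le h1 (by linarith)
    have : p⁻¹ * e ^ (-q) ≤ p⁻¹ * e ^ (p - q) := mul_le_mul_of_nonneg_left this (by positivity)
    have : 0 < (q - p)⁻¹ * e ^ (p - q) := by positivity
    linarith
  · refine (setIntegral_Ioo_le_add he h1 (integrableOn_rpow_mul_add_rpow hp he q)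
      (g := fun v => v ^ (p - 1) * e ^ (-q)) (k := fun v => v ^ (p - q - 1))
      ((intervalIntegrable_rpow_sub_one hp).mul_const _) (intervalIntegrable_rpow_of_pos _ he)
      (fun v hv => rpow_mul_add_rpow_le_left hq he hv.1)
      (fun v hv => rpow_mul_add_rpow_le_right hq he (he.trans hv.1))).trans ?_
    rw [intervalIntegral.integral_mul_const, intervalIntegral_rpow_sub_one hp,
      integral_rpow (Or.inr ⟨by linarith, by
        rw [mem_uIcc]; push Not; constructor <;> intro h <;> linarith⟩)]
    have e1 : e ^ p * e ^ (-q) = e ^ (p - q) := by rw [← Real.rpow_add he]; ring_nf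
    have e2 : (1 ^ (p - q - 1 + 1) - e ^ (p - q - 1 + 1)) / (p - q - 1 + 1) =
        (q - p)⁻¹ * e ^ (p - q) - (q - p)⁻¹ := by
      have : p - q ≠ 0 := by linarith
      rw [sub_add_cancel, Real.one_rpow]
      field_simp
      rw [← neg_sub q p]
      field_simp
      ring
    have : 0 < (q - p)⁻¹ := by positivity
    rw [e2, div_mul_eq_mul_div, e1, add_mul, div_eq_inv_mul]
    linarith

lemma log_two_le_log_add_two {x : ℝ} (hx : 0 ≤ x) : Real.log 2 ≤ Real.log (x + 2) :=
  Real.log_le_log (by norm_num) (by linarith)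

/-- The borderline case `q = p`, in which the part over `v ≥ e` contributes a logarithm. -/
lemma setIntegral_rpow_mul_add_rpow_le_log {p : ℝ} (hp : 0 < p) {e : ℝ} (he : 0 < e) :
    ∫ v in Ioo (0 : ℝ) 1, v ^ (p - 1) * (v + e) ^ (-p) ≤
      (p⁻¹ / Real.log 2 + 1) * Real.log (1 / e + 2) := by
  have hl2 : 0 < Real.log 2 := Real.log_pos (by norm_num)
  have hlog : Real.log 2 ≤ Real.log (1 / e + 2) := log_two_le_log_add_two (by positivity)
  have h0 : p⁻¹ ≤ p⁻¹ / Real.log 2 * Real.log (1 / e + 2) := by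
    rw [div_mul_eq_mul_div, le_div_iff₀ hl2]
    exact mul_le_mul_of_nonneg_left hlog (by positivity)
  rcases le_or_gt 1 e with h1 | h1
  · refine (setIntegral_rpow_mul_add_rpow_le_of_one_le hp hp.le h1).trans ?_
    have : e ^ (-p) ≤ 1 := Real.rpow_le_one_of_one_le_of_nonpos h1 (by linarith)
    have : p⁻¹ * e ^ (-p) ≤ p⁻¹ := mul_le_of_le_one_right (by positivity) this
    linarith
  · refine (setIntegral_Ioo_le_add he h1 (integrableOn_rpow_mul_add_rpow hp he p)
      (g := fun v => v ^ (p - 1) * e ^ (-p)) (k := fun v => v ^ (p - p - 1))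
      ((intervalIntegrable_rpow_sub_one hp).mul_const _) (intervalIntegrable_rpow_of_pos _ he)
      (fun v hv => rpow_mul_add_rpow_le_left hp.le he hv.1)
      (fun v hv => rpow_mul_add_rpow_le_right hp.le he (he.trans hv.1))).trans ?_
    have e2 : ∫ v in e..1, v ^ (p - p - 1) = Real.log (1 / e) := by
      simp only [sub_self, zero_sub, Real.rpow_neg_one]
      exact integral_inv (by rw [mem_uIcc]; push Not; constructor <;> intro h <;> linarith)
    have e1 : e ^ p * e ^ (-p) = 1 := by rw [← Real.rpow_add he]; simp
    rw [e2, intervalIntegral.integral_mul_const, intervalIntegral_rpow_sub_one hp,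
      div_mul_eq_mul_div, e1, add_mul, one_mul, one_div p]
    have : Real.log (1 / e) ≤ Real.log (1 / e + 2) :=
      Real.log_le_log (by positivity) (by linarith)
    linarith

/-! ### Estimates of the radial integral -/

lemma radialIntegral_le_of_pos {lam : ℝ} (hlam : 0 ≤ lam) {β : ℝ} (hβ : 0 < β) {m : ℕ}
    (hm : β < m) : ∃ C : ℝ, 0 < C ∧ ∀ a r : ℝ, 0 < a → 0 < r →
      radialIntegral lam β m a r ≤ C * (a⁻¹ * r ^ (-(2 * lam)) * min a r ^ (-β)) := by
  have hmβ : 0 < (m : ℝ) - β := by linarith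
  refine ⟨(m - β)⁻¹ + β⁻¹, by positivity, fun a r ha hr => ?_⟩
  have hd : 0 < min a r := lt_min ha hr
  have hJ := setIntegral_rpow_mul_add_rpow_le_of_lt hmβ (by linarith : (m : ℝ) - β < m) hd
  rw [show (m : ℝ) - (m - β) = β by ring, show (m : ℝ) - β - m = -β by ring] at hJ
  calc radialIntegral lam β m a r
      ≤ ∫ v in Ioo (0 : ℝ) 1, (a⁻¹ * r ^ (-(2 * lam))) *
          (v ^ ((m : ℝ) - β - 1) * (v + min a r) ^ (-(m : ℝ))) := by
        refine setIntegral_mono_on (integrableOn_radial lam hm ha hr)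
          ((integrableOn_rpow_mul_add_rpow hmβ hd _).const_mul _) measurableSet_Ioo fun v hv => ?_
        have hv0 := hv.1
        have h1 : (a + v) ^ (-1 : ℝ) ≤ a⁻¹ := by
          rw [Real.rpow_neg_one]; exact inv_anti₀ ha (by linarith)
        have h2 : (r + v) ^ (-(2 * lam)) ≤ r ^ (-(2 * lam)) :=
          Real.rpow_le_rpow_of_nonpos hr (by linarith) (by linarith)
        rw [add_comm v]
        calc _ ≤ v ^ ((m : ℝ) - β - 1) * (a⁻¹ * r ^ (-(2 * lam)) * (min a r + v) ^ (-(m : ℝ))) := by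
              gcongr
          _ = _ := by ring
    _ ≤ _ := by
        rw [integral_const_mul]
        calc _ ≤ (a⁻¹ * r ^ (-(2 * lam))) * (((m - β)⁻¹ + β⁻¹) * min a r ^ (-β)) := by gcongr
          _ = _ := by ring

/-- The bound for `β < 0`. The factor `(r + u) ^ (-2 lam)` is split into powers with exponents
`-(2 lam - δ)` and `-δ`, and the latter is put on `u`. -/
lemma radialIntegral_zero_le {lam β : ℝ} {δ : ℝ} (h0 : 0 ≤ δ)
    (h1 : δ ≤ 2 * lam) (h2 : -1 - β < δ) (h3 : δ < -β) : ∃ C : ℝ, 0 < C ∧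
      ∀ a r : ℝ, 0 < a → 0 < r →
      radialIntegral lam β 0 a r ≤ C * (r ^ (-(2 * lam - δ)) * a ^ (-(β + 1 + δ))) := by
  have hp : 0 < -β - δ := by linarith
  have hq : 0 < 1 - (-β - δ) := by linarith
  refine ⟨(-β - δ)⁻¹ + (1 - (-β - δ))⁻¹, by positivity, fun a r ha hr => ?_⟩
  have hJ := setIntegral_rpow_mul_add_rpow_le_of_lt hp (by linarith : -β - δ < 1) ha
  rw [show -β - δ - 1 = -(β + 1 + δ) by ring] at hJ
  have hm : β < ((0 : ℕ) : ℝ) := by simp; linarith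
  calc radialIntegral lam β 0 a r
      ≤ ∫ v in Ioo (0 : ℝ) 1, (r ^ (-(2 * lam - δ))) *
          (v ^ (-(β + 1 + δ)) * (v + a) ^ (-1 : ℝ)) := by
        refine setIntegral_mono_on (integrableOn_radial lam hm ha hr) ?_ measurableSet_Ioo
          fun v hv => ?_
        · have := (integrableOn_rpow_mul_add_rpow hp ha 1).const_mul (r ^ (-(2 * lam - δ)))
          rwa [show -β - δ - 1 = -(β + 1 + δ) by ring] at this
        have hv0 := hv.1
        have hx : (r + v) ^ (-(2 * lam)) ≤ r ^ (-(2 * lam - δ)) * v ^ (-δ) := by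
          have : (r + v) ^ (-(2 * lam)) = (r + v) ^ (-(2 * lam - δ)) * (r + v) ^ (-δ) := by
            rw [← Real.rpow_add (by positivity)]; ring_nf
          rw [this]
          refine mul_le_mul (Real.rpow_le_rpow_of_nonpos hr (by linarith) (by linarith))
            (Real.rpow_le_rpow_of_nonpos hv0 (by linarith) (by linarith)) (by positivity)
            (by positivity)
        have hy : v ^ (((0 : ℕ) : ℝ) - β - 1) * v ^ (-δ) = v ^ (-(β + 1 + δ)) := by
          rw [← Real.rpow_add hv0]; push_cast; ring_nf
        have hz : (min a r + v) ^ (-((0 : ℕ) : ℝ)) = 1 := by simp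
        rw [hz, mul_one, ← hy, add_comm v a]
        calc _ ≤ v ^ (((0 : ℕ) : ℝ) - β - 1) *
              ((a + v) ^ (-1 : ℝ) * (r ^ (-(2 * lam - δ)) * v ^ (-δ))) := by gcongr
          _ = _ := by ring
    _ ≤ _ := by
        rw [integral_const_mul]
        calc _ ≤ r ^ (-(2 * lam - δ)) *
              (((-β - δ)⁻¹ + (1 - (-β - δ))⁻¹) * a ^ (-(β + 1 + δ))) := by gcongr
          _ = _ := by ring

/-- For `β < -1` the factor `(a + u)⁻¹` is dominated by `u⁻¹`. -/
lemma radialIntegral_zero_le_setIntegral {lam β : ℝ} (hβ : β < -1) {a r : ℝ}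
    (ha : 0 < a) (hr : 0 < r) : radialIntegral lam β 0 a r ≤
      ∫ v in Ioo (0 : ℝ) 1, v ^ (-β - 1 - 1) * (v + r) ^ (-(2 * lam)) := by
  have hm : β < ((0 : ℕ) : ℝ) := by simp; linarith
  refine setIntegral_mono_on (integrableOn_radial lam hm ha hr)
    (integrableOn_rpow_mul_add_rpow (by linarith) hr _) measurableSet_Ioo fun v hv => ?_
  have hv0 := hv.1
  have hz : (min a r + v) ^ (-((0 : ℕ) : ℝ)) = 1 := by simp
  have hy : v ^ (((0 : ℕ) : ℝ) - β - 1) * v ^ (-1 : ℝ) = v ^ (-β - 1 - 1) := by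
    rw [← Real.rpow_add hv0]; push_cast; ring_nf
  have hx : (a + v) ^ (-1 : ℝ) ≤ v ^ (-1 : ℝ) :=
    Real.rpow_le_rpow_of_nonpos hv0 (by linarith) (by norm_num)
  rw [hz, mul_one, ← hy, add_comm v r, mul_assoc]
  gcongr

lemma radialIntegral_neg_one_le {lam : ℝ} (hlam : 0 < lam) : ∃ C : ℝ, 0 < C ∧
      ∀ a r : ℝ, 0 < a → 0 < r →
      radialIntegral lam (-1) 0 a r ≤ C * (r ^ (-(2 * lam)) * Real.log (r / a + 2)) := by
  have hl2 : 0 < Real.log 2 := Real.log_pos (by norm_num)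
  refine ⟨1 + (2 * lam)⁻¹ / Real.log 2, by positivity, fun a r ha hr => ?_⟩
  have hm : (-1 : ℝ) < ((0 : ℕ) : ℝ) := by norm_num
  have hlog : Real.log 2 ≤ Real.log (r / a + 2) := log_two_le_log_add_two (by positivity)
  have hrp : 0 < r ^ (-(2 * lam)) := Real.rpow_pos_of_pos hr _
  have hfun : ∀ v : ℝ, 0 < v → v ^ (((0 : ℕ) : ℝ) - (-1) - 1) * ((a + v) ^ (-1 : ℝ) *
      (r + v) ^ (-(2 * lam)) * (min a r + v) ^ (-((0 : ℕ) : ℝ))) =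
      (a + v)⁻¹ * (r + v) ^ (-(2 * lam)) := fun v hv => by
    rw [Real.rpow_neg_one]; simp
  -- the part of the integral over `(0, e)`, for `e ≤ r`
  have hgi : ∀ e : ℝ, 0 < e →
      IntervalIntegrable (fun v : ℝ => r ^ (-(2 * lam)) * (a + v)⁻¹) volume 0 e := fun e he => by
    refine ContinuousOn.intervalIntegrable ?_
    rw [uIcc_of_le he.le]
    refine continuousOn_const.mul (ContinuousOn.inv₀ (by fun_prop) fun v hv => ?_)
    have := hv.1
    positivity
  have hg : ∀ e : ℝ, 0 < e → e ≤ r → ∫ v in (0 : ℝ)..e, r ^ (-(2 * lam)) * (a + v)⁻¹ ≤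
      r ^ (-(2 * lam)) * Real.log (r / a + 2) := fun e he her => by
    rw [intervalIntegral.integral_const_mul]
    refine mul_le_mul_of_nonneg_left ?_ hrp.le
    rw [intervalIntegral.integral_comp_add_left (fun x => x⁻¹) a, integral_inv_of_pos (by linarith)
      (by linarith)]
    refine Real.log_le_log (by positivity) ?_
    rw [add_zero, add_div, div_self ha.ne']
    have : e / a ≤ r / a := by gcongr
    linarith
  have hgle : ∀ v : ℝ, 0 < v → (a + v)⁻¹ * (r + v) ^ (-(2 * lam)) ≤
      r ^ (-(2 * lam)) * (a + v)⁻¹ := fun v hv => by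
    rw [mul_comm]
    refine mul_le_mul_of_nonneg_right ?_ (by positivity)
    exact Real.rpow_le_rpow_of_nonpos hr (by linarith) (by linarith)
  have hfi := integrableOn_radial lam hm ha hr
  have hpos : 0 < (2 * lam)⁻¹ / Real.log 2 * (r ^ (-(2 * lam)) * Real.log (r / a + 2)) := by
    have := hl2.trans_le hlog
    positivity
  rcases le_or_gt 1 r with h1 | h1
  · have h01 := (hgi 1 one_pos)
    rw [intervalIntegrable_iff_integrableOn_Ioo_of_le zero_le_one] at h01
    have := setIntegral_mono_on hfi h01 measurableSet_Ioo
      (fun v hv => by rw [hfun v hv.1]; exact hgle v hv.1)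
    rw [← integral_Ioc_eq_integral_Ioo (f := fun v : ℝ => r ^ (-(2 * lam)) * (a + v)⁻¹),
      ← intervalIntegral.integral_of_le zero_le_one] at this
    refine (this.trans (hg 1 one_pos h1)).trans ?_
    rw [add_mul, one_mul]; linarith
  · refine (setIntegral_Ioo_le_add hr h1 hfi (hgi r hr)
      (intervalIntegrable_rpow_of_pos (-(2 * lam) - 1) hr)
      (fun v hv => by rw [hfun v hv.1]; exact hgle v hv.1) (fun v hv => ?_)).trans ?_
    · have hv0 : 0 < v := hr.trans hv.1
      rw [hfun v hv0, Real.rpow_sub_one hv0.ne', div_eq_mul_inv, mul_comm]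
      refine mul_le_mul (Real.rpow_le_rpow_of_nonpos hv0 (by linarith) (by linarith))
        (inv_anti₀ hv0 (by linarith)) (by positivity) (by positivity)
    · have e2 : ∫ v in r..1, v ^ (-(2 * lam) - 1) ≤ (2 * lam)⁻¹ * r ^ (-(2 * lam)) := by
        rw [integral_rpow (Or.inr ⟨by linarith, by
          rw [mem_uIcc]; push Not; constructor <;> intro h <;> linarith⟩), sub_add_cancel,
          Real.one_rpow]
        have : (1 - r ^ (-(2 * lam))) / (-(2 * lam)) =
            (2 * lam)⁻¹ * r ^ (-(2 * lam)) - (2 * lam)⁻¹ := by field_simp; ring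
        rw [this]
        have : 0 < (2 * lam)⁻¹ := by positivity
        linarith
      have e3 : (2 * lam)⁻¹ * r ^ (-(2 * lam)) ≤
          (2 * lam)⁻¹ / Real.log 2 * (r ^ (-(2 * lam)) * Real.log (r / a + 2)) := by
        rw [div_mul_eq_mul_div, le_div_iff₀ hl2]
        calc _ ≤ (2 * lam)⁻¹ * r ^ (-(2 * lam)) * Real.log (r / a + 2) := by gcongr
          _ = _ := by ring
      rw [add_mul, one_mul]
      exact add_le_add (hg r hr le_rfl) (e2.trans e3)

/-! ### Moments of the mixed distance -/

/-- The convex combination of `a ^ 2` and `b ^ 2` with weights `1 - s`, `s`. For `a = ‖1 - z w̄‖` and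
`b = ‖1 - z w‖` it is `‖1 - mixPoint z w s‖ ^ 2`. -/
def mixSq (a b s : ℝ) : ℝ := (1 - s) * a ^ 2 + s * b ^ 2

lemma mixSq_pos {a b : ℝ} (ha : 0 < a) (hb : 0 < b) {s : ℝ} (hs : s ∈ Icc (0 : ℝ) 1) :
    0 < mixSq a b s := by
  rcases hs.1.eq_or_lt with h | h
  · rw [mixSq, ← h]; simpa using by positivity
  · have : 0 ≤ 1 - s := by linarith [hs.2]
    rw [mixSq]; positivity

lemma continuousOn_mixSq_rpow {a b : ℝ} (ha : 0 < a) (hb : 0 < b) (e : ℝ) :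
    ContinuousOn (fun s => mixSq a b s ^ e) (Icc 0 1) := by
  refine ContinuousOn.rpow_const ?_ fun s hs => Or.inl (mixSq_pos ha hb hs).ne'
  unfold mixSq
  fun_prop

/-- The `-κ`-th moment of `√(mixSq a b s)`. -/
def mixMoment (lam κ a b : ℝ) : ℝ := ∫ s, mixSq a b s ^ (-(κ / 2)) ∂mixMeasure lam

lemma mixMoment_lam_zero (κ a : ℝ) {b : ℝ} (hb : 0 < b) : mixMoment 0 κ a b = b ^ (-κ) := by
  rw [mixMoment, mixMeasure_zero, integral_dirac, mixSq, sub_self, zero_mul, zero_add, one_mul,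
    ← Real.rpow_natCast, ← Real.rpow_mul hb.le]
  push_cast
  ring_nf

lemma mixMoment_le {lam : ℝ} (hlam : 0 < lam) {κ a b : ℝ} (ha : 0 < a) (hb : 0 < b) {g : ℝ → ℝ}
    (hg : IntegrableOn g (Ioo 0 1))
    (h : ∀ s ∈ Ioo (0 : ℝ) 1, (s ^ lam * (1 - s) ^ (lam - 1)) * mixSq a b s ^ (-(κ / 2)) ≤ g s) :
    mixMoment lam κ a b ≤
      (ProbabilityTheory.beta (lam + 1) lam)⁻¹ * ∫ s in Ioo (0 : ℝ) 1, g s := by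
  rw [mixMoment, integral_mixMeasure hlam, smul_eq_mul]
  refine mul_le_mul_of_nonneg_left ?_
    (inv_nonneg.mpr (ProbabilityTheory.beta_pos (by linarith) hlam).le)
  refine setIntegral_mono_on ?_ hg measurableSet_Ioo h
  have hi := integrableOn_beta (by linarith : 0 < lam + 1) hlam
  rw [add_sub_cancel_right] at hi
  rw [← integrableOn_Icc_iff_integrableOn_Ioo] at hi ⊢
  exact hi.mul_continuousOn (continuousOn_mixSq_rpow ha hb _) isCompact_Icc

lemma sq_rpow_neg_half {x : ℝ} (hx : 0 < x) (κ : ℝ) : (x ^ 2) ^ (-(κ / 2)) = x ^ (-κ) := by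
  rw [← Real.rpow_natCast, ← Real.rpow_mul hx.le]; push_cast; ring_nf

/-- Below the critical exponent `2 lam` the moments see only the larger of `a` and `b`: the lower
bound `s (1 - s) (a + b) ^ 2 / 2` of `mixSq` costs powers of `s` and `1 - s` which remain
integrable. -/
lemma exists_mixMoment_le_of_lt {lam : ℝ} (hlam : 0 ≤ lam) {κ : ℝ} (hκ : 0 ≤ κ)
    (h : κ < 2 * lam ∨ κ = 0) : ∃ C : ℝ, 0 < C ∧ ∀ a b : ℝ, 0 < a → 0 < b →
      mixMoment lam κ a b ≤ C * (a + b) ^ (-κ) := by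
  rcases h with h | rfl
  swap
  · refine ⟨1, one_pos, fun a b _ _ => ?_⟩
    have := isProbabilityMeasure_mixMeasure hlam
    simp [mixMoment]
  have hpos : 0 < lam := by linarith
  have hp : 0 < lam - κ / 2 + 1 := by linarith
  have hq : 0 < lam - κ / 2 := by linarith
  have hB := ProbabilityTheory.beta_pos (by linarith : 0 < lam + 1) hpos
  have hI : 0 < ∫ t in Ioo (0 : ℝ) 1, t ^ (lam - κ / 2 + 1 - 1) * (1 - t) ^ (lam - κ / 2 - 1) := by
    rw [integral_beta hp hq]
    exact div_pos (mul_pos (Real.Gamma_pos_of_pos hp) (Real.Gamma_pos_of_pos hq))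
      (Real.Gamma_pos_of_pos (by linarith))
  refine ⟨(ProbabilityTheory.beta (lam + 1) lam)⁻¹ * ((2⁻¹ : ℝ) ^ (-(κ / 2)) *
    ∫ t in Ioo (0 : ℝ) 1, t ^ (lam - κ / 2 + 1 - 1) * (1 - t) ^ (lam - κ / 2 - 1)),
    by positivity, fun a b ha hb => ?_⟩
  refine (mixMoment_le hpos ha hb
    ((integrableOn_beta hp hq).const_mul ((2⁻¹ : ℝ) ^ (-(κ / 2)) * (a + b) ^ (-κ)))
    fun s hs => ?_).trans ?_
  · have hs1 : 0 < 1 - s := by linarith [hs.2]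
    have hs0 := hs.1
    have h1 : s * (1 - s) * (2⁻¹ * (a + b) ^ 2) ≤ mixSq a b s := by
      have h2 : 2⁻¹ * (a + b) ^ 2 ≤ a ^ 2 + b ^ 2 := by nlinarith [sq_nonneg (a - b)]
      have h3 : s * (1 - s) * (2⁻¹ * (a + b) ^ 2) ≤ s * (1 - s) * (a ^ 2 + b ^ 2) := by gcongr
      have h4 : 0 ≤ (1 - s) * (1 - s) * a ^ 2 + s * s * b ^ 2 := by positivity
      rw [mixSq]; nlinarith
    have h5 : mixSq a b s ^ (-(κ / 2)) ≤ (s * (1 - s) * (2⁻¹ * (a + b) ^ 2)) ^ (-(κ / 2)) :=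
      Real.rpow_le_rpow_of_nonpos (by positivity) h1 (by linarith)
    have h6 : (s * (1 - s) * (2⁻¹ * (a + b) ^ 2)) ^ (-(κ / 2)) =
        s ^ (-(κ / 2)) * (1 - s) ^ (-(κ / 2)) * ((2⁻¹ : ℝ) ^ (-(κ / 2)) * (a + b) ^ (-κ)) := by
      rw [Real.mul_rpow (by positivity) (by positivity), Real.mul_rpow hs0.le hs1.le,
        Real.mul_rpow (by norm_num) (by positivity), sq_rpow_neg_half (by positivity)]
    have h7 : s ^ (lam - κ / 2 + 1 - 1) = s ^ lam * s ^ (-(κ / 2)) := by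
      rw [← Real.rpow_add hs0]; ring_nf
    have h8 : (1 - s) ^ (lam - κ / 2 - 1) = (1 - s) ^ (lam - 1) * (1 - s) ^ (-(κ / 2)) := by
      rw [← Real.rpow_add hs1]; ring_nf
    rw [h6] at h5
    rw [h7, h8]
    calc _ ≤ s ^ lam * (1 - s) ^ (lam - 1) * (s ^ (-(κ / 2)) * (1 - s) ^ (-(κ / 2)) *
        ((2⁻¹ : ℝ) ^ (-(κ / 2)) * (a + b) ^ (-κ))) := by gcongr
      _ = _ := by ring
  · rw [integral_const_mul]
    exact le_of_eq (by ring)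

/-- The critical moment in the region `a ≤ b`. The density contains `s ^ lam`, which absorbs the power
`s ^ (-lam)` from the lower bound `s (a + b) ^ 2 / 4` of `mixSq`. -/
lemma exists_mixMoment_crit_le_of_le {lam : ℝ} (hlam : 0 ≤ lam) : ∃ C : ℝ, 0 < C ∧
    ∀ a b : ℝ, 0 < a → 0 < b → a ≤ b →
      mixMoment lam (2 * lam) a b ≤ C * (a + b) ^ (-(2 * lam)) := by
  rcases hlam.eq_or_lt with rfl | hpos
  · refine ⟨1, one_pos, fun a b ha hb _ => ?_⟩
    rw [mixMoment_lam_zero _ _ hb]; simp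
  have hB := ProbabilityTheory.beta_pos (by linarith : 0 < lam + 1) hpos
  refine ⟨(ProbabilityTheory.beta (lam + 1) lam)⁻¹ * ((4⁻¹ : ℝ) ^ (-lam) * lam⁻¹),
    by positivity, fun a b ha hb hab => ?_⟩
  refine (mixMoment_le hpos ha hb
    ((integrableOn_Ioo_one_sub (f := fun v => v ^ (lam - 1))
      (integrableOn_rpow_Ioo (by linarith))).const_mul ((4⁻¹ : ℝ) ^ (-lam) * (a + b) ^ (-(2 * lam))))
    fun s hs => ?_).trans ?_
  · have hs1 : 0 < 1 - s := by linarith [hs.2]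
    have hs0 := hs.1
    have h1 : s * (4⁻¹ * (a + b) ^ 2) ≤ mixSq a b s := by
      have h2 : 4⁻¹ * (a + b) ^ 2 ≤ b ^ 2 := by nlinarith
      have h3 : s * (4⁻¹ * (a + b) ^ 2) ≤ s * b ^ 2 := by gcongr
      have h4 : 0 ≤ (1 - s) * a ^ 2 := by positivity
      rw [mixSq]; linarith
    have h5 : mixSq a b s ^ (-(2 * lam / 2)) ≤ (s * (4⁻¹ * (a + b) ^ 2)) ^ (-(2 * lam / 2)) :=
      Real.rpow_le_rpow_of_nonpos (by positivity) h1 (by linarith)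
    have h6 : (s * (4⁻¹ * (a + b) ^ 2)) ^ (-(2 * lam / 2)) =
        s ^ (-lam) * ((4⁻¹ : ℝ) ^ (-lam) * (a + b) ^ (-(2 * lam))) := by
      rw [Real.mul_rpow hs0.le (by positivity), Real.mul_rpow (by norm_num) (by positivity),
        sq_rpow_neg_half (by positivity), mul_div_cancel_left₀ _ (two_ne_zero)]
    have h7 : s ^ lam * s ^ (-lam) = 1 := by rw [← Real.rpow_add hs0]; simp
    rw [h6] at h5
    calc _ ≤ s ^ lam * (1 - s) ^ (lam - 1) *
          (s ^ (-lam) * ((4⁻¹ : ℝ) ^ (-lam) * (a + b) ^ (-(2 * lam)))) := by gcongr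
      _ = (s ^ lam * s ^ (-lam)) * ((4⁻¹ : ℝ) ^ (-lam) * (a + b) ^ (-(2 * lam)) *
          (1 - s) ^ (lam - 1)) := by ring
      _ = _ := by rw [h7, one_mul]
  · rw [integral_const_mul, setIntegral_Ioo_one_sub (fun v => v ^ (lam - 1)),
      setIntegral_Ioo_rpow_sub_one hpos]
    exact le_of_eq (by ring)

lemma rpow_neg_le_two_rpow_mul_add {a b e : ℝ} (ha : 0 < a) (hb : 0 < b) (h : b ≤ a) (he : 0 ≤ e) :
    a ^ (-e) ≤ 2 ^ e * (a + b) ^ (-e) := by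
  have h1 : (2 * a) ^ (-e) ≤ (a + b) ^ (-e) :=
    Real.rpow_le_rpow_of_nonpos (by positivity) (by linarith) (by linarith)
  rw [Real.mul_rpow (by norm_num) ha.le, Real.rpow_neg (by norm_num : (0 : ℝ) ≤ 2),
    inv_mul_le_iff₀ (by positivity)] at h1
  exact h1

lemma sq_div_sq_rpow {a b : ℝ} (ha : 0 < a) (hb : 0 < b) (p : ℝ) :
    ((b / a) ^ 2) ^ p = b ^ (2 * p) * a ^ (-(2 * p)) := by
  rw [← Real.rpow_natCast, ← Real.rpow_mul (by positivity), Real.div_rpow hb.le ha.le,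
    Real.rpow_neg ha.le]
  rfl

/-- The critical moment in the region `b ≤ a`. There `mixSq` is at least `s a ^ 2 ((1 - s) + e)` with
`e = (b / a) ^ 2`, and the singularity of the density at `s = 1` produces a logarithm. -/
lemma exists_mixMoment_crit_le_of_ge {lam : ℝ} (hlam : 0 ≤ lam) : ∃ C : ℝ, 0 < C ∧
    ∀ a b : ℝ, 0 < a → 0 < b → b ≤ a →
      mixMoment lam (2 * lam) a b ≤ C * ((a + b) ^ (-(2 * lam)) * Real.log (a / b + 2)) := by
  have hl2 : 0 < Real.log 2 := Real.log_pos (by norm_num)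
  rcases hlam.eq_or_lt with rfl | hpos
  · refine ⟨(Real.log 2)⁻¹, by positivity, fun a b ha hb _ => ?_⟩
    have := log_two_le_log_add_two (by positivity : 0 ≤ a / b)
    rw [mixMoment_lam_zero _ _ hb]
    simp only [mul_zero, neg_zero, Real.rpow_zero, one_mul]
    rw [inv_mul_eq_div, le_div_iff₀ hl2]; linarith
  have hB := ProbabilityTheory.beta_pos (by linarith : 0 < lam + 1) hpos
  refine ⟨(ProbabilityTheory.beta (lam + 1) lam)⁻¹ * (2 ^ (2 * lam) *
    ((lam⁻¹ / Real.log 2 + 1) * 2)), by positivity, fun a b ha hb hab => ?_⟩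
  set e : ℝ := (b / a) ^ 2 with he
  have he0 : 0 < e := by positivity
  refine (mixMoment_le hpos ha hb
    ((integrableOn_Ioo_one_sub (f := fun v => v ^ (lam - 1) * (v + e) ^ (-lam))
      (integrableOn_rpow_mul_add_rpow hpos he0 lam)).const_mul (a ^ (-(2 * lam))))
    fun s hs => ?_).trans ?_
  · have hs1 : 0 < 1 - s := by linarith [hs.2]
    have hs0 := hs.1
    have h1 : s * (a ^ 2 * ((1 - s) + e)) ≤ mixSq a b s := by
      have : a ^ 2 * ((1 - s) + e) = (1 - s) * a ^ 2 + b ^ 2 := by rw [he]; field_simp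
      rw [this, mixSq]
      have : 0 ≤ (1 - s) * ((1 - s) * a ^ 2) := by positivity
      nlinarith
    have h5 : mixSq a b s ^ (-(2 * lam / 2)) ≤ (s * (a ^ 2 * ((1 - s) + e))) ^ (-(2 * lam / 2)) :=
      Real.rpow_le_rpow_of_nonpos (by positivity) h1 (by linarith)
    have h6 : (s * (a ^ 2 * ((1 - s) + e))) ^ (-(2 * lam / 2)) =
        s ^ (-lam) * (a ^ (-(2 * lam)) * ((1 - s) + e) ^ (-lam)) := by
      rw [Real.mul_rpow hs0.le (by positivity), Real.mul_rpow (by positivity) (by positivity),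
        sq_rpow_neg_half ha, mul_div_cancel_left₀ _ (two_ne_zero)]
    have h7 : s ^ lam * s ^ (-lam) = 1 := by rw [← Real.rpow_add hs0]; simp
    rw [h6] at h5
    calc _ ≤ s ^ lam * (1 - s) ^ (lam - 1) *
          (s ^ (-lam) * (a ^ (-(2 * lam)) * ((1 - s) + e) ^ (-lam))) := by gcongr
      _ = (s ^ lam * s ^ (-lam)) * (a ^ (-(2 * lam)) *
          ((1 - s) ^ (lam - 1) * ((1 - s) + e) ^ (-lam))) := by ring
      _ = _ := by rw [h7, one_mul]
  · rw [integral_const_mul, setIntegral_Ioo_one_sub (fun v => v ^ (lam - 1) * (v + e) ^ (-lam))]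
    have hJ := setIntegral_rpow_mul_add_rpow_le_log hpos he0
    have hlog : Real.log (1 / e + 2) ≤ 2 * Real.log (a / b + 2) := by
      have hab' : 0 < a / b := by positivity
      have : (2 : ℝ) * Real.log (a / b + 2) = Real.log ((a / b + 2) ^ 2) := by
        rw [Real.log_pow]; norm_num
      rw [this]
      refine Real.log_le_log (by positivity) ?_
      have h1e : 1 / e = (a / b) ^ 2 := by rw [he]; field_simp
      rw [h1e]; nlinarith
    have ha' := rpow_neg_le_two_rpow_mul_add ha hb hab (by linarith : 0 ≤ 2 * lam)
    rw [mul_assoc]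
    refine mul_le_mul_of_nonneg_left ?_ (by positivity)
    have hl0 : 0 < Real.log (a / b + 2) :=
      hl2.trans_le (log_two_le_log_add_two (by positivity))
    have hJ' := hJ.trans (mul_le_mul_of_nonneg_left hlog (by positivity))
    have hI0 : 0 ≤ ∫ v in Ioo (0 : ℝ) 1, v ^ (lam - 1) * (v + e) ^ (-lam) :=
      setIntegral_nonneg measurableSet_Ioo fun v hv => by
        have := hv.1
        positivity
    calc _ ≤ (2 ^ (2 * lam) * (a + b) ^ (-(2 * lam))) *
          ((lam⁻¹ / Real.log 2 + 1) * (2 * Real.log (a / b + 2))) :=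
          mul_le_mul ha' hJ' hI0 (by positivity)
      _ = _ := by ring

/-- Above the critical exponent, in the region `b ≤ a`. -/
lemma exists_mixMoment_le_of_gt {lam : ℝ} (hlam : 0 ≤ lam) {κ : ℝ} (hκ : 2 * lam < κ) :
    ∃ C : ℝ, 0 < C ∧ ∀ a b : ℝ, 0 < a → 0 < b → b ≤ a →
      mixMoment lam κ a b ≤ C * ((a + b) ^ (-(2 * lam)) * b ^ (2 * lam - κ)) := by
  rcases hlam.eq_or_lt with rfl | hpos
  · refine ⟨1, one_pos, fun a b ha hb _ => ?_⟩
    rw [mixMoment_lam_zero _ _ hb]; simp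
  have hB := ProbabilityTheory.beta_pos (by linarith : 0 < lam + 1) hpos
  have hκ' : 0 < κ / 2 - lam := by linarith
  refine ⟨(ProbabilityTheory.beta (lam + 1) lam)⁻¹ * (2 ^ (2 * lam) *
    ((2⁻¹ : ℝ) ^ (-(κ / 2)) * (lam⁻¹ + (κ / 2 - lam)⁻¹))), by positivity, fun a b ha hb hab => ?_⟩
  set e : ℝ := (b / a) ^ 2 with he
  have he0 : 0 < e := by positivity
  refine (mixMoment_le hpos ha hb
    ((integrableOn_Ioo_one_sub (f := fun v => v ^ (lam - 1) * (v + e) ^ (-(κ / 2)))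
      (integrableOn_rpow_mul_add_rpow hpos he0 (κ / 2))).const_mul
        ((2⁻¹ : ℝ) ^ (-(κ / 2)) * a ^ (-κ))) fun s hs => ?_).trans ?_
  · have hs1 : 0 < 1 - s := by linarith [hs.2]
    have hs0 := hs.1
    have h1 : 2⁻¹ * (a ^ 2 * ((1 - s) + e)) ≤ mixSq a b s := by
      have : a ^ 2 * ((1 - s) + e) = (1 - s) * a ^ 2 + b ^ 2 := by rw [he]; field_simp
      rw [this, mixSq]
      have : b ^ 2 ≤ a ^ 2 := pow_le_pow_left₀ hb.le hab 2
      nlinarith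
    have h5 : mixSq a b s ^ (-(κ / 2)) ≤ (2⁻¹ * (a ^ 2 * ((1 - s) + e))) ^ (-(κ / 2)) :=
      Real.rpow_le_rpow_of_nonpos (by positivity) h1 (by linarith)
    have h6 : (2⁻¹ * (a ^ 2 * ((1 - s) + e))) ^ (-(κ / 2)) =
        (2⁻¹ : ℝ) ^ (-(κ / 2)) * (a ^ (-κ) * ((1 - s) + e) ^ (-(κ / 2))) := by
      rw [Real.mul_rpow (by norm_num) (by positivity), Real.mul_rpow (by positivity)
        (by positivity), sq_rpow_neg_half ha]
    have h7 : s ^ lam ≤ 1 := Real.rpow_le_one hs0.le hs.2.le hlam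
    rw [h6] at h5
    calc _ ≤ 1 * (1 - s) ^ (lam - 1) *
          ((2⁻¹ : ℝ) ^ (-(κ / 2)) * (a ^ (-κ) * ((1 - s) + e) ^ (-(κ / 2)))) := by
          have := (mixSq_pos ha hb (Ioo_subset_Icc_self hs)).le
          gcongr
      _ = _ := by ring
  · rw [integral_const_mul, setIntegral_Ioo_one_sub
      (fun v => v ^ (lam - 1) * (v + e) ^ (-(κ / 2)))]
    have hJ := setIntegral_rpow_mul_add_rpow_le_of_lt hpos (by linarith : lam < κ / 2) he0
    rw [he, sq_div_sq_rpow ha hb, ← he] at hJ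
    have ha' := rpow_neg_le_two_rpow_mul_add ha hb hab (by linarith : 0 ≤ 2 * lam)
    have hexp : a ^ (-κ) * a ^ (-(2 * (lam - κ / 2))) = a ^ (-(2 * lam)) := by
      rw [← Real.rpow_add ha]; ring_nf
    have hbe : b ^ (2 * (lam - κ / 2)) = b ^ (2 * lam - κ) := by ring_nf
    rw [mul_assoc (ProbabilityTheory.beta (lam + 1) lam)⁻¹]
    refine mul_le_mul_of_nonneg_left ?_ (by positivity)
    calc _ ≤ (2⁻¹ : ℝ) ^ (-(κ / 2)) * a ^ (-κ) * ((lam⁻¹ + (κ / 2 - lam)⁻¹) *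
          (b ^ (2 * (lam - κ / 2)) * a ^ (-(2 * (lam - κ / 2))))) := by gcongr
      _ = (2⁻¹ : ℝ) ^ (-(κ / 2)) * (lam⁻¹ + (κ / 2 - lam)⁻¹) *
          ((a ^ (-κ) * a ^ (-(2 * (lam - κ / 2)))) * b ^ (2 * (lam - κ / 2))) := by ring
      _ ≤ (2⁻¹ : ℝ) ^ (-(κ / 2)) * (lam⁻¹ + (κ / 2 - lam)⁻¹) *
          ((2 ^ (2 * lam) * (a + b) ^ (-(2 * lam))) * b ^ (2 * lam - κ)) := by
          rw [hexp, hbe]; gcongr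
      _ = _ := by ring

/-! ### Averaging over the mixed points -/

lemma mixSq_eq (z w : ℂ) {s : ℝ} (hs : s ∈ Icc (0 : ℝ) 1) :
    ‖1 - mixPoint z w s‖ ^ 2 = mixSq ‖1 - z * conj w‖ ‖1 - z * w‖ s := by
  simpa [mixSq] using sq_norm_one_sub_mixPoint z w hs 1

lemma summable_gammaRatio_mul_norm_coeff {γ β : ℝ} (hγ : 0 < γ) (hβ : 0 < γ + β)
    (μ₁ μ₂ μ₃ : ℝ) {r : ℝ} (hr0 : 0 ≤ r) (hr : r < 1) :
    Summable fun n => gammaRatio γ β n *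
      ‖PowerSeries.coeff n (tripleSeries μ₁ μ₂ μ₃ (r : ℂ) (r : ℂ) (r : ℂ))‖ := by
  obtain ⟨m, hm⟩ := exists_nat_gt β
  obtain ⟨C, hC, hR⟩ := exists_gammaRatio_le hγ hβ hm
  obtain ⟨C', hC', hS⟩ := exists_norm_tsum_poch_mul_coeff_le m γ μ₁ μ₂ μ₃
  have hrn : ‖(r : ℂ)‖ < 1 := by rwa [Complex.norm_real, Real.norm_eq_abs, abs_of_nonneg hr0]
  have hs := (hS r r r hrn hrn hrn rfl).1.norm.mul_left C
  refine Summable.of_nonneg_of_le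
    (fun n => mul_nonneg (gammaRatio_pos hγ hβ n).le (norm_nonneg _)) (fun n => ?_) hs
  have hp : 0 < poch (n + γ) m := poch_pos (by positivity) m
  rw [norm_mul, Complex.norm_real, Real.norm_eq_abs, abs_of_pos hp, ← mul_assoc]
  exact mul_le_mul_of_nonneg_right (hR n) (norm_nonneg _)

/-- A bound for the sums of the weighted coefficients `mixCoeff`, uniform in the mixing parameter,
is averaged to a bound for the kernel. -/
lemma norm_tsum_phi_le_integral {lam : ℝ} (h : 0 ≤ lam) {γ β : ℝ} (hγ : 0 < γ) (hβ : 0 < γ + β)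
    {z w : ℂ} (hz : ‖z‖ < 1) (hw : ‖w‖ < 1) {B : ℝ → ℝ} (hB : ContinuousOn B (Icc 0 1))
    (hle : ∀ s ∈ Icc (0 : ℝ) 1, ‖∑' n, (gammaRatio γ β n : ℂ) * mixCoeff lam z w n s‖ ≤ B s) :
    ‖∑' n, (gammaRatio γ β n : ℂ) * (phi lam n z * conj (phi lam n w))‖ ≤
      ∫ s, B s ∂mixMeasure lam := by
  have hP := isProbabilityMeasure_mixMeasure h
  have hsumr := summable_gammaRatio_mul_norm_coeff hγ hβ 1 lam lam
    (norm_nonneg (z * w)) (norm_mul_lt_one hz hw)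
  have hae : ∀ᵐ s ∂mixMeasure lam, s ∈ Icc (0 : ℝ) 1 :=
    (ae_mem_mixMeasure h).mono fun q hq => Ioc_subset_Icc_self hq
  have hint : ∀ n, Integrable (fun s => (gammaRatio γ β n : ℂ) * mixCoeff lam z w n s)
      (mixMeasure lam) := fun n => integrable_mixMeasure h
    (continuous_const.mul (continuous_mixCoeff lam z w n)).continuousOn
  have hsum : Summable fun n =>
      ∫ s, ‖(gammaRatio γ β n : ℂ) * mixCoeff lam z w n s‖ ∂mixMeasure lam := by
    refine Summable.of_nonneg_of_le (fun n => integral_nonneg fun s => norm_nonneg _)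
      (fun n => ?_) hsumr
    refine (Real.le_norm_self _).trans (norm_integral_mixMeasure_le h (fun s hs => ?_))
    rw [norm_norm, norm_mul, Complex.norm_real, Real.norm_eq_abs,
      abs_of_pos (gammaRatio_pos hγ hβ n)]
    exact mul_le_mul_of_nonneg_left (norm_mixCoeff_le h z w n (Ioc_subset_Icc_self hs))
      (gammaRatio_pos hγ hβ n).le
  have key := (hasSum_integral_of_summable_integral_norm hint hsum).tsum_eq
  simp only [integral_const_mul, ← phi_mul_conj_phi h hz hw] at key
  rw [key]
  exact norm_integral_le_of_norm_le (integrable_mixMeasure h hB) (hae.mono hle)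

/-- The form in which the previous lemma is used: a pointwise bound by a power of the mixed
distance gives a bound by the corresponding moment. -/
lemma norm_tsum_phi_le_mixMoment {lam : ℝ} (h : 0 ≤ lam) {γ β : ℝ} (hγ : 0 < γ)
    (hβ : 0 < γ + β) {z w : ℂ} (hz : ‖z‖ < 1) (hw : ‖w‖ < 1) {K κ : ℝ}
    (hle : ∀ s ∈ Icc (0 : ℝ) 1, ‖∑' n, (gammaRatio γ β n : ℂ) * mixCoeff lam z w n s‖ ≤
      K * ‖1 - mixPoint z w s‖ ^ (-κ)) :
    ‖∑' n, (gammaRatio γ β n : ℂ) * (phi lam n z * conj (phi lam n w))‖ ≤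
      K * mixMoment lam κ ‖1 - z * conj w‖ ‖1 - z * w‖ := by
  have hzw := norm_mul_lt_one hz hw
  have ha : 0 < ‖1 - z * conj w‖ := norm_one_sub_pos (by rwa [norm_mul_conj])
  have hb : 0 < ‖1 - z * w‖ := norm_one_sub_pos hzw
  rw [mixMoment, ← integral_const_mul]
  refine norm_tsum_phi_le_integral h hγ hβ hz hw
    (continuousOn_const.mul (continuousOn_mixSq_rpow ha hb _)) fun s hs => ?_
  have hρ : 0 < ‖1 - mixPoint z w s‖ := norm_one_sub_pos (by rwa [norm_mixPoint z w hs])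
  rw [← mixSq_eq z w hs, sq_rpow_neg_half hρ]
  exact hle s hs

/-! ### Pointwise estimates of the kernels -/

/-- The series `∑ Γ(n + γ + β) / Γ(n + γ) * φ_n(z) conj φ_n(w)`, of which both kernels are
instances. -/
def kernelSum (lam γ β : ℝ) (z w : ℂ) : ℂ :=
  ∑' n, (gammaRatio γ β n : ℂ) * (phi lam n z * conj (phi lam n w))

lemma mixPoint_bounds (z w : ℂ) {s : ℝ} (hs : s ∈ Icc (0 : ℝ) 1) :
    min ‖1 - z * conj w‖ ‖1 - z * w‖ ≤ ‖1 - mixPoint z w s‖ ∧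
      ‖1 - mixPoint z w s‖ ≤ max ‖1 - z * conj w‖ ‖1 - z * w‖ := by
  set a := ‖1 - z * conj w‖ with ha
  set b := ‖1 - z * w‖ with hb
  have h := mixSq_eq z w hs
  rw [mixSq, ← ha, ← hb] at h
  have h1 : 0 ≤ 1 - s := by linarith [hs.2]
  have ha0 : 0 ≤ a := norm_nonneg _
  have hb0 : 0 ≤ b := norm_nonneg _
  have hm0 : 0 ≤ min a b := le_min ha0 hb0
  constructor
  · refine (sq_le_sq₀ hm0 (norm_nonneg _)).mp ?_
    have e1 : min a b ^ 2 ≤ a ^ 2 := pow_le_pow_left₀ hm0 (min_le_left _ _) 2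
    have e2 : min a b ^ 2 ≤ b ^ 2 := pow_le_pow_left₀ hm0 (min_le_right _ _) 2
    rw [h]
    nlinarith [mul_le_mul_of_nonneg_left e1 h1, mul_le_mul_of_nonneg_left e2 hs.1]
  · refine (sq_le_sq₀ (norm_nonneg _) (ha0.trans (le_max_left _ _))).mp ?_
    have e1 : a ^ 2 ≤ max a b ^ 2 := pow_le_pow_left₀ ha0 (le_max_left _ _) 2
    have e2 : b ^ 2 ≤ max a b ^ 2 := pow_le_pow_left₀ hb0 (le_max_right _ _) 2
    rw [h]
    nlinarith [mul_le_mul_of_nonneg_left e1 h1, mul_le_mul_of_nonneg_left e2 hs.1]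

/-- The bound by the radial integral, for the mixed coefficients. -/
lemma exists_norm_tsum_mixCoeff_le {lam : ℝ} (hlam : 0 ≤ lam) {γ β : ℝ} (hγ : 0 < γ)
    (hβ : 1 ≤ γ + β) {m : ℕ} (hm : β < m) : ∃ C : ℝ, 0 < C ∧
    ∀ z w : ℂ, ‖z‖ < 1 → ‖w‖ < 1 → ∀ s ∈ Icc (0 : ℝ) 1,
      0 < ‖1 - z * conj w‖ ∧ 0 < ‖1 - z * w‖ ∧ 0 < ‖1 - mixPoint z w s‖ ∧
      ‖∑' n, (gammaRatio γ β n : ℂ) * mixCoeff lam z w n s‖ ≤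
        C * radialIntegral lam β m ‖1 - z * conj w‖ ‖1 - mixPoint z w s‖ := by
  obtain ⟨C, hC, h⟩ := exists_norm_tsum_gammaRatio_le hlam hγ hβ hm
  refine ⟨C, hC, fun z w hz hw s hs => ?_⟩
  have hzw := norm_mul_lt_one hz hw
  have h1 : ‖z * conj w‖ < 1 := by rwa [norm_mul_conj]
  have h2 : ‖mixPoint z w s‖ < 1 := by rwa [norm_mixPoint z w hs]
  exact ⟨norm_one_sub_pos h1, norm_one_sub_pos hzw, norm_one_sub_pos h2, h _ _ h1 h2⟩

lemma norm_one_sub_mul_pos {z w : ℂ} (hz : ‖z‖ < 1) (hw : ‖w‖ < 1) :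
    0 < ‖1 - z * conj w‖ ∧ 0 < ‖1 - z * w‖ :=
  ⟨norm_one_sub_pos (by rw [norm_mul_conj]; exact norm_mul_lt_one hz hw),
    norm_one_sub_pos (norm_mul_lt_one hz hw)⟩

/-- For `a ≤ b` the radial integral is governed by `a` and the critical moment occurs; for `b ≤ a` the
mixed distance enters with an exponent above the critical one. -/
theorem exists_norm_kernelSum_le_of_pos {lam : ℝ} (hlam : 0 ≤ lam) {γ β : ℝ} (hγ : 0 < γ)
    (hβ : 0 < β) (hγβ : 1 ≤ γ + β) : ∃ C : ℝ, 0 < C ∧ ∀ z w : ℂ, ‖z‖ < 1 → ‖w‖ < 1 →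
      ‖kernelSum lam γ β z w‖ ≤
        C * ((‖1 - z * conj w‖ + ‖1 - z * w‖) ^ (-(2 * lam)) * ‖1 - z * conj w‖⁻¹ *
          (‖1 - z * conj w‖ ^ (-β) + ‖1 - z * w‖ ^ (-β))) := by
  obtain ⟨m, hm⟩ := exists_nat_gt β
  obtain ⟨C₁, hC₁, h₁⟩ := exists_norm_tsum_mixCoeff_le hlam hγ hγβ hm
  obtain ⟨C₂, hC₂, h₂⟩ := radialIntegral_le_of_pos hlam hβ hm
  obtain ⟨C₃, hC₃, h₃⟩ := exists_mixMoment_crit_le_of_le hlam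
  obtain ⟨C₄, hC₄, h₄⟩ := exists_mixMoment_le_of_gt hlam (κ := 2 * lam + β) (by linarith)
  refine ⟨C₁ * C₂ * (C₃ + C₄), by positivity, fun z w hz hw => ?_⟩
  obtain ⟨ha, hb⟩ := norm_one_sub_mul_pos hz hw
  have hr := fun s hs => h₁ z w hz hw s hs
  have hmb := fun s hs => mixPoint_bounds z w (s := s) hs
  have hav := fun K κ h => norm_tsum_phi_le_mixMoment hlam hγ (by linarith : 0 < γ + β) hz hw
    (K := K) (κ := κ) h
  rw [kernelSum]
  set a := ‖1 - z * conj w‖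
  set b := ‖1 - z * w‖
  rcases le_total a b with hab | hab
  · refine (hav (C₁ * C₂ * (a⁻¹ * a ^ (-β))) (2 * lam) fun s hs => ?_).trans ?_
    · obtain ⟨-, -, hρ, hle⟩ := hr s hs
      obtain ⟨hl, hu⟩ := hmb s hs
      rw [min_eq_left hab] at hl
      have := h₂ a _ ha hρ
      rw [min_eq_left hl] at this
      refine (hle.trans (mul_le_mul_of_nonneg_left this hC₁.le)).trans (le_of_eq (by ring))
    · have := h₃ a b ha hb hab
      calc _ ≤ C₁ * C₂ * (a⁻¹ * a ^ (-β)) * (C₃ * (a + b) ^ (-(2 * lam))) := by gcongr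
        _ = C₁ * C₂ * C₃ * ((a + b) ^ (-(2 * lam)) * a⁻¹ * a ^ (-β)) := by ring
        _ ≤ _ := by gcongr <;> simp <;> positivity
  · refine (hav (C₁ * C₂ * a⁻¹) (2 * lam + β) fun s hs => ?_).trans ?_
    · obtain ⟨-, -, hρ, hle⟩ := hr s hs
      obtain ⟨hl, hu⟩ := hmb s hs
      rw [max_eq_left hab] at hu
      have := h₂ a _ ha hρ
      rw [min_eq_right hu, mul_assoc a⁻¹, ← Real.rpow_add hρ, ← neg_add] at this
      refine (hle.trans (mul_le_mul_of_nonneg_left this hC₁.le)).trans (le_of_eq (by ring))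
    · have := h₄ a b ha hb hab
      rw [show 2 * lam - (2 * lam + β) = -β by ring] at this
      calc _ ≤ C₁ * C₂ * a⁻¹ * (C₄ * ((a + b) ^ (-(2 * lam)) * b ^ (-β))) := by gcongr
        _ = C₁ * C₂ * C₄ * ((a + b) ^ (-(2 * lam)) * a⁻¹ * b ^ (-β)) := by ring
        _ ≤ _ := by gcongr <;> simp <;> positivity

/-- For `β = 0` the weights are `1`, so the weighted sum of the mixed coefficients is the value of the
generating function, and the critical moment decides. -/
theorem exists_norm_kernelSum_le_of_zero {lam : ℝ} (hlam : 0 ≤ lam) {γ : ℝ} (hγ : 0 < γ) :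
    ∃ C : ℝ, 0 < C ∧ ∀ z w : ℂ, ‖z‖ < 1 → ‖w‖ < 1 →
      ‖kernelSum lam γ 0 z w‖ ≤
        C * ((‖1 - z * conj w‖ + ‖1 - z * w‖) ^ (-(2 * lam)) / ‖1 - z * conj w‖ *
          Real.log (‖1 - z * conj w‖ / ‖1 - z * w‖ + 2)) := by
  have hl2 : 0 < Real.log 2 := Real.log_pos (by norm_num)
  obtain ⟨C₁, hC₁, h₁⟩ := exists_norm_tsum_poch_mul_coeff_le 0 γ 1 lam lam
  obtain ⟨C₃, hC₃, h₃⟩ := exists_mixMoment_crit_le_of_le hlam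
  obtain ⟨C₄, hC₄, h₄⟩ := exists_mixMoment_crit_le_of_ge hlam
  refine ⟨C₁ * (C₃ / Real.log 2 + C₄), by positivity, fun z w hz hw => ?_⟩
  obtain ⟨ha, hb⟩ := norm_one_sub_mul_pos hz hw
  have hzw := norm_mul_lt_one hz hw
  have hE : ∀ s ∈ Icc (0 : ℝ) 1, ‖∑' n, (gammaRatio γ 0 n : ℂ) * mixCoeff lam z w n s‖ ≤
      C₁ * ‖1 - z * conj w‖⁻¹ * ‖1 - mixPoint z w s‖ ^ (-(2 * lam)) := by
    intro s hs
    have e1 : ‖z * conj w‖ < 1 := by rwa [norm_mul_conj]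
    have e2 : ‖mixPoint z w s‖ < 1 := by rwa [norm_mixPoint z w hs]
    have e3 : ‖conj (mixPoint z w s)‖ < 1 := by rwa [RCLike.norm_conj]
    have := (h₁ _ _ _ e1 e2 e3 (by rw [← RCLike.norm_conj (1 - mixPoint z w s)]; simp)).2
    simp only [poch_zero, Complex.ofReal_one, one_mul, Nat.cast_zero, neg_zero, Real.rpow_zero,
      mul_one, ← two_mul, Real.rpow_neg_one] at this
    simp only [gammaRatio_zero hγ, Complex.ofReal_one, one_mul, mixCoeff]
    exact this.trans (le_of_eq (by ring))
  refine (norm_tsum_phi_le_mixMoment hlam hγ (by linarith) hz hw hE).trans ?_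
  set a := ‖1 - z * conj w‖
  set b := ‖1 - z * w‖
  have hlog : Real.log 2 ≤ Real.log (a / b + 2) := log_two_le_log_add_two (by positivity)
  have hl0 := hl2.trans_le hlog
  rw [mul_assoc, mul_assoc]
  refine mul_le_mul_of_nonneg_left ?_ hC₁.le
  rw [inv_mul_le_iff₀ ha]
  have : a * ((C₃ / Real.log 2 + C₄) * ((a + b) ^ (-(2 * lam)) / a * Real.log (a / b + 2))) =
      (C₃ / Real.log 2 + C₄) * ((a + b) ^ (-(2 * lam)) * Real.log (a / b + 2)) := by
    field_simp
  rw [this]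
  rcases le_total a b with hab | hab
  · refine (h₃ a b ha hb hab).trans ?_
    calc C₃ * (a + b) ^ (-(2 * lam))
        = C₃ / Real.log 2 * ((a + b) ^ (-(2 * lam)) * Real.log 2) := by field_simp
      _ ≤ _ := by gcongr; linarith
  · refine (h₄ a b ha hb hab).trans ?_
    have : 0 < C₃ / Real.log 2 := by positivity
    gcongr
    linarith

/-- The bound for `β < 0` in the region `‖1 - z w‖ ≤ ‖1 - z w̄‖`. The parameter `δ` moves a power of
the mixed distance to `‖1 - z w̄‖`, which makes the exponent of the former subcritical. -/
lemma exists_norm_kernelSum_le_of_ge {lam : ℝ} (hlam : 0 ≤ lam) {γ β : ℝ} (hγ : 0 < γ)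
    (hγβ : 1 ≤ γ + β) {δ : ℝ} (h0 : 0 ≤ δ) (h1 : δ ≤ 2 * lam) (hδ : 0 < δ ∨ lam = 0)
    (h2 : -1 - β < δ) (h3 : δ < -β) : ∃ C : ℝ, 0 < C ∧ ∀ z w : ℂ, ‖z‖ < 1 → ‖w‖ < 1 →
      ‖1 - z * w‖ ≤ ‖1 - z * conj w‖ →
      ‖kernelSum lam γ β z w‖ ≤ C * ((‖1 - z * conj w‖ + ‖1 - z * w‖) ^ (-(2 * lam)) *
        ‖1 - z * conj w‖ ^ (-(β + 1))) := by
  obtain ⟨C₁, hC₁, h₁⟩ := exists_norm_tsum_mixCoeff_le hlam hγ hγβ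
    (m := 0) (by push_cast; linarith)
  obtain ⟨C₂, hC₂, h₂⟩ := radialIntegral_zero_le h0 h1 h2 h3
  obtain ⟨C₃, hC₃, h₃⟩ := exists_mixMoment_le_of_lt hlam (κ := 2 * lam - δ) (by linarith)
    (by rcases hδ with h | h
        · left; linarith
        · right; linarith)
  refine ⟨C₁ * C₂ * C₃ * 2 ^ δ, by positivity, fun z w hz hw hab => ?_⟩
  obtain ⟨ha, hb⟩ := norm_one_sub_mul_pos hz hw
  have hr := fun s hs => h₁ z w hz hw s hs
  have hav := fun K κ h => norm_tsum_phi_le_mixMoment hlam hγ (by linarith : 0 < γ + β) hz hw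
    (K := K) (κ := κ) h
  rw [kernelSum]
  set a := ‖1 - z * conj w‖
  set b := ‖1 - z * w‖
  refine (hav (C₁ * C₂ * a ^ (-(β + 1 + δ))) (2 * lam - δ) fun s hs => ?_).trans ?_
  · obtain ⟨-, -, hρ, hle⟩ := hr s hs
    exact (hle.trans (mul_le_mul_of_nonneg_left (h₂ a _ ha hρ) hC₁.le)).trans
      (le_of_eq (by ring))
  · have hm := h₃ a b ha hb
    have e1 : (a + b) ^ (-(2 * lam - δ)) = (a + b) ^ (-(2 * lam)) * (a + b) ^ δ := by
      rw [← Real.rpow_add (by positivity)]; ring_nf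
    have e2 : (a + b) ^ δ ≤ 2 ^ δ * a ^ δ := by
      rw [← Real.mul_rpow (by norm_num) ha.le]
      exact Real.rpow_le_rpow (by positivity) (by linarith) h0
    have e3 : a ^ (-(β + 1 + δ)) * a ^ δ = a ^ (-(β + 1)) := by
      rw [← Real.rpow_add ha]; ring_nf
    calc _ ≤ C₁ * C₂ * a ^ (-(β + 1 + δ)) *
          (C₃ * ((a + b) ^ (-(2 * lam)) * (2 ^ δ * a ^ δ))) := by
          rw [e1] at hm
          refine mul_le_mul_of_nonneg_left (hm.trans ?_) (by positivity)
          gcongr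
      _ = C₁ * C₂ * C₃ * 2 ^ δ * ((a + b) ^ (-(2 * lam)) *
          (a ^ (-(β + 1 + δ)) * a ^ δ)) := by ring
      _ = _ := by rw [e3]

/-- For `a ≤ b` the critical moment is bounded without a logarithm; for `b ≤ a` the exponent of the
mixed distance is lowered first. -/
theorem exists_norm_kernelSum_le_of_neg {lam : ℝ} (hlam : 0 ≤ lam) {γ β : ℝ} (hγ : 0 < γ)
    (hγβ : 1 ≤ γ + β) (hβ1 : -1 < β) (hβ0 : β < 0) :
    ∃ C : ℝ, 0 < C ∧ ∀ z w : ℂ, ‖z‖ < 1 → ‖w‖ < 1 →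
      ‖kernelSum lam γ β z w‖ ≤ C * ((‖1 - z * conj w‖ + ‖1 - z * w‖) ^ (-(2 * lam)) *
        ‖1 - z * conj w‖ ^ (-(β + 1))) := by
  have hδ0 : 0 ≤ min (2 * lam) (-β / 2) := le_min (by linarith) (by linarith)
  have hδ1 : min (2 * lam) (-β / 2) ≤ -β / 2 := min_le_right _ _
  obtain ⟨C₅, hC₅, h₅⟩ := exists_norm_kernelSum_le_of_ge hlam hγ hγβ hδ0 (min_le_left _ _)
    (by rcases hlam.eq_or_lt with h | h
        · right; exact h.symm
        · left; exact lt_min (by linarith) (by linarith)) (by linarith) (by linarith)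
  obtain ⟨C₁, hC₁, h₁⟩ := exists_norm_tsum_mixCoeff_le hlam hγ hγβ
    (m := 0) (by push_cast; linarith)
  obtain ⟨C₂, hC₂, h₂⟩ := radialIntegral_zero_le (lam := lam) (β := β) le_rfl (by linarith)
    (by linarith) (by linarith)
  obtain ⟨C₃, hC₃, h₃⟩ := exists_mixMoment_crit_le_of_le hlam
  refine ⟨C₁ * C₂ * C₃ + C₅, by positivity, fun z w hz hw => ?_⟩
  obtain ⟨ha, hb⟩ := norm_one_sub_mul_pos hz hw
  have hr := fun s hs => h₁ z w hz hw s hs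
  have hav := fun K κ h => norm_tsum_phi_le_mixMoment hlam hγ (by linarith : 0 < γ + β) hz hw
    (K := K) (κ := κ) h
  have h₅' := h₅ z w hz hw
  rw [kernelSum] at h₅' ⊢
  set a := ‖1 - z * conj w‖
  set b := ‖1 - z * w‖
  rcases le_total a b with hab | hab
  · refine (hav (C₁ * C₂ * a ^ (-(β + 1))) (2 * lam) fun s hs => ?_).trans ?_
    · obtain ⟨-, -, hρ, hle⟩ := hr s hs
      have := h₂ a _ ha hρ
      rw [sub_zero, add_zero] at this
      exact (hle.trans (mul_le_mul_of_nonneg_left this hC₁.le)).trans (le_of_eq (by ring))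
    · have hm := h₃ a b ha hb hab
      calc _ ≤ C₁ * C₂ * a ^ (-(β + 1)) * (C₃ * (a + b) ^ (-(2 * lam))) := by gcongr
        _ = C₁ * C₂ * C₃ * ((a + b) ^ (-(2 * lam)) * a ^ (-(β + 1))) := by ring
        _ ≤ _ := by gcongr; linarith
  · refine (h₅' hab).trans ?_
    have : 0 < C₁ * C₂ * C₃ := by positivity
    gcongr
    linarith

/-- The logarithm comes from the radial integral of `(a + u)⁻¹`. -/
theorem exists_norm_kernelSum_le_of_neg_one {lam : ℝ} (hlam : 0 < lam) {γ : ℝ} (hγ : 0 < γ)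
    (hγβ : 1 ≤ γ + -1) : ∃ C : ℝ, 0 < C ∧ ∀ z w : ℂ, ‖z‖ < 1 → ‖w‖ < 1 →
      ‖kernelSum lam γ (-1) z w‖ ≤ C * ((‖1 - z * conj w‖ + ‖1 - z * w‖) ^ (-(2 * lam)) *
        Real.log (‖1 - z * w‖ / ‖1 - z * conj w‖ + 2)) := by
  have hl2 : 0 < Real.log 2 := Real.log_pos (by norm_num)
  have hδ0 : 0 < min (2 * lam) (1 / 2) := lt_min (by linarith) (by norm_num)
  have hδ1 : min (2 * lam) (1 / 2) ≤ 1 / 2 := min_le_right _ _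
  obtain ⟨C₅, hC₅, h₅⟩ := exists_norm_kernelSum_le_of_ge hlam.le hγ hγβ hδ0.le (min_le_left _ _)
    (Or.inl hδ0) (by linarith) (by linarith)
  obtain ⟨C₁, hC₁, h₁⟩ := exists_norm_tsum_mixCoeff_le hlam.le hγ hγβ
    (m := 0) (by push_cast; linarith)
  obtain ⟨C₂, hC₂, h₂⟩ := radialIntegral_neg_one_le hlam
  obtain ⟨C₃, hC₃, h₃⟩ := exists_mixMoment_crit_le_of_le hlam.le
  refine ⟨C₁ * C₂ * C₃ + C₅ / Real.log 2, by positivity, fun z w hz hw => ?_⟩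
  obtain ⟨ha, hb⟩ := norm_one_sub_mul_pos hz hw
  have hr := fun s hs => h₁ z w hz hw s hs
  have hmb := fun s hs => mixPoint_bounds z w (s := s) hs
  have hav := fun K κ h => norm_tsum_phi_le_mixMoment hlam.le hγ (by linarith : 0 < γ + -1) hz hw
    (K := K) (κ := κ) h
  have h₅' := h₅ z w hz hw
  rw [kernelSum] at h₅' ⊢
  set a := ‖1 - z * conj w‖
  set b := ‖1 - z * w‖
  have hlog : Real.log 2 ≤ Real.log (b / a + 2) := log_two_le_log_add_two (by positivity)
  have hl0 := hl2.trans_le hlog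
  rcases le_total a b with hab | hab
  · refine (hav (C₁ * C₂ * Real.log (b / a + 2)) (2 * lam) fun s hs => ?_).trans ?_
    · obtain ⟨-, -, hρ, hle⟩ := hr s hs
      obtain ⟨hl, hu⟩ := hmb s hs
      rw [max_eq_right hab] at hu
      have h5 := h₂ a _ ha hρ
      have h6 : Real.log (‖1 - mixPoint z w s‖ / a + 2) ≤ Real.log (b / a + 2) :=
        Real.log_le_log (by positivity) (by gcongr)
      calc _ ≤ _ := hle
        _ ≤ C₁ * (C₂ * (‖1 - mixPoint z w s‖ ^ (-(2 * lam)) * Real.log (b / a + 2))) := by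
          refine mul_le_mul_of_nonneg_left (h5.trans ?_) hC₁.le
          gcongr
        _ = _ := by ring
    · have hm := h₃ a b ha hb hab
      calc _ ≤ C₁ * C₂ * Real.log (b / a + 2) * (C₃ * (a + b) ^ (-(2 * lam))) := by gcongr
        _ = C₁ * C₂ * C₃ * ((a + b) ^ (-(2 * lam)) * Real.log (b / a + 2)) := by ring
        _ ≤ _ := by
          have : 0 < C₅ / Real.log 2 := by positivity
          gcongr
          linarith
  · refine (h₅' hab).trans ?_
    have h7 : 0 < C₁ * C₂ * C₃ := by positivity
    rw [show -((-1 : ℝ) + 1) = 0 by norm_num, Real.rpow_zero, mul_one]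
    calc C₅ * (a + b) ^ (-(2 * lam))
        = C₅ / Real.log 2 * ((a + b) ^ (-(2 * lam)) * Real.log 2) := by field_simp
      _ ≤ _ := by
        gcongr
        linarith

/-- For `β < -1` the factor `(1 - t z w̄)⁻¹` is not singular enough to matter, and the moments of the
mixed distance that occur are subcritical. -/
theorem exists_norm_kernelSum_le_of_lt_neg_one {lam : ℝ} (hlam : 0 ≤ lam) {γ β : ℝ} (hγ : 0 < γ)
    (hγβ : 1 ≤ γ + β) (h0 : -(2 * lam) - 1 < β) (h1 : β < -1) :
    ∃ C : ℝ, 0 < C ∧ ∀ z w : ℂ, ‖z‖ < 1 → ‖w‖ < 1 →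
      ‖kernelSum lam γ β z w‖ ≤
        C * (‖1 - z * conj w‖ + ‖1 - z * w‖) ^ (-β - 2 * lam - 1) := by
  obtain ⟨C₁, hC₁, h₁⟩ := exists_norm_tsum_mixCoeff_le hlam hγ hγβ
    (m := 0) (by push_cast; linarith)
  obtain ⟨C₃, hC₃, h₃⟩ := exists_mixMoment_le_of_lt hlam (κ := β + 2 * lam + 1) (by linarith)
    (Or.inl (by linarith))
  have hp : 0 < -β - 1 := by linarith
  have hq : 0 < 2 * lam - (-β - 1) := by linarith
  refine ⟨C₁ * ((-β - 1)⁻¹ + (2 * lam - (-β - 1))⁻¹) * C₃, by positivity, fun z w hz hw => ?_⟩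
  obtain ⟨ha, hb⟩ := norm_one_sub_mul_pos hz hw
  have hr := fun s hs => h₁ z w hz hw s hs
  refine (norm_tsum_phi_le_mixMoment hlam hγ (by linarith : 0 < γ + β) hz hw
    (K := C₁ * ((-β - 1)⁻¹ + (2 * lam - (-β - 1))⁻¹)) (κ := β + 2 * lam + 1)
    fun s hs => ?_).trans ?_
  · obtain ⟨-, -, hρ, hle⟩ := hr s hs
    have h2 := (radialIntegral_zero_le_setIntegral (lam := lam) h1 ha hρ).trans
      (setIntegral_rpow_mul_add_rpow_le_of_lt hp (by linarith) hρ)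
    rw [show -β - 1 - 2 * lam = -(β + 2 * lam + 1) by ring] at h2
    exact (hle.trans (mul_le_mul_of_nonneg_left h2 hC₁.le)).trans (le_of_eq (by ring))
  · rw [show -β - 2 * lam - 1 = -(β + 2 * lam + 1) by ring,
      mul_assoc (C₁ * ((-β - 1)⁻¹ + (2 * lam - (-β - 1))⁻¹))]
    exact mul_le_mul_of_nonneg_left (h₃ _ _ ha hb) (by positivity)

/-- The radial integral is a logarithm of the mixed distance `ρ`. Compared to the logarithm of `a + b`
it grows at most like `((a + b) / ρ) ^ lam`, a power with a subcritical exponent. -/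
theorem exists_norm_kernelSum_le_of_eq_neg_two_mul_sub_one {lam : ℝ} (hlam : 0 < lam)
    {γ : ℝ} (hγ : 0 < γ)
    (hγβ : 1 ≤ γ + (-(2 * lam) - 1)) : ∃ C : ℝ, 0 < C ∧ ∀ z w : ℂ, ‖z‖ < 1 → ‖w‖ < 1 →
      ‖kernelSum lam γ (-(2 * lam) - 1) z w‖ ≤
        C * Real.log (1 / (‖1 - z * conj w‖ + ‖1 - z * w‖) + 2) := by
  have hl2 : 0 < Real.log 2 := Real.log_pos (by norm_num)
  obtain ⟨C₁, hC₁, h₁⟩ := exists_norm_tsum_mixCoeff_le hlam.le hγ hγβ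
    (m := 0) (by push_cast; linarith)
  obtain ⟨C₃, hC₃, h₃⟩ := exists_mixMoment_le_of_lt hlam.le (κ := lam) hlam.le
    (Or.inl (by linarith))
  have hp : 0 < 2 * lam := by linarith
  set D : ℝ := 1 + 2 ^ lam / lam / Real.log 2 with hD
  refine ⟨C₁ * ((2 * lam)⁻¹ / Real.log 2 + 1) * D * C₃, by positivity, fun z w hz hw => ?_⟩
  obtain ⟨ha, hb⟩ := norm_one_sub_mul_pos hz hw
  have hr := fun s hs => h₁ z w hz hw s hs
  have hmb := fun s hs => mixPoint_bounds z w (s := s) hs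
  have hav := fun K κ h => norm_tsum_phi_le_mixMoment hlam.le hγ
    (by linarith : 0 < γ + (-(2 * lam) - 1)) hz hw (K := K) (κ := κ) h
  rw [kernelSum]
  set a := ‖1 - z * conj w‖
  set b := ‖1 - z * w‖
  have hS : 0 < a + b := by positivity
  set L := Real.log (1 / (a + b) + 2) with hL
  have hlog : Real.log 2 ≤ L := log_two_le_log_add_two (by positivity)
  have hl0 := hl2.trans_le hlog
  refine (hav (C₁ * ((2 * lam)⁻¹ / Real.log 2 + 1) * (D * (L * (a + b) ^ lam))) lam
    fun s hs => ?_).trans ?_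
  · obtain ⟨-, -, hρ, hle⟩ := hr s hs
    obtain ⟨hl, hu⟩ := hmb s hs
    set ρ := ‖1 - mixPoint z w s‖
    have hρS : ρ ≤ a + b := hu.trans (max_le (by linarith) (by linarith))
    have h2 := radialIntegral_zero_le_setIntegral (lam := lam) (β := -(2 * lam) - 1)
      (by linarith) ha hρ
    rw [show -(-(2 * lam) - 1) - 1 - 1 = 2 * lam - 1 by ring] at h2
    have h3 := h2.trans (setIntegral_rpow_mul_add_rpow_le_log hp hρ)
    -- `1 / ρ + 2 ≤ (1 / S + 2) * (2 S / ρ)` for `ρ ≤ S = a + b`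
    have hq1 : 1 ≤ ((a + b) / ρ) ^ lam :=
      Real.one_le_rpow (by rwa [one_le_div hρ]) hlam.le
    have h4 : Real.log (1 / ρ + 2) ≤ D * (L * ((a + b) / ρ) ^ lam) := by
      have e1 : 1 / ρ + 2 ≤ (1 / (a + b) + 2) * (2 * ((a + b) / ρ)) := by
        have : (1 / (a + b) + 2) * (2 * ((a + b) / ρ)) = 2 / ρ + 4 * ((a + b) / ρ) := by
          field_simp; ring
        rw [this]
        have h1 : 1 ≤ (a + b) / ρ := by rwa [one_le_div hρ]
        have h2 : 1 / ρ ≤ 2 / ρ := by gcongr; norm_num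
        linarith
      have e2 := Real.log_le_log (by positivity) e1
      rw [Real.log_mul (by positivity) (by positivity)] at e2
      have e3 := Real.log_le_rpow_div (by positivity : 0 ≤ 2 * ((a + b) / ρ)) hlam
      rw [Real.mul_rpow (by norm_num) (by positivity)] at e3
      have e4 : L ≤ L * ((a + b) / ρ) ^ lam := le_mul_of_one_le_right hl0.le hq1
      have e5 : 2 ^ lam * ((a + b) / ρ) ^ lam / lam ≤
          2 ^ lam / lam / Real.log 2 * (L * ((a + b) / ρ) ^ lam) := by
        calc 2 ^ lam * ((a + b) / ρ) ^ lam / lam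
            = 2 ^ lam / lam / Real.log 2 * (Real.log 2 * ((a + b) / ρ) ^ lam) := by field_simp
          _ ≤ _ := by gcongr
      rw [hD, add_mul, one_mul]
      linarith
    rw [Real.div_rpow hS.le hρ.le, div_eq_mul_inv ((a + b) ^ lam), ← Real.rpow_neg hρ.le] at h4
    calc _ ≤ _ := hle
      _ ≤ C₁ * (((2 * lam)⁻¹ / Real.log 2 + 1) *
          (D * (L * ((a + b) ^ lam * ρ ^ (-lam))))) := by
        refine mul_le_mul_of_nonneg_left (h3.trans ?_) hC₁.le
        gcongr
      _ = _ := by ring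
  · have hm := h₃ a b ha hb
    have e : (a + b) ^ lam * (a + b) ^ (-lam) = 1 := by rw [← Real.rpow_add hS]; simp
    have hD0 : 0 < D := by positivity
    calc _ ≤ C₁ * ((2 * lam)⁻¹ / Real.log 2 + 1) * (D * (L * (a + b) ^ lam)) *
          (C₃ * (a + b) ^ (-lam)) := by gcongr
      _ = C₁ * ((2 * lam)⁻¹ / Real.log 2 + 1) * D * C₃ * L *
          ((a + b) ^ lam * (a + b) ^ (-lam)) := by ring
      _ = _ := by rw [e, mul_one]

/-! ### Absolute convergence and the two kernels -/

lemma summable_gammaRatio_mul_binomCoeff {lam : ℝ} (hlam : 0 ≤ lam) {γ β : ℝ} (hγ : 0 < γ)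
    (hβ : 0 < γ + β) {r : ℝ} (hr0 : 0 ≤ r) (hr : r < 1) :
    Summable fun n => gammaRatio γ β n * (binomCoeff (2 * lam + 1) n * r ^ n) := by
  refine (summable_gammaRatio_mul_norm_coeff hγ hβ (2 * lam + 1) 0 0 hr0 hr).congr fun n => ?_
  rw [tripleSeries, binomSeries_zero, mul_one, mul_one, coeff_binomSeries, norm_mul, norm_pow,
    Complex.norm_real, Complex.norm_real, Real.norm_eq_abs, Real.norm_eq_abs, abs_of_nonneg hr0,
    abs_of_nonneg (binomCoeff_nonneg (by linarith) n)]

lemma norm_gammaRatio_mul_phi_le {lam : ℝ} (hlam : 0 ≤ lam) {γ β : ℝ} (hγ : 0 < γ)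
    (hβ : 0 < γ + β) (n : ℕ) (z w : ℂ) :
    ‖(gammaRatio γ β n : ℂ) * (phi lam n z * conj (phi lam n w))‖ ≤
      gammaRatio γ β n * (binomCoeff (2 * lam + 1) n * ‖z * w‖ ^ n) := by
  have h0 := (gammaRatio_pos hγ hβ n).le
  rw [norm_mul, norm_mul, RCLike.norm_conj, Complex.norm_real, Real.norm_eq_abs, abs_of_nonneg h0]
  exact mul_le_mul_of_nonneg_left (norm_phi_mul_norm_phi_le hlam n z w) h0

lemma summable_norm_kernelSum {lam : ℝ} (hlam : 0 ≤ lam) {γ β : ℝ} (hγ : 0 < γ)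
    (hβ : 0 < γ + β) {z w : ℂ} (h : ‖z * w‖ < 1) :
    Summable fun n => ‖(gammaRatio γ β n : ℂ) * (phi lam n z * conj (phi lam n w))‖ :=
  (summable_gammaRatio_mul_binomCoeff hlam hγ hβ (norm_nonneg _) h).of_nonneg_of_le
    (fun _ => norm_nonneg _) fun n => norm_gammaRatio_mul_phi_le hlam hγ hβ n z w

lemma variantTerm_eq (lam β : ℝ) (z w : ℂ) (n : ℕ) :
    variantTerm lam β z w n =
      (gammaRatio (2 * lam + 2) β n : ℂ) * (phi lam n z * conj (phi lam n w)) := by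
  rw [variantTerm, gammaRatio, mul_assoc, show (n : ℝ) + β + 2 * lam + 2 = n + (2 * lam + 2) + β by
    ring, show (n : ℝ) + 2 * lam + 2 = n + (2 * lam + 2) by ring]

lemma variantKernel_eq (lam β : ℝ) (z w : ℂ) :
    variantKernel lam β z w = kernelSum lam (2 * lam + 2) β z w :=
  tsum_congr fun n => variantTerm_eq lam β z w n

lemma conj_phi_conj (lam : ℝ) (n : ℕ) (w : ℂ) : conj (phi lam n (conj w)) = phi lam n w := by
  rw [conj_phi_eq, phi_eq, Complex.conj_conj]

/-- The Bergman kernel involves `φ_n(w) = conj φ_n(w̄)`, so it is a `kernelSum` at `w̄`; this exchanges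
the roles of `‖1 - z w̄‖` and `‖1 - z w‖`. -/
lemma bergmanTerm_eq (lam α : ℝ) (z w : ℂ) (n : ℕ) :
    bergmanTerm lam α z w n =
      ((Real.Gamma (lam + 1) / Real.Gamma (lam + α + 2) : ℝ) : ℂ) *
        ((gammaRatio (lam + 1) (α + 1) n : ℂ) * (phi lam n z * conj (phi lam n (conj w)))) := by
  rw [conj_phi_conj, bergmanTerm, gammaRatio, mul_assoc, ← mul_assoc (_ : ℂ) (_ : ℂ) (_ * _),
    ← Complex.ofReal_mul, div_mul_div_comm,
    show (n : ℝ) + lam + α + 2 = n + (lam + 1) + (α + 1) by ring,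
    show (n : ℝ) + lam + 1 = n + (lam + 1) by ring]

lemma bergmanKernel_eq (lam α : ℝ) (z w : ℂ) :
    bergmanKernel lam α z w = ((Real.Gamma (lam + 1) / Real.Gamma (lam + α + 2) : ℝ) : ℂ) *
      kernelSum lam (lam + 1) (α + 1) z (conj w) := by
  rw [bergmanKernel, kernelSum, ← tsum_mul_left]
  exact tsum_congr fun n => bergmanTerm_eq lam α z w n

theorem exists_norm_bergmanKernel_le {lam α : ℝ} (hlam : 0 ≤ lam) (hα : -1 < α) :
    ∃ C : ℝ, 0 < C ∧ ∀ z w : ℂ, ‖z‖ < 1 → ‖w‖ < 1 →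
      ‖bergmanKernel lam α z w‖ ≤
        C * (‖1 - z * w‖⁻¹ * (‖1 - z * conj w‖ + ‖1 - z * w‖) ^ (-(2 * lam)) *
          (‖1 - z * conj w‖ ^ (-(α + 1)) + ‖1 - z * w‖ ^ (-(α + 1)))) := by
  obtain ⟨C, hC, h⟩ := exists_norm_kernelSum_le_of_pos hlam (γ := lam + 1) (β := α + 1)
    (by linarith) (by linarith) (by linarith)
  have hG : 0 < Real.Gamma (lam + 1) / Real.Gamma (lam + α + 2) :=
    div_pos (Real.Gamma_pos_of_pos (by linarith)) (Real.Gamma_pos_of_pos (by linarith))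
  refine ⟨Real.Gamma (lam + 1) / Real.Gamma (lam + α + 2) * C, by positivity,
    fun z w hz hw => ?_⟩
  have := h z (conj w) hz (by rwa [RCLike.norm_conj])
  rw [Complex.conj_conj, add_comm ‖1 - z * w‖, add_comm (‖1 - z * w‖ ^ _)] at this
  rw [bergmanKernel_eq, norm_mul, Complex.norm_real, Real.norm_eq_abs, abs_of_pos hG, mul_assoc]
  refine mul_le_mul_of_nonneg_left (this.trans (le_of_eq (by ring))) hG.le

/-! ### The mean estimate over circles -/

lemma norm_one_sub_mul_exp_lower {r : ℝ} (hr0 : 0 ≤ r) (hr : r < 1) {ψ : ℝ}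
    (hψ : |ψ| ≤ Real.pi) :
    (1 - r) + |ψ| ≤ (1 + Real.pi) * ‖1 - (r : ℂ) * Complex.exp ((ψ : ℂ) * Complex.I)‖ := by
  set e := Complex.exp ((ψ : ℂ) * Complex.I) with he
  have hen : ‖e‖ = 1 := Complex.norm_exp_ofReal_mul_I ψ
  have h1 : 1 - r ≤ ‖1 - (r : ℂ) * e‖ := by
    have := norm_sub_norm_le (1 : ℂ) ((r : ℂ) * e)
    rwa [norm_mul, hen, mul_one, Complex.norm_real, Real.norm_eq_abs, abs_of_nonneg hr0,
      norm_one] at this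
  have h2 : ‖e - 1‖ ≤ 2 * ‖1 - (r : ℂ) * e‖ := by
    have e1 : e - 1 = -(1 - (r : ℂ) * e) + ((1 - r : ℝ) : ℂ) * e := by push_cast; ring
    have e2 := norm_add_le (-(1 - (r : ℂ) * e)) (((1 - r : ℝ) : ℂ) * e)
    rw [← e1, norm_neg, norm_mul, hen, mul_one, Complex.norm_real, Real.norm_eq_abs,
      abs_of_nonneg (by linarith)] at e2
    linarith
  have h3 : 2 / Real.pi * |ψ| ≤ ‖e - 1‖ := by
    rw [he, mul_comm (ψ : ℂ), Complex.norm_exp_I_mul_ofReal_sub_one, Real.norm_eq_abs,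
      abs_mul, abs_two]
    have := Real.mul_abs_le_abs_sin (x := ψ / 2) (by
      rw [abs_div, abs_two]; linarith)
    rw [abs_div, abs_two] at this
    linarith
  have h4 : |ψ| ≤ Real.pi * ‖1 - (r : ℂ) * e‖ := by
    have : 2 / Real.pi * |ψ| ≤ 2 * ‖1 - (r : ℂ) * e‖ := h3.trans h2
    rw [div_mul_eq_mul_div, div_le_iff₀ Real.pi_pos] at this
    linarith
  linarith

lemma continuous_norm_one_sub_mul_exp_rpow {ζ : ℂ} (hζ : ‖ζ‖ < 1) (q : ℝ) :
    Continuous fun φ : ℝ => ‖1 - ζ * Complex.exp ((φ : ℂ) * Complex.I)‖ ^ q := by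
  refine Continuous.rpow_const (by fun_prop) fun φ => Or.inl (ne_of_gt ?_)
  exact norm_one_sub_pos (by rwa [norm_mul, Complex.norm_exp_ofReal_mul_I, mul_one])

lemma intervalIntegral_add_abs_rpow_le {q ε : ℝ} (hq : 1 < q) (hε : 0 < ε) {c : ℝ} (hc : 0 ≤ c) :
    ∫ ψ in (-c)..c, (ε + |ψ|) ^ (-q) ≤ 2 * ((q - 1)⁻¹ * ε ^ (1 - q)) := by
  have hcont : Continuous fun ψ : ℝ => (ε + |ψ|) ^ (-q) :=
    Continuous.rpow_const (by fun_prop) fun ψ => Or.inl (by positivity)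
  have h0 : ∫ ψ in (0 : ℝ)..c, (ε + |ψ|) ^ (-q) ≤ (q - 1)⁻¹ * ε ^ (1 - q) := by
    have e1 : ∫ ψ in (0 : ℝ)..c, (ε + |ψ|) ^ (-q) = ∫ ψ in (0 : ℝ)..c, (ψ + ε) ^ (-q) := by
      refine intervalIntegral.integral_congr fun ψ hψ => ?_
      rw [uIcc_of_le hc] at hψ
      simp only [abs_of_nonneg hψ.1, add_comm ε]
    rw [e1, intervalIntegral.integral_comp_add_right fun x : ℝ => x ^ (-q), zero_add,
      integral_rpow (Or.inr ⟨by linarith, by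
        rw [uIcc_of_le (by linarith)]; exact fun h => by linarith [h.1]⟩),
      show -q + 1 = 1 - q by ring, ← neg_div_neg_eq, neg_sub, neg_sub, inv_mul_eq_div]
    have : 0 ≤ (c + ε) ^ (1 - q) := by positivity
    have hq' : 0 ≤ q - 1 := by linarith
    gcongr
    linarith
  have h1 : ∫ ψ in (-c)..0, (ε + |ψ|) ^ (-q) = ∫ ψ in (0 : ℝ)..c, (ε + |ψ|) ^ (-q) := by
    have := intervalIntegral.integral_comp_neg (a := 0) (b := c) fun ψ : ℝ => (ε + |ψ|) ^ (-q)
    simp only [abs_neg, neg_zero] at this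
    exact this.symm
  rw [← intervalIntegral.integral_add_adjacent_intervals (hcont.intervalIntegrable (-c) 0)
    (hcont.intervalIntegrable 0 c), h1]
  linarith

/-- The classical growth of the circular means of `|1 - ζ e^{iφ}|^(-q)`, `q > 1`. -/
lemma exists_setIntegral_norm_one_sub_rpow_le {q : ℝ} (hq : 1 < q) : ∃ C : ℝ, 0 < C ∧
    ∀ ζ : ℂ, ‖ζ‖ < 1 →
      ∫ φ in Ioc (-Real.pi) Real.pi, ‖1 - ζ * Complex.exp ((φ : ℂ) * Complex.I)‖ ^ (-q) ≤
        C * (1 - ‖ζ‖) ^ (1 - q) := by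
  have hπ := Real.pi_pos
  refine ⟨(1 + Real.pi) ^ q * (2 * (q - 1)⁻¹), by
    have : 0 < q - 1 := by linarith
    positivity, fun ζ hζ => ?_⟩
  rw [← intervalIntegral.integral_of_le (by linarith)]
  set r := ‖ζ‖ with hr
  have hr0 : 0 ≤ r := norm_nonneg _
  set h : ℝ → ℝ := fun ψ => ‖1 - (r : ℂ) * Complex.exp ((ψ : ℂ) * Complex.I)‖ ^ (-q) with hh
  have hcont : Continuous h := continuous_norm_one_sub_mul_exp_rpow (by
    rwa [Complex.norm_real, Real.norm_eq_abs, abs_of_nonneg hr0]) (-q)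
  have hper : Function.Periodic h (2 * Real.pi) := fun ψ => by
    simp only [hh]
    push_cast
    rw [add_mul, Complex.exp_periodic]
  -- rotating the circle by the argument of `ζ` reduces to a nonnegative `ζ`
  have hrot : ∫ φ in (-Real.pi)..Real.pi, ‖1 - ζ * Complex.exp ((φ : ℂ) * Complex.I)‖ ^ (-q) =
      ∫ ψ in (-Real.pi)..Real.pi, h ψ := by
    have e1 : ∀ φ : ℝ, ‖1 - ζ * Complex.exp ((φ : ℂ) * Complex.I)‖ ^ (-q) =
        h (φ + Complex.arg ζ) := fun φ => by
      simp only [hh]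
      nth_rewrite 1 [← Complex.norm_mul_exp_arg_mul_I ζ]
      push_cast
      rw [add_mul, Complex.exp_add]
      congr 3; ring
    simp_rw [e1]
    rw [intervalIntegral.integral_comp_add_right,
      show Real.pi + Complex.arg ζ = (-Real.pi + Complex.arg ζ) + 2 * Real.pi by ring,
      hper.intervalIntegral_add_eq _ (-Real.pi)]
    congr 1; ring
  rw [hrot]
  have hε : 0 < 1 - r := by linarith
  have hmono : ∫ ψ in (-Real.pi)..Real.pi, h ψ ≤
      ∫ ψ in (-Real.pi)..Real.pi, (1 + Real.pi) ^ q * ((1 - r) + |ψ|) ^ (-q) := by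
    refine intervalIntegral.integral_mono_on (by linarith) (hcont.intervalIntegrable _ _)
      (Continuous.intervalIntegrable ?_ _ _) fun ψ hψ => ?_
    · exact continuous_const.mul
        (Continuous.rpow_const (by fun_prop) fun ψ => Or.inl (by positivity))
    · have hl := norm_one_sub_mul_exp_lower hr0 hζ (abs_le.mpr ⟨hψ.1, hψ.2⟩)
      have hpos : 0 < (1 - r) + |ψ| := by positivity
      have hn : 0 < ‖1 - (r : ℂ) * Complex.exp ((ψ : ℂ) * Complex.I)‖ :=
        pos_of_mul_pos_right (hpos.trans_le hl) (by positivity)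
      have := Real.rpow_le_rpow_of_nonpos hpos hl (by linarith : -q ≤ 0)
      rw [Real.mul_rpow (by positivity) hn.le, Real.rpow_neg (by positivity : 0 ≤ 1 + Real.pi),
        inv_mul_le_iff₀ (by positivity)] at this
      exact this
  refine hmono.trans ?_
  rw [intervalIntegral.integral_const_mul]
  calc _ ≤ (1 + Real.pi) ^ q * (2 * ((q - 1)⁻¹ * (1 - r) ^ (1 - q))) := by
        gcongr; exact intervalIntegral_add_abs_rpow_le hq hε hπ.le
    _ = _ := by ring

lemma diskConst_nonneg {lam : ℝ} (hlam : 0 ≤ lam) : 0 ≤ diskConst lam / (2 * lam + 2) := by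
  have h1 := Real.Gamma_pos_of_pos (by linarith : 0 < lam + 2)
  have h2 := Real.Gamma_pos_of_pos (by linarith : 0 < lam + 1 / 2)
  have h3 := Real.Gamma_pos_of_pos (by norm_num : (0 : ℝ) < 1 / 2)
  rw [diskConst]
  positivity

lemma measurable_circleDensity (lam : ℝ) : Measurable fun φ : ℝ =>
    ENNReal.ofReal (diskConst lam / (2 * lam + 2) * |Real.sin φ| ^ (2 * lam)) := by
  fun_prop

lemma integrable_circleMeasure {lam : ℝ} (hlam : 0 ≤ lam) {F : ℝ → ℝ} (hF : Continuous F) :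
    Integrable F (circleMeasure lam) := by
  rw [circleMeasure, integrable_withDensity_iff_integrable_smul' (measurable_circleDensity lam)
    (Filter.Eventually.of_forall fun _ => ENNReal.ofReal_lt_top)]
  have hk := diskConst_nonneg hlam
  simp only [fun φ => ENNReal.toReal_ofReal (by positivity :
    0 ≤ diskConst lam / (2 * lam + 2) * |Real.sin φ| ^ (2 * lam)), smul_eq_mul]
  refine Continuous.integrableOn_Ioc (Continuous.mul (continuous_const.mul ?_) hF)
  exact Continuous.rpow_const (by fun_prop) fun _ => Or.inr (by linarith)

lemma integral_circleMeasure {lam : ℝ} (hlam : 0 ≤ lam) (F : ℝ → ℝ) :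
    ∫ φ, F φ ∂circleMeasure lam = diskConst lam / (2 * lam + 2) *
      ∫ φ in Ioc (-Real.pi) Real.pi, |Real.sin φ| ^ (2 * lam) * F φ := by
  have hk := diskConst_nonneg hlam
  rw [circleMeasure, integral_withDensity_eq_integral_toReal_smul₀
    (measurable_circleDensity lam).aemeasurable
    (Filter.Eventually.of_forall fun _ => ENNReal.ofReal_lt_top), ← integral_const_mul]
  refine integral_congr_ae (Filter.Eventually.of_forall fun φ => ?_)
  simp only [ENNReal.toReal_ofReal (by positivity :
    0 ≤ diskConst lam / (2 * lam + 2) * |Real.sin φ| ^ (2 * lam)), smul_eq_mul]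
  ring

lemma continuous_phi (lam : ℝ) (n : ℕ) : Continuous (phi lam n) := by
  simp only [funext (phi_eq lam n)]
  exact continuous_const.mul (continuous_biPoly lam n continuous_id Complex.continuous_conj)

lemma continuous_bergmanKernel_circle {lam α : ℝ} (hlam : 0 ≤ lam) (hα : -1 < α) {z : ℂ} {s : ℝ}
    (hz : ‖z‖ < 1) (hs0 : 0 ≤ s) (hs : s < 1) : Continuous fun φ : ℝ =>
      bergmanKernel lam α z ((s : ℂ) * Complex.exp ((φ : ℂ) * Complex.I)) := by
  simp only [bergmanKernel_eq, kernelSum]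
  refine continuous_const.mul (continuous_tsum (fun n => ?_)
    (summable_gammaRatio_mul_binomCoeff hlam (γ := lam + 1) (β := α + 1) (by linarith)
      (by linarith) (r := ‖z‖ * s) (by positivity) ?_) fun n φ => ?_)
  · simp only [conj_phi_conj]
    exact continuous_const.mul (continuous_const.mul
      ((continuous_phi lam n).comp (by fun_prop)))
  · nlinarith [norm_nonneg z]
  · refine (norm_gammaRatio_mul_phi_le hlam (by linarith) (by linarith) n _ _).trans (le_of_eq ?_)
    rw [norm_mul_conj, norm_mul, norm_mul, Complex.norm_exp_ofReal_mul_I, Complex.norm_real,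
      Real.norm_eq_abs, abs_of_nonneg hs0, mul_one]

/-- The `p`-th power of the pointwise bound, in a form in which the two singularities are
separated. -/
lemma inv_rpow_mul_add_rpow_le {p σ a b : ℝ} (hp : 0 < p) (hp1 : p ≤ 1) (hσ : 0 ≤ σ) (ha : 0 < a)
    (hb : 0 < b) : (b⁻¹ * (a ^ (-σ) + b ^ (-σ))) ^ p ≤
      2 * (a ^ (-((σ + 1) * p)) + b ^ (-((σ + 1) * p))) := by
  have key : ∀ x : ℝ, 0 < x → x⁻¹ * x ^ (-σ) = x ^ (-(σ + 1)) := fun x hx => by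
    rw [← Real.rpow_neg_one, ← Real.rpow_add hx]; ring_nf
  have ha' := key a ha
  have hb' := key b hb
  have h1 : b⁻¹ * (a ^ (-σ) + b ^ (-σ)) ≤ 2 * (a ^ (-(σ + 1)) + b ^ (-(σ + 1))) := by
    have pa : 0 < a ^ (-(σ + 1)) := by positivity
    have pb : 0 < b ^ (-(σ + 1)) := by positivity
    rw [mul_add, hb']
    rcases le_total a b with hab | hab
    · have : b⁻¹ * a ^ (-σ) ≤ a⁻¹ * a ^ (-σ) := by gcongr
      linarith
    · have : b⁻¹ * a ^ (-σ) ≤ b⁻¹ * b ^ (-σ) :=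
        mul_le_mul_of_nonneg_left (Real.rpow_le_rpow_of_nonpos hb hab (by linarith)) (by positivity)
      linarith
  calc _ ≤ (2 * (a ^ (-(σ + 1)) + b ^ (-(σ + 1)))) ^ p := by gcongr
    _ = 2 ^ p * (a ^ (-(σ + 1)) + b ^ (-(σ + 1))) ^ p := Real.mul_rpow (by norm_num) (by positivity)
    _ ≤ 2 ^ (1 : ℝ) * ((a ^ (-(σ + 1))) ^ p + (b ^ (-(σ + 1))) ^ p) := by
        gcongr
        · norm_num
        · exact Real.rpow_add_le_add_rpow (by positivity) (by positivity) hp.le hp1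
    _ = _ := by
        rw [Real.rpow_one, ← Real.rpow_mul ha.le, ← Real.rpow_mul hb.le, neg_mul]

/-- With `w = s e^{iφ}`, either `z w` is at most `1 / 2` in modulus and both distances are at least
`1 / 2`, or the difference `z (w - w̄)` of the two points is at least `|sin φ|` in modulus. -/
lemma abs_sin_le_of_circle {z : ℂ} {s φ : ℝ} (hs0 : 0 ≤ s) :
    |Real.sin φ| ≤ ‖1 - z * conj ((s : ℂ) * Complex.exp ((φ : ℂ) * Complex.I))‖ +
      ‖1 - z * ((s : ℂ) * Complex.exp ((φ : ℂ) * Complex.I))‖ := by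
  set w := (s : ℂ) * Complex.exp ((φ : ℂ) * Complex.I) with hw
  have hwn : ‖w‖ = s := by
    rw [hw, norm_mul, Complex.norm_exp_ofReal_mul_I, Complex.norm_real, Real.norm_eq_abs,
      abs_of_nonneg hs0, mul_one]
  have hs1 := Real.abs_sin_le_one φ
  rcases le_total (‖z‖ * s) (1 / 2) with hr | hr
  · have h1 := norm_sub_norm_le 1 (z * conj w)
    have h2 := norm_sub_norm_le 1 (z * w)
    rw [norm_mul_conj, norm_mul, hwn, norm_one] at h1
    rw [norm_mul, hwn, norm_one] at h2
    linarith
  · have him : w - conj w = ((2 * (s * Real.sin φ) : ℝ) : ℂ) * Complex.I := by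
      rw [Complex.sub_conj]
      congr 3
      rw [hw, Complex.im_ofReal_mul, Complex.exp_ofReal_mul_I_im]
    have h1 := norm_sub_le (1 - z * conj w) (1 - z * w)
    rw [show 1 - z * conj w - (1 - z * w) = z * (w - conj w) by ring, him, norm_mul, norm_mul,
      Complex.norm_I, mul_one, Complex.norm_real, Real.norm_eq_abs, abs_mul, abs_mul, abs_two,
      abs_of_nonneg hs0] at h1
    nlinarith [abs_nonneg (Real.sin φ)]

/-- If `ζ e^{iφ}` is close to `1`, then `|sin φ|` is controlled by `|1 - ζ ^ 2|`. -/
lemma abs_sin_le_norm_one_sub_sq_add {ζ : ℂ} (hζ : ‖ζ‖ < 1) (φ : ℝ) :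
    |Real.sin φ| ≤ ‖1 - ζ ^ 2‖ + ‖1 - ζ * Complex.exp ((φ : ℂ) * Complex.I)‖ := by
  set e := Complex.exp ((φ : ℂ) * Complex.I) with he
  have hen : ‖e‖ = 1 := Complex.norm_exp_ofReal_mul_I φ
  have he2 : e * conj e = 1 := by
    rw [Complex.mul_conj, Complex.normSq_eq_norm_sq, hen]; norm_num
  have h1 : conj e - e = ((-(2 * Real.sin φ) : ℝ) : ℂ) * Complex.I := by
    rw [← neg_sub, Complex.sub_conj, he, Complex.exp_ofReal_mul_I_im]; push_cast; ring
  have h2 : conj e - e = (conj e + ζ) * (1 - ζ * e) - e * (1 - ζ ^ 2) := by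
    linear_combination ζ * he2
  have h3 : ‖(conj e + ζ) * (1 - ζ * e)‖ ≤ 2 * ‖1 - ζ * e‖ := by
    rw [norm_mul]
    refine mul_le_mul_of_nonneg_right ((norm_add_le _ _).trans ?_) (norm_nonneg _)
    rw [RCLike.norm_conj, hen]; linarith
  have h4 := norm_sub_le ((conj e + ζ) * (1 - ζ * e)) (e * (1 - ζ ^ 2))
  rw [← h2, h1, norm_mul, Complex.norm_I, mul_one, Complex.norm_real, Real.norm_eq_abs, abs_neg,
    abs_mul, abs_two, norm_mul e, hen, one_mul] at h4
  linarith [norm_nonneg (1 - ζ ^ 2)]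

/-- The singularity of the kernel is integrated with the gain from the factor `|sin φ| ^ κ`. -/
lemma exists_setIntegral_abs_sin_mul_le {q κ : ℝ} (hκ : 0 ≤ κ) (hq : 1 < q - κ) :
    ∃ C : ℝ, 0 < C ∧ ∀ ζ : ℂ, ‖ζ‖ < 1 →
      ∫ φ in Ioc (-Real.pi) Real.pi, |Real.sin φ| ^ κ *
          ‖1 - ζ * Complex.exp ((φ : ℂ) * Complex.I)‖ ^ (-q) ≤
        C * (‖1 - ζ ^ 2‖ ^ κ * (1 - ‖ζ‖) ^ (1 - q)) := by
  obtain ⟨C₁, hC₁, h₁⟩ := exists_setIntegral_norm_one_sub_rpow_le (q := q) (by linarith)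
  obtain ⟨C₂, hC₂, h₂⟩ := exists_setIntegral_norm_one_sub_rpow_le hq
  refine ⟨2 ^ κ * (C₁ + C₂), by positivity, fun ζ hζ => ?_⟩
  set D := ‖1 - ζ ^ 2‖ with hD
  have hD0 : 0 ≤ D := norm_nonneg _
  have hr : 0 < 1 - ‖ζ‖ := by linarith
  have hrD : 1 - ‖ζ‖ ≤ D := by
    have := norm_sub_norm_le 1 (ζ ^ 2)
    rw [norm_one, norm_pow] at this
    nlinarith [norm_nonneg ζ]
  have hpt : ∀ φ : ℝ, |Real.sin φ| ^ κ * ‖1 - ζ * Complex.exp ((φ : ℂ) * Complex.I)‖ ^ (-q) ≤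
      2 ^ κ * (D ^ κ * ‖1 - ζ * Complex.exp ((φ : ℂ) * Complex.I)‖ ^ (-q) +
        ‖1 - ζ * Complex.exp ((φ : ℂ) * Complex.I)‖ ^ (-(q - κ))) := fun φ => by
    have hs := abs_sin_le_norm_one_sub_sq_add hζ φ
    have hx : 0 < ‖1 - ζ * Complex.exp ((φ : ℂ) * Complex.I)‖ :=
      norm_one_sub_pos (by rwa [norm_mul, Complex.norm_exp_ofReal_mul_I, mul_one])
    set x := ‖1 - ζ * Complex.exp ((φ : ℂ) * Complex.I)‖
    have h1 : |Real.sin φ| ^ κ ≤ 2 ^ κ * (D ^ κ + x ^ κ) := by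
      rcases le_total D x with h | h
      · calc |Real.sin φ| ^ κ ≤ (2 * x) ^ κ := by gcongr; linarith
          _ = 2 ^ κ * x ^ κ := Real.mul_rpow (by norm_num) hx.le
          _ ≤ _ := by gcongr; simp; positivity
      · calc |Real.sin φ| ^ κ ≤ (2 * D) ^ κ := by gcongr; linarith
          _ = 2 ^ κ * D ^ κ := Real.mul_rpow (by norm_num) hD0
          _ ≤ _ := by gcongr; simp; positivity
    rw [show -(q - κ) = κ + -q by ring, Real.rpow_add hx, ← add_mul, ← mul_assoc]
    gcongr
  have hi := fun q' => (continuous_norm_one_sub_mul_exp_rpow hζ q').integrableOn_Ioc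
    (a := -Real.pi) (b := Real.pi) (μ := volume)
  have hsin : Continuous fun φ : ℝ => |Real.sin φ| ^ κ :=
    Continuous.rpow_const (by fun_prop) fun _ => Or.inr hκ
  refine (setIntegral_mono (Continuous.integrableOn_Ioc
    (hsin.mul (continuous_norm_one_sub_mul_exp_rpow hζ (-q))))
    ((((hi (-q)).const_mul (D ^ κ)).add (hi (-(q - κ)))).const_mul (2 ^ κ)) hpt).trans ?_
  rw [integral_const_mul, integral_add' ((hi (-q)).const_mul (D ^ κ)) (hi (-(q - κ))),
    integral_const_mul, mul_assoc]
  refine mul_le_mul_of_nonneg_left ?_ (by positivity)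
  have e1 : (1 - ‖ζ‖) ^ (1 - (q - κ)) ≤ D ^ κ * (1 - ‖ζ‖) ^ (1 - q) := by
    rw [show 1 - (q - κ) = κ + (1 - q) by ring, Real.rpow_add hr]
    gcongr
  calc _ ≤ D ^ κ * (C₁ * (1 - ‖ζ‖) ^ (1 - q)) + C₂ * (D ^ κ * (1 - ‖ζ‖) ^ (1 - q)) := by
        gcongr
        · exact h₁ ζ hζ
        · exact (h₂ ζ hζ).trans (by gcongr)
    _ = _ := by ring

theorem exists_integral_norm_bergmanKernel_rpow_le {lam p α : ℝ} (hlam : 0 ≤ lam) (hp : 0 < p)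
    (hp1 : p ≤ 1) (hα : (2 * lam + 1) * (1 / p - 1) - 1 < α) :
    ∃ C : ℝ, 0 < C ∧ ∀ (z : ℂ) (s : ℝ), ‖z‖ < 1 → 0 ≤ s → s < 1 →
      Integrable (fun φ : ℝ => ‖bergmanKernel lam α z
        ((s : ℂ) * Complex.exp ((φ : ℂ) * Complex.I))‖ ^ p) (circleMeasure lam) ∧
      ∫ φ : ℝ, ‖bergmanKernel lam α z ((s : ℂ) * Complex.exp ((φ : ℂ) * Complex.I))‖ ^ p
          ∂circleMeasure lam ≤
        C * (‖1 - (s : ℂ) ^ 2 * z ^ 2‖ ^ (2 * lam * (1 - p)) /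
          (1 - s * ‖z‖) ^ ((2 + α) * p - 1)) := by
  have hpinv : 1 ≤ 1 / p := by rw [le_div_iff₀ hp]; linarith
  have hα1 : -1 < α := by nlinarith
  have hq : 1 < (α + 1 + 1) * p - 2 * lam * (1 - p) := by
    have h := mul_lt_mul_of_pos_right hα hp
    have e : ((2 * lam + 1) * (1 / p - 1) - 1) * p = (2 * lam + 1) * (1 - p) - p := by field_simp
    rw [e] at h
    nlinarith
  have hκ : 0 ≤ 2 * lam * (1 - p) := mul_nonneg (by linarith) (by linarith)
  obtain ⟨C₁, hC₁, h₁⟩ := exists_norm_bergmanKernel_le hlam hα1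
  obtain ⟨C₂, hC₂, h₂⟩ := exists_setIntegral_abs_sin_mul_le hκ hq
  set κ := 2 * lam * (1 - p) with hκd
  set q := (α + 1 + 1) * p with hqd
  have hk := diskConst_nonneg hlam
  set k := diskConst lam / (2 * lam + 2)
  -- `+ 1` makes the constant positive without the positivity of `k`
  refine ⟨k * (C₁ ^ p * 2 * (2 * C₂)) + 1, by positivity, fun z s hz hs0 hs => ?_⟩
  have hcont : Continuous fun φ : ℝ => ‖bergmanKernel lam α z
      ((s : ℂ) * Complex.exp ((φ : ℂ) * Complex.I))‖ ^ p :=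
    Continuous.rpow_const (continuous_bergmanKernel_circle hlam hα1 hz hs0 hs).norm
      fun _ => Or.inr hp.le
  refine ⟨integrable_circleMeasure hlam hcont, ?_⟩
  rw [integral_circleMeasure hlam]
  have hsz : ‖(s : ℂ) * z‖ = s * ‖z‖ := by
    rw [norm_mul, Complex.norm_real, Real.norm_eq_abs, abs_of_nonneg hs0]
  have hsz1 : ‖(s : ℂ) * z‖ < 1 := by rw [hsz]; nlinarith [norm_nonneg z]
  have hszc : ‖conj ((s : ℂ) * z)‖ < 1 := by rwa [RCLike.norm_conj]
  have hpt : ∀ φ : ℝ, |Real.sin φ| ^ (2 * lam) *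
      ‖bergmanKernel lam α z ((s : ℂ) * Complex.exp ((φ : ℂ) * Complex.I))‖ ^ p ≤
      C₁ ^ p * 2 * (|Real.sin φ| ^ κ *
          ‖1 - conj ((s : ℂ) * z) * Complex.exp ((φ : ℂ) * Complex.I)‖ ^ (-q) +
        |Real.sin φ| ^ κ * ‖1 - (s : ℂ) * z * Complex.exp ((φ : ℂ) * Complex.I)‖ ^ (-q)) := by
    intro φ
    have hab := abs_sin_le_of_circle (z := z) (φ := φ) hs0
    have hwn : ‖(s : ℂ) * Complex.exp ((φ : ℂ) * Complex.I)‖ < 1 := by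
      rwa [norm_mul, Complex.norm_exp_ofReal_mul_I, Complex.norm_real, Real.norm_eq_abs,
        abs_of_nonneg hs0, mul_one]
    have hK := h₁ z _ hz hwn
    obtain ⟨ha, hb⟩ := norm_one_sub_mul_pos hz hwn
    have eb : ‖1 - z * ((s : ℂ) * Complex.exp ((φ : ℂ) * Complex.I))‖ =
        ‖1 - (s : ℂ) * z * Complex.exp ((φ : ℂ) * Complex.I)‖ := by congr 1; ring
    have ea : ‖1 - z * conj ((s : ℂ) * Complex.exp ((φ : ℂ) * Complex.I))‖ =
        ‖1 - conj ((s : ℂ) * z) * Complex.exp ((φ : ℂ) * Complex.I)‖ := by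
      rw [← RCLike.norm_conj]; congr 1
      simp only [map_sub, map_mul, map_one, Complex.conj_conj, Complex.conj_ofReal]; ring
    rw [← ea, ← eb]
    set w := (s : ℂ) * Complex.exp ((φ : ℂ) * Complex.I)
    set a := ‖1 - z * conj w‖
    set b := ‖1 - z * w‖
    have hS : 0 < a + b := by positivity
    have e1 : ‖bergmanKernel lam α z w‖ ^ p ≤
        C₁ ^ p * (a + b) ^ (-(2 * lam * p)) * (2 * (a ^ (-q) + b ^ (-q))) := by
      calc _ ≤ (C₁ * (b⁻¹ * (a + b) ^ (-(2 * lam)) * (a ^ (-(α + 1)) + b ^ (-(α + 1))))) ^ p := by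
            gcongr
        _ = C₁ ^ p * (a + b) ^ (-(2 * lam * p)) *
            (b⁻¹ * (a ^ (-(α + 1)) + b ^ (-(α + 1)))) ^ p := by
            rw [← neg_mul (2 * lam) p, Real.rpow_mul hS.le (-(2 * lam)) p,
              ← Real.mul_rpow (by positivity) (by positivity),
              ← Real.mul_rpow (by positivity) (by positivity)]
            congr 1; ring
        _ ≤ _ := by
            gcongr
            exact inv_rpow_mul_add_rpow_le hp hp1 (by linarith) ha hb
    have e2 : |Real.sin φ| ^ (2 * lam) * (a + b) ^ (-(2 * lam * p)) ≤ |Real.sin φ| ^ κ := by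
      rw [show 2 * lam = κ + 2 * lam * p by rw [hκd]; ring,
        Real.rpow_add_of_nonneg (abs_nonneg _) hκ (by positivity), mul_assoc,
        show κ + 2 * lam * p = 2 * lam by rw [hκd]; ring]
      refine mul_le_of_le_one_right (by positivity) ?_
      rw [Real.rpow_neg hS.le, ← div_eq_mul_inv, div_le_one (by positivity)]
      gcongr
    calc _ ≤ |Real.sin φ| ^ (2 * lam) *
          (C₁ ^ p * (a + b) ^ (-(2 * lam * p)) * (2 * (a ^ (-q) + b ^ (-q)))) := by gcongr
      _ = C₁ ^ p * 2 * ((|Real.sin φ| ^ (2 * lam) * (a + b) ^ (-(2 * lam * p))) *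
          (a ^ (-q) + b ^ (-q))) := by ring
      _ ≤ C₁ ^ p * 2 * (|Real.sin φ| ^ κ * (a ^ (-q) + b ^ (-q))) := by gcongr
      _ = _ := by ring
  have hsin : ∀ {x : ℝ}, 0 ≤ x → Continuous fun φ : ℝ => |Real.sin φ| ^ x := fun hx =>
    Continuous.rpow_const (by fun_prop) fun _ => Or.inr hx
  have hi : ∀ ζ : ℂ, ‖ζ‖ < 1 → IntegrableOn (fun φ : ℝ => |Real.sin φ| ^ κ *
      ‖1 - ζ * Complex.exp ((φ : ℂ) * Complex.I)‖ ^ (-q)) (Ioc (-Real.pi) Real.pi) :=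
    fun ζ hζ => Continuous.integrableOn_Ioc
      ((hsin hκ).mul (continuous_norm_one_sub_mul_exp_rpow hζ (-q)))
  have hI := setIntegral_mono (Continuous.integrableOn_Ioc
    ((hsin (by linarith : 0 ≤ 2 * lam)).mul hcont))
    (((hi _ hszc).add (hi _ hsz1)).const_mul (C₁ ^ p * 2)) hpt
  rw [integral_const_mul, integral_add' (hi _ hszc) (hi _ hsz1)] at hI
  have hc := h₂ _ hszc
  have hd := h₂ _ hsz1
  rw [RCLike.norm_conj, ← map_pow, show 1 - conj (((s : ℂ) * z) ^ 2) =
    conj (1 - ((s : ℂ) * z) ^ 2) by simp, RCLike.norm_conj] at hc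
  rw [hsz, mul_pow] at hc hd
  have hr : 0 < 1 - s * ‖z‖ := by rw [← hsz]; linarith
  rw [div_eq_mul_inv (_ ^ κ), ← Real.rpow_neg hr.le,
    show -((2 + α) * p - 1) = 1 - q by rw [hqd]; ring]
  set X := ‖1 - (s : ℂ) ^ 2 * z ^ 2‖ ^ κ * (1 - s * ‖z‖) ^ (1 - q) with hX
  have hX0 : 0 ≤ X := by positivity
  calc _ ≤ k * (C₁ ^ p * 2 * (C₂ * X + C₂ * X)) := by
        refine mul_le_mul_of_nonneg_left (hI.trans ?_) hk
        gcongr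
    _ = k * (C₁ ^ p * 2 * (2 * C₂)) * X := by ring
    _ ≤ _ := by gcongr; linarith

/-! ### Convergence up to the boundary -/

/-- The coefficients `(x)_n / n!` with `0 < x < 1` decrease to `0` with differences
`(1 - x) (x)_n / (n! (n + 1))`. -/
lemma summable_binomCoeff_div {x : ℝ} (hx0 : 0 < x) (hx1 : x < 1) :
    Summable fun n : ℕ => binomCoeff x n / ((n : ℝ) + 1) := by
  have h1 : 0 < 1 - x := by linarith
  refine summable_of_sum_range_le (c := (1 - x)⁻¹)
    (fun n => div_nonneg (binomCoeff_nonneg hx0.le n) (by positivity)) fun N => ?_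
  have hd : ∀ n : ℕ, binomCoeff x n / ((n : ℝ) + 1) =
      (1 - x)⁻¹ * (binomCoeff x n - binomCoeff x (n + 1)) := fun n => by
    have h := binomCoeff_succ x n
    have h2 : (n : ℝ) + 1 ≠ 0 := by positivity
    rw [← eq_div_iff h2] at h
    rw [h]
    field_simp
    ring
  simp_rw [hd]
  rw [← Finset.mul_sum, Finset.sum_range_sub']
  have h0 : binomCoeff x 0 = 1 := by simp [binomCoeff, poch_zero]
  rw [h0]
  refine mul_le_of_le_one_right (by positivity) ?_
  linarith [binomCoeff_nonneg hx0.le N]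

/-- For `-2 lam - 2 < β < -2 lam - 1` the coefficients of the variant kernel are summable. -/
lemma summable_gammaRatio_mul_binomCoeff_of_lt {lam β : ℝ} (hlam : 0 ≤ lam)
    (h1 : -(2 * lam) - 2 < β) (h2 : β < -(2 * lam) - 1) :
    Summable fun n => gammaRatio (2 * lam + 2) β n * binomCoeff (2 * lam + 1) n := by
  set x := β + 2 * lam + 2 with hx
  have hx0 : 0 < x := by linarith
  have hG := Real.Gamma_pos_of_pos hx0
  have hG1 := Real.Gamma_pos_of_pos (by linarith : 0 < 2 * lam + 1)
  have hs := (summable_binomCoeff_div hx0 (by linarith)).mul_left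
    (Real.Gamma x / Real.Gamma (2 * lam + 1))
  refine hs.of_nonneg_of_le (fun n => mul_nonneg (gammaRatio_pos (by linarith) (by linarith) n).le
    (binomCoeff_nonneg (by linarith) n)) fun n => ?_
  have e1 : Real.Gamma (n + (2 * lam + 2) + β) = poch x n * Real.Gamma x := by
    rw [← Gamma_add_nat]
    · congr 1; rw [hx]; ring
    · exact hx0
  have e2 : Real.Gamma (n + (2 * lam + 2)) =
      (2 * lam + 1 + n) * (poch (2 * lam + 1) n * Real.Gamma (2 * lam + 1)) := by
    rw [← Gamma_add_nat (by linarith : 0 < 2 * lam + 1), ← Real.Gamma_add_one (by positivity)]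
    congr 1; ring
  have hp := poch_pos (by linarith : 0 < 2 * lam + 1) n
  have hpx := poch_pos hx0 n
  -- the quotient `(2 lam + 1)_n / Γ(n + 2 lam + 2)` leaves the factor `1 / (2 lam + 1 + n)`
  have e3 : gammaRatio (2 * lam + 2) β n * binomCoeff (2 * lam + 1) n =
      Real.Gamma x / Real.Gamma (2 * lam + 1) * (binomCoeff x n / (2 * lam + 1 + n)) := by
    rw [gammaRatio, e1, e2, binomCoeff, binomCoeff]
    have : (2 * lam + 1 + n : ℝ) ≠ 0 := by positivity
    field_simp
  rw [e3]
  have := binomCoeff_nonneg hx0.le n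
  gcongr _ * (_ / ?_)
  linarith

/-- The bound of the terms of the variant kernel, uniform for `|z w| ≤ 1`. -/
lemma norm_variantTerm_le {lam β : ℝ} (hlam : 0 ≤ lam) (h1 : -(2 * lam) - 2 < β) (n : ℕ)
    {z w : ℂ} (h : ‖z * w‖ ≤ 1) :
    ‖variantTerm lam β z w n‖ ≤ gammaRatio (2 * lam + 2) β n * binomCoeff (2 * lam + 1) n := by
  rw [variantTerm_eq]
  refine (norm_gammaRatio_mul_phi_le hlam (by linarith) (by linarith) n z w).trans ?_
  refine mul_le_mul_of_nonneg_left ?_ (gammaRatio_pos (by linarith) (by linarith) n).le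
  exact mul_le_of_le_one_right (binomCoeff_nonneg (by linarith) n)
    (pow_le_one₀ (norm_nonneg _) h)

lemma continuousOn_variantKernel {lam β : ℝ} (hlam : 0 ≤ lam) (h1 : -(2 * lam) - 2 < β)
    (h2 : β < -(2 * lam) - 1) : ContinuousOn (fun q : ℂ × ℂ => variantKernel lam β q.1 q.2)
      {q : ℂ × ℂ | ‖q.1 * q.2‖ ≤ 1} := by
  refine continuousOn_tsum (fun n => Continuous.continuousOn ?_)
    (summable_gammaRatio_mul_binomCoeff_of_lt hlam h1 h2)
    fun n q hq => norm_variantTerm_le hlam h1 n hq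
  simp only [variantTerm_eq]
  exact continuous_const.mul (((continuous_phi lam n).comp continuous_fst).mul
    (Complex.continuous_conj.comp ((continuous_phi lam n).comp continuous_snd)))

end DunklDisk

end

theorem mainTheorem7 (lam : ℝ) (hlam : 0 ≤ lam) :
    -- the pointwise estimate of the (lam, α)-Bergman kernel
    (∀ α : ℝ, -1 < α →
      (∀ z w : ℂ, ‖z * w‖ < 1 → Summable fun n => ‖DunklDisk.bergmanTerm lam α z w n‖) ∧
      ∃ C : ℝ, 0 < C ∧ ∀ z w : ℂ, ‖z‖ < 1 → ‖w‖ < 1 →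
        ‖DunklDisk.bergmanKernel lam α z w‖ ≤
          C * (‖1 - z * w‖⁻¹ *
            (‖1 - z * starRingEnd ℂ w‖ + ‖1 - z * w‖) ^ (-(2 * lam)) *
            (‖1 - z * starRingEnd ℂ w‖ ^ (-(α + 1)) + ‖1 - z * w‖ ^ (-(α + 1))))) ∧
    -- the p-mean estimate
    (∀ p α : ℝ, 0 < p → p ≤ 1 → (2 * lam + 1) * (1 / p - 1) - 1 < α →
      ∃ C : ℝ, 0 < C ∧ ∀ (z : ℂ) (s : ℝ), ‖z‖ < 1 → 0 ≤ s → s < 1 →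
        MeasureTheory.Integrable
          (fun φ : ℝ => ‖DunklDisk.bergmanKernel lam α z
            ((s : ℂ) * Complex.exp ((φ : ℂ) * Complex.I))‖ ^ p)
          (DunklDisk.circleMeasure lam) ∧
        ∫ φ : ℝ, ‖DunklDisk.bergmanKernel lam α z
            ((s : ℂ) * Complex.exp ((φ : ℂ) * Complex.I))‖ ^ p
            ∂(DunklDisk.circleMeasure lam) ≤
          C * (‖1 - (s : ℂ) ^ 2 * z ^ 2‖ ^ (2 * lam * (1 - p)) /
            (1 - s * ‖z‖) ^ ((2 + α) * p - 1))) ∧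
    -- absolute convergence of the series of the variant kernels
    (∀ β : ℝ, -(2 * lam) - 2 < β → ∀ z w : ℂ, ‖z * w‖ < 1 →
      Summable fun n => ‖DunklDisk.variantTerm lam β z w n‖) ∧
    -- the range β > 0
    (∀ β : ℝ, 0 < β → ∃ C : ℝ, 0 < C ∧ ∀ z w : ℂ, ‖z‖ < 1 → ‖w‖ < 1 →
      ‖DunklDisk.variantKernel lam β z w‖ ≤
        C * ((‖1 - z * starRingEnd ℂ w‖ + ‖1 - z * w‖) ^ (-(2 * lam)) /
            ‖1 - z * starRingEnd ℂ w‖ *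
          (1 / ‖1 - z * starRingEnd ℂ w‖ ^ β + 1 / ‖1 - z * w‖ ^ β))) ∧
    -- β = 0
    (∃ C : ℝ, 0 < C ∧ ∀ z w : ℂ, ‖z‖ < 1 → ‖w‖ < 1 →
      ‖DunklDisk.variantKernel lam 0 z w‖ ≤
        C * ((‖1 - z * starRingEnd ℂ w‖ + ‖1 - z * w‖) ^ (-(2 * lam)) /
            ‖1 - z * starRingEnd ℂ w‖ *
          Real.log (‖1 - z * starRingEnd ℂ w‖ / ‖1 - z * w‖ + 2))) ∧
    -- the range -1 < β < 0
    (∀ β : ℝ, -1 < β → β < 0 → ∃ C : ℝ, 0 < C ∧ ∀ z w : ℂ, ‖z‖ < 1 → ‖w‖ < 1 →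
      ‖DunklDisk.variantKernel lam β z w‖ ≤
        C * ((‖1 - z * starRingEnd ℂ w‖ + ‖1 - z * w‖) ^ (-(2 * lam)) /
          ‖1 - z * starRingEnd ℂ w‖ ^ (β + 1))) ∧
    -- β = -1
    (0 < lam → ∃ C : ℝ, 0 < C ∧ ∀ z w : ℂ, ‖z‖ < 1 → ‖w‖ < 1 →
      ‖DunklDisk.variantKernel lam (-1) z w‖ ≤
        C * ((‖1 - z * starRingEnd ℂ w‖ + ‖1 - z * w‖) ^ (-(2 * lam)) *
          Real.log (‖1 - z * w‖ / ‖1 - z * starRingEnd ℂ w‖ + 2))) ∧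
    -- the range -2 lam - 1 < β < -1
    (∀ β : ℝ, -(2 * lam) - 1 < β → β < -1 →
      ∃ C : ℝ, 0 < C ∧ ∀ z w : ℂ, ‖z‖ < 1 → ‖w‖ < 1 →
        ‖DunklDisk.variantKernel lam β z w‖ ≤
          C * (‖1 - z * starRingEnd ℂ w‖ + ‖1 - z * w‖) ^ (-β - 2 * lam - 1)) ∧
    -- β = -2 lam - 1
    (0 < lam → ∃ C : ℝ, 0 < C ∧ ∀ z w : ℂ, ‖z‖ < 1 → ‖w‖ < 1 →
      ‖DunklDisk.variantKernel lam (-(2 * lam) - 1) z w‖ ≤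
        C * Real.log (1 / (‖1 - z * starRingEnd ℂ w‖ + ‖1 - z * w‖) + 2)) ∧
    -- the range -2 lam - 2 < β < -2 lam - 1
    (∀ β : ℝ, -(2 * lam) - 2 < β → β < -(2 * lam) - 1 →
      (∀ z w : ℂ, ‖z * w‖ ≤ 1 → Summable fun n => ‖DunklDisk.variantTerm lam β z w n‖) ∧
      ContinuousOn (fun q : ℂ × ℂ => DunklDisk.variantKernel lam β q.1 q.2)
        {q : ℂ × ℂ | ‖q.1 * q.2‖ ≤ 1}) := by
  refine ⟨fun α hα => ⟨fun z w h => ?_, DunklDisk.exists_norm_bergmanKernel_le hlam hα⟩,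
    fun p α hp hp1 hα => DunklDisk.exists_integral_norm_bergmanKernel_rpow_le hlam hp hp1 hα,
    fun β hβ z w h => ?_, fun β hβ => ?_, ?_, fun β h1 h2 => ?_, fun h0 => ?_, fun β h1 h2 => ?_,
    fun h0 => ?_, fun β h1 h2 => ⟨fun z w h => ?_, DunklDisk.continuousOn_variantKernel hlam h1 h2⟩⟩
  · simp only [DunklDisk.bergmanTerm_eq, norm_mul (((_ / _ : ℝ) : ℂ))]
    have := DunklDisk.summable_norm_kernelSum hlam (γ := lam + 1) (β := α + 1) (by linarith)
      (by linarith) (z := z) (w := starRingEnd ℂ w) (by rwa [DunklDisk.norm_mul_conj])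
    exact this.mul_left _
  · simp only [DunklDisk.variantTerm_eq]
    exact DunklDisk.summable_norm_kernelSum hlam (by linarith) (by linarith) h
  · obtain ⟨C, hC, h⟩ := DunklDisk.exists_norm_kernelSum_le_of_pos hlam
      (by linarith : 0 < 2 * lam + 2) hβ (by linarith)
    refine ⟨C, hC, fun z w hz hw => ?_⟩
    have := h z w hz hw
    rwa [Real.rpow_neg (norm_nonneg _), Real.rpow_neg (norm_nonneg _) β, ← one_div (_ ^ β),
      ← one_div (_ ^ β), ← div_eq_mul_inv, ← DunklDisk.variantKernel_eq] at this
  · obtain ⟨C, hC, h⟩ := DunklDisk.exists_norm_kernelSum_le_of_zero hlam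
      (by linarith : 0 < 2 * lam + 2)
    exact ⟨C, hC, fun z w hz hw => DunklDisk.variantKernel_eq lam 0 z w ▸ h z w hz hw⟩
  · obtain ⟨C, hC, h⟩ := DunklDisk.exists_norm_kernelSum_le_of_neg hlam
      (by linarith : 0 < 2 * lam + 2) (by linarith) h1 h2
    refine ⟨C, hC, fun z w hz hw => ?_⟩
    have := h z w hz hw
    rwa [Real.rpow_neg (norm_nonneg _) (β + 1), ← div_eq_mul_inv,
      ← DunklDisk.variantKernel_eq] at this
  · obtain ⟨C, hC, h⟩ := DunklDisk.exists_norm_kernelSum_le_of_neg_one h0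
      (by linarith : 0 < 2 * lam + 2) (by linarith)
    exact ⟨C, hC, fun z w hz hw => DunklDisk.variantKernel_eq lam (-1) z w ▸ h z w hz hw⟩
  · obtain ⟨C, hC, h⟩ := DunklDisk.exists_norm_kernelSum_le_of_lt_neg_one hlam
      (by linarith : 0 < 2 * lam + 2) (by linarith) h1 h2
    exact ⟨C, hC, fun z w hz hw => DunklDisk.variantKernel_eq lam β z w ▸ h z w hz hw⟩
  · obtain ⟨C, hC, h⟩ := DunklDisk.exists_norm_kernelSum_le_of_eq_neg_two_mul_sub_one h0
      (by linarith : 0 < 2 * lam + 2) (by linarith)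
    exact ⟨C, hC, fun z w hz hw =>
      DunklDisk.variantKernel_eq lam (-(2 * lam) - 1) z w ▸ h z w hz hw⟩
  · exact (DunklDisk.summable_gammaRatio_mul_binomCoeff_of_lt hlam h1 h2).of_nonneg_of_le
      (fun _ => norm_nonneg _) fun n => DunklDisk.norm_variantTerm_le hlam h1 n h
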